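/- Let $K$ be a field, $Q$ a finite quiver, $I$ an admissible ideal of the path algebra $KQ$ generated by paths, and $\Lambda=KQ/I$ (a monomial algebra), graded by giving every arrow degree one. Modules are finitely generated right modules, $M(j)$ denotes the degree shift $M(j)_k=M_{k+j}$, paths are composed from left to right, and $l(p)$ is the length of a path $p$. A path is non-zero in $\Lambda$ if it does not lie in $I$. A pair $(p,q)$ of non-trivial paths that are non-zero in $\Lambda$, with $q$ starting where $p$ ends, is *perfect* if $pq=0$ in $\Lambda$, every non-zero path $q'$ starting at the end of $p$ with $pq'=0$ in $\Lambda$ has $q$ as a left divisor, and every non-zero path $p'$ ending at the start of $q$ with $p'q=0$ in $\Lambda$ has $p$ as a right divisor. A *perfect path sequence* is a sequence $(p_1,\dots,p_n,p_{n+1}=p_1)$ with all pairs $(p_k,p_{k+1})$ perfect; a *perfect path* is a path occurring in such a sequence. A perfect path is *co-elementary* if it is a sink in the Hasse quiver of the set of perfect paths ordered by left divisibility ($p\preceq q$ if $p$ is a left divisor of $q$; arrows $q\to p$ go from a perfect path $q$ to a perfect path $p\prec q$ with no perfect path strictly in between). An *underlying cycle* is, for some perfect path sequence as above, the shortest cycle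 $c$ with $p_1\cdots p_n=c^{t}$ for some $t>0$. Let $c=r_1\cdots r_n$ be an underlying cycle with all $r_k$ co-elementary. Read the indices modulo $n$ and put $[i,j]=r_ir_{i+1}\cdots r_j$ for integers $i\le j$; let $[i,i-1]$ be the trivial path at the source of $r_i$. For a path $p$, $p\Lambda$ is the graded submodule of $\Lambda$ generated by $p$ (so $p$ has degree $l(p)$, and $p\Lambda=0$ if $p=0$ in $\Lambda$). Let $m_c$ be the number of perfect paths that have $r_1$ as a left divisor. Let $i$ and $m>0$ be integers such that $p=[i,i+m-1]$ is a perfect path. Put $$A_p=[i+1,i+m]\Lambda(-l(r_i)),\qquad B_p=[i+1,i+m-1]\Lambda(-l(r_i))\oplus[i,i+m]\Lambda .$$ Then $A_p$, $B_p$ and $p\Lambda$ are graded Gorenstein-projective, and there is a short exact sequence of graded modules $$0\to A_p\xrightarrow{\left[\begin{smallmatrix}\iota'\\-\pi'\end{smallmatrix}\right]}B_p\xrightarrow{[\pi\ \ \iota]}p\Lambda\to 0,$$ where $\iota',\iota$ are inclusions and $\pi',\pi$ are left multiplication by $r_i$. Moreover the suspension of $A_p$ in the stable category $\underline{\mathrm{Gproj}}^{\mathbb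 Z}\Lambda$ of graded Gorenstein-projective modules is $$\Sigma A_p=[i+m-m_c,i]\,\Lambda\bigl(l([i+m-m_c,i-1])\bigr),$$ by means of the exact sequence $0\to A_p\to e\Lambda(-l(r_i))\to\Sigma A_p\to0$, where $e$ is the trivial path at the target of $r_i$, the first map is the inclusion and the second is left multiplication by $[i+m-m_c,i]$. With this identification, $$A_p\xrightarrow{\left[\begin{smallmatrix}\iota'\\-\pi'\end{smallmatrix}\right]}B_p\xrightarrow{[\pi\ \ \iota]}p\Lambda\xrightarrow{\ \xi\ }\Sigma A_p ,$$ where $\xi$ is the class of left multiplication by $[i+m-m_c,i-1]$ (it sends $p$ to $[i+m-m_c,i+m-1]$), is an Auslander–Reiten triangle in $\underline{\mathrm{Gproj}}^{\mathbb Z}\Lambda$. That is, it is a distinguished triangle (isomorphic to one induced by a short exact sequence of graded Gorenstein-projective modules), $A_p$ and $p\Lambda$ are indecomposable in $\underline{\mathrm{Gproj}}^{\mathbb Z}\Lambda$, $\xi\neq0$, and every morphism $W\to p\Lambda$ in $\underline{\mathrm{Gproj}}^{\mathbb Z}\Lambda$ that is not a retraction factors through $[\pi\ \ \iota]$. -/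

import Mathlib

open CategoryTheory CategoryTheory.Limits

universe w u v

namespace MonAlg

/-! ### Path algebras and monomial algebras -/

section PathAlgebra

variable (K : Type w) [Field K] (V : Type u) [Quiver.{v} V]

/-- The set of all paths of the quiver `V`: source, target, and a path between them. -/
abbrev TPath : Type (max u v) := Σ a b : V, Quiver.Path a b

variable {V} in
/-- A path, regarded as an element of the set of all paths. -/
abbrev tot {a b : V} (p : Quiver.Path a b) : TPath V := ⟨a, b, p⟩

variable {V} in
/-- The length of a path. -/
def TPath.len (x : TPath V) : ℕ := x.2.2.length

/-- The path algebra `KV`: the vector space with basis the set of paths, the product of two paths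
being their concatenation (read from left to right) if this is defined, and zero otherwise. -/
def PathAlg : Type (max u v w) := TPath V →₀ K

noncomputable instance : AddCommGroup (PathAlg K V) := inferInstanceAs (AddCommGroup (TPath V →₀ K))
noncomputable instance : Module K (PathAlg K V) := inferInstanceAs (Module K (TPath V →₀ K))

variable {V}

/-- The basis element of the path algebra given by a path. -/
noncomputable def ofPath (x : TPath V) : PathAlg K V := Finsupp.single x (1 : K)

open Classical in
/-- The product of two paths in the path algebra. -/
noncomputable def pathMul (x y : TPath V) : PathAlg K V :=
  if h : x.2.1 = y.1 then ofPath K (tot (x.2.2.comp (y.2.2.cast h.symm rfl))) else 0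

theorem pathMul_comp {a b c : V} (p : Quiver.Path a b) (q : Quiver.Path b c) :
    pathMul K (tot p) (tot q) = ofPath K (tot (p.comp q)) := by
  simp [pathMul]

theorem pathMul_of_ne {x y : TPath V} (h : x.2.1 ≠ y.1) : pathMul K x y = 0 := by
  simp [pathMul, h]

/-- The multiplication of the path algebra, as a bilinear map. -/
noncomputable def mulBilin : PathAlg K V →ₗ[K] PathAlg K V →ₗ[K] PathAlg K V :=
  Finsupp.linearCombination K (fun x : TPath V =>
    (Finsupp.linearCombination K (fun y : TPath V => pathMul K x y) :
      (TPath V →₀ K) →ₗ[K] PathAlg K V))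

theorem linearCombination_ofPath {M : Type*} [AddCommGroup M] [Module K M] (f : TPath V → M)
    (x : TPath V) :
    (Finsupp.linearCombination K f : (TPath V →₀ K) →ₗ[K] M) (ofPath K x) = f x :=
  (Finsupp.linearCombination_single K (1 : K) x).trans (one_smul K _)

theorem mulBilin_ofPath (x y : TPath V) :
    mulBilin K (ofPath K x) (ofPath K y) = pathMul K x y :=
  (LinearMap.congr_fun (linearCombination_ofPath K _ x) (ofPath K y)).trans
    (linearCombination_ofPath K _ y)

variable {K} in
theorem PathAlg.induction {P : PathAlg K V → Prop} (x : PathAlg K V) (h0 : P 0)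
    (hadd : ∀ x y, P x → P y → P (x + y)) (hs : ∀ (a : K) (x : TPath V), P (a • ofPath K x)) :
    P x := by
  refine Finsupp.induction_linear (motive := P) x h0 hadd fun y a => ?_
  have := hs a y
  have e : a • ofPath K y = (Finsupp.single y a : TPath V →₀ K) := by
    show a • (Finsupp.single y (1 : K) : TPath V →₀ K) = _
    simp
  rwa [e] at this

theorem mulBilin_assoc (x y z : PathAlg K V) :
    mulBilin K (mulBilin K x y) z = mulBilin K x (mulBilin K y z) := by
  induction x using PathAlg.induction with
  | h0 => simp
  | hadd x x' hx hx' => simp [hx, hx']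
  | hs a x =>
  induction y using PathAlg.induction with
  | h0 => simp
  | hadd x x' hx hx' => simp only [map_add, LinearMap.add_apply, hx, hx']
  | hs b y =>
  induction z using PathAlg.induction with
  | h0 => simp
  | hadd x x' hx hx' => simp only [map_add, hx, hx']
  | hs c z =>
  simp only [map_smul, LinearMap.smul_apply, mulBilin_ofPath]
  obtain ⟨x1, x2, p⟩ := x
  obtain ⟨y1, y2, q⟩ := y
  obtain ⟨z1, z2, r⟩ := z
  by_cases h1 : x2 = y1
  · subst h1
    by_cases h2 : y2 = z1
    · subst h2
      rw [pathMul_comp, pathMul_comp, mulBilin_ofPath, mulBilin_ofPath, pathMul_comp,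
        pathMul_comp, Quiver.Path.comp_assoc]
    · rw [pathMul_comp, mulBilin_ofPath, pathMul_of_ne K (by exact h2),
        pathMul_of_ne K (by exact h2)]
      simp
  · by_cases h2 : y2 = z1
    · subst h2
      rw [pathMul_comp, mulBilin_ofPath, pathMul_of_ne K (by exact h1),
        pathMul_of_ne K (by exact h1)]
      simp
    · rw [pathMul_of_ne K (by exact h1), pathMul_of_ne K (by exact h2)]
      simp

variable [Fintype V]

/-- The unit of the path algebra: the sum of the trivial paths. -/
noncomputable def pathOne : PathAlg K V :=
  ∑ a : V, ofPath K (tot (Quiver.Path.nil : Quiver.Path a a))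

theorem pathOne_mul (x : PathAlg K V) : mulBilin K (pathOne K) x = x := by
  induction x using PathAlg.induction with
  | h0 => simp
  | hadd x x' hx hx' => rw [map_add, hx, hx']
  | hs a x =>
  obtain ⟨x1, x2, p⟩ := x
  rw [map_smul, pathOne, map_sum, LinearMap.sum_apply, Finset.sum_eq_single x1]
  · rw [mulBilin_ofPath, pathMul_comp, Quiver.Path.nil_comp]
  · intro b _ hb
    rw [mulBilin_ofPath, pathMul_of_ne K (by exact hb)]
  · simp

theorem mul_pathOne (x : PathAlg K V) : mulBilin K x (pathOne K) = x := by
  induction x using PathAlg.induction with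
  | h0 => simp
  | hadd x x' hx hx' => rw [map_add, LinearMap.add_apply, hx, hx']
  | hs a x =>
  obtain ⟨x1, x2, p⟩ := x
  rw [map_smul, LinearMap.smul_apply, pathOne, map_sum, Finset.sum_eq_single x2]
  · rw [mulBilin_ofPath, pathMul_comp, Quiver.Path.comp_nil]
  · intro b _ hb
    rw [mulBilin_ofPath, pathMul_of_ne K (by exact hb.symm)]
  · simp

noncomputable instance : Ring (PathAlg K V) where
  __ := (inferInstance : AddCommGroup (PathAlg K V))
  mul x y := mulBilin K x y
  one := pathOne K
  left_distrib x y z := map_add (mulBilin K x) y z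
  right_distrib x y z := by
    show mulBilin K (x + y) z = mulBilin K x z + mulBilin K y z
    rw [map_add, LinearMap.add_apply]
  zero_mul x := by show mulBilin K 0 x = 0; simp
  mul_zero x := by show mulBilin K x 0 = 0; simp
  mul_assoc := mulBilin_assoc K
  one_mul := pathOne_mul K
  mul_one := mul_pathOne K

theorem PathAlg.mul_def (x y : PathAlg K V) : x * y = mulBilin K x y := rfl

noncomputable instance : Algebra K (PathAlg K V) :=
  Algebra.ofModule
    (fun a x y => by rw [PathAlg.mul_def, PathAlg.mul_def, map_smul, LinearMap.smul_apply])
    (fun a x y => by rw [PathAlg.mul_def, PathAlg.mul_def, map_smul])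

/-- The two-sided ideal of the path algebra generated by a set `S` of paths. -/
noncomputable def relIdeal (S : Set (TPath V)) : TwoSidedIdeal (PathAlg K V) :=
  TwoSidedIdeal.span (ofPath K '' S)

/-- The ideal generated by the set `S` of paths is admissible, i.e. contained in the square of the
arrow ideal and containing some power of the arrow ideal. -/
def IsAdmissible (S : Set (TPath V)) : Prop :=
  (∀ x ∈ S, 2 ≤ x.len) ∧ ∃ N : ℕ, ∀ x : TPath V, N ≤ x.len → ofPath K x ∈ relIdeal K S

/-- The algebra `KV/I`, where `I` is the ideal generated by the set `S` of paths. -/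
def Alg (S : Set (TPath V)) : Type (max u v w) := (relIdeal K S).ringCon.Quotient

variable (S : Set (TPath V))

noncomputable instance : Ring (Alg K S) := inferInstanceAs (Ring (relIdeal K S).ringCon.Quotient)
noncomputable instance : Algebra K (Alg K S) :=
  inferInstanceAs (Algebra K (relIdeal K S).ringCon.Quotient)

/-- The canonical projection from the path algebra. -/
noncomputable def Alg.mk : PathAlg K V →+* Alg K S := (relIdeal K S).ringCon.mk'

/-- The class in the algebra `KV/I` of a path. -/
noncomputable def cls {a b : V} (p : Quiver.Path a b) : Alg K S := Alg.mk K S (ofPath K (tot p))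

/-- The homogeneous component of degree `i` of `KV/I`, every arrow having degree one: the span of
the classes of the paths of length `i`. -/
noncomputable def algDeg (i : ℤ) : Submodule K (Alg K S) :=
  Submodule.span K {y | ∃ x : TPath V, (x.len : ℤ) = i ∧ Alg.mk K S (ofPath K x) = y}

/-! The remaining facts of this section show that these components form a grading. -/

theorem Alg.mk_surjective : Function.Surjective (Alg.mk K S) := RingCon.mk'_surjective _

theorem Alg.mk_eq_zero {x : PathAlg K V} : Alg.mk K S x = 0 ↔ x ∈ relIdeal K S := by
  rw [← map_zero (Alg.mk K S)]
  exact (RingCon.eq _).trans (by rw [TwoSidedIdeal.mem_iff])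

theorem Alg.mk_smul (a : K) (x : PathAlg K V) : Alg.mk K S (a • x) = a • Alg.mk K S x := rfl

open Classical in
/-- The projection of the path algebra to its component of degree `i`. -/
noncomputable def pathProj (i : ℤ) : PathAlg K V →ₗ[K] PathAlg K V :=
  Finsupp.linearCombination K (fun x : TPath V => if (x.len : ℤ) = i then ofPath K x else 0)

open Classical in
theorem pathProj_ofPath (i : ℤ) (x : TPath V) :
    pathProj K i (ofPath K x) = if (x.len : ℤ) = i then ofPath K x else 0 :=
  linearCombination_ofPath K _ x

theorem pathProj_mul_left (i : ℤ) (x : TPath V) (m : PathAlg K V) :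
    pathProj K i (ofPath K x * m) = ofPath K x * pathProj K (i - x.len) m := by
  induction m using PathAlg.induction with
  | h0 => simp
  | hadd y z hy hz => rw [mul_add, map_add, hy, hz, map_add, mul_add]
  | hs a y =>
  rw [mul_smul_comm, map_smul, map_smul, mul_smul_comm, pathProj_ofPath]
  congr 1
  obtain ⟨x1, x2, p⟩ := x
  obtain ⟨y1, y2, q⟩ := y
  by_cases h : x2 = y1
  · subst h
    have : ((tot p).len : ℤ) + (tot q).len = (tot (p.comp q)).len := by simp [TPath.len]
    simp only [PathAlg.mul_def, mulBilin_ofPath, pathMul_comp, pathProj_ofPath]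
    by_cases h' : ((tot q).len : ℤ) = i - (tot p).len
    · rw [if_pos (by omega), if_pos h', mulBilin_ofPath, pathMul_comp]
    · rw [if_neg (by omega), if_neg h', map_zero]
  · have h0 := pathMul_of_ne K (x := tot p) (y := tot q) h
    split_ifs <;> simp [PathAlg.mul_def, mulBilin_ofPath, h0]

theorem pathProj_mul_right (i : ℤ) (x : TPath V) (m : PathAlg K V) :
    pathProj K i (m * ofPath K x) = pathProj K (i - x.len) m * ofPath K x := by
  induction m using PathAlg.induction with
  | h0 => simp
  | hadd y z hy hz => rw [add_mul, map_add, hy, hz, map_add, add_mul]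
  | hs a y =>
  rw [smul_mul_assoc, map_smul, map_smul, smul_mul_assoc, pathProj_ofPath]
  congr 1
  obtain ⟨x1, x2, p⟩ := x
  obtain ⟨y1, y2, q⟩ := y
  by_cases h : y2 = x1
  · subst h
    have : ((tot q).len : ℤ) + (tot p).len = (tot (q.comp p)).len := by simp [TPath.len]
    simp only [PathAlg.mul_def, mulBilin_ofPath, pathMul_comp, pathProj_ofPath]
    by_cases h' : ((tot q).len : ℤ) = i - (tot p).len
    · rw [if_pos (by omega), if_pos h', mulBilin_ofPath, pathMul_comp]
    · rw [if_neg (by omega), if_neg h', map_zero, LinearMap.zero_apply]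
  · have h0 := pathMul_of_ne K (x := tot q) (y := tot p) h
    split_ifs <;> simp [PathAlg.mul_def, mulBilin_ofPath, h0]

theorem smul_mem_relIdeal (a : K) {x : PathAlg K V} (hx : x ∈ relIdeal K S) :
    a • x ∈ relIdeal K S := by
  rw [← one_mul x, ← smul_mul_assoc]
  exact TwoSidedIdeal.mul_mem_left _ _ _ hx

theorem pathProj_mem (x : PathAlg K V) (hx : x ∈ relIdeal K S) :
    ∀ i, pathProj K i x ∈ relIdeal K S := by
  induction hx using TwoSidedIdeal.span_induction with
  | mem x h =>
    obtain ⟨y, hy, rfl⟩ := h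
    intro i
    rw [pathProj_ofPath]
    split_ifs
    · exact TwoSidedIdeal.subset_span ⟨y, hy, rfl⟩
    · exact TwoSidedIdeal.zero_mem _
  | zero => intro i; rw [map_zero]; exact TwoSidedIdeal.zero_mem _
  | add x y _ _ hx hy => intro i; rw [map_add]; exact TwoSidedIdeal.add_mem _ (hx i) (hy i)
  | neg x _ hx => intro i; rw [map_neg]; exact TwoSidedIdeal.neg_mem _ (hx i)
  | left_absorb a x _ hx =>
    induction a using PathAlg.induction with
    | h0 => intro i; rw [zero_mul, map_zero]; exact TwoSidedIdeal.zero_mem _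
    | hadd y z hy hz =>
      intro i; rw [add_mul, map_add]; exact TwoSidedIdeal.add_mem _ (hy i) (hz i)
    | hs a y =>
      intro i
      rw [smul_mul_assoc, map_smul, pathProj_mul_left]
      exact smul_mem_relIdeal K S a (TwoSidedIdeal.mul_mem_left _ _ _ (hx _))
  | right_absorb a x _ hx =>
    induction a using PathAlg.induction with
    | h0 => intro i; rw [mul_zero, map_zero]; exact TwoSidedIdeal.zero_mem _
    | hadd y z hy hz =>
      intro i; rw [mul_add, map_add]; exact TwoSidedIdeal.add_mem _ (hy i) (hz i)
    | hs a y =>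
      intro i
      rw [mul_smul_comm, map_smul, pathProj_mul_right]
      exact smul_mem_relIdeal K S a (TwoSidedIdeal.mul_mem_right _ _ _ (hx _))

/-- The projection of `KV/I` to its component of degree `i`. -/
noncomputable def algProj (i : ℤ) : Alg K S →+ Alg K S where
  toFun := Quotient.lift (fun x => Alg.mk K S (pathProj K i x)) (by
    intro x y h
    have h' : x - y ∈ relIdeal K S := (TwoSidedIdeal.rel_iff _ _ _).1 h
    have := pathProj_mem K S _ h' i
    rw [← Alg.mk_eq_zero, map_sub, map_sub, sub_eq_zero] at this
    exact this)
  map_zero' := by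
    show Alg.mk K S (pathProj K i 0) = 0
    rw [map_zero, map_zero]
  map_add' := by
    intro x y
    obtain ⟨x, rfl⟩ := Alg.mk_surjective K S x
    obtain ⟨y, rfl⟩ := Alg.mk_surjective K S y
    show Alg.mk K S (pathProj K i (x + y)) = _
    rw [map_add, map_add]
    rfl

theorem algProj_mk (i : ℤ) (x : PathAlg K V) :
    algProj K S i (Alg.mk K S x) = Alg.mk K S (pathProj K i x) := rfl

theorem algProj_mem (i : ℤ) (x : Alg K S) : algProj K S i x ∈ algDeg K S i := by
  obtain ⟨x, rfl⟩ := Alg.mk_surjective K S x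
  rw [algProj_mk]
  induction x using PathAlg.induction with
  | h0 => rw [map_zero, map_zero]; exact Submodule.zero_mem _
  | hadd x y hx hy => rw [map_add, map_add]; exact Submodule.add_mem _ hx hy
  | hs a x =>
    rw [map_smul, pathProj_ofPath, Alg.mk_smul]
    refine Submodule.smul_mem _ _ ?_
    split_ifs with h
    · exact Submodule.subset_span ⟨x, h, rfl⟩
    · rw [map_zero]; exact Submodule.zero_mem _

theorem algProj_smul (i : ℤ) (a : K) (x : Alg K S) :
    algProj K S i (a • x) = a • algProj K S i x := by
  obtain ⟨x, rfl⟩ := Alg.mk_surjective K S x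
  rw [algProj_mk, ← Alg.mk_smul, ← Alg.mk_smul, algProj_mk, map_smul]

theorem algProj_of_mem (i : ℤ) {x : Alg K S} (hx : x ∈ algDeg K S i) : algProj K S i x = x := by
  induction hx using Submodule.span_induction with
  | mem y h =>
    obtain ⟨x, h, rfl⟩ := h
    rw [algProj_mk, pathProj_ofPath, if_pos h]
  | zero => exact map_zero _
  | add x y _ _ hx hy => rw [map_add, hx, hy]
  | smul a x _ hx => rw [algProj_smul, hx]

theorem algProj_of_mem_ne {i j : ℤ} (hij : i ≠ j) {x : Alg K S} (hx : x ∈ algDeg K S j) :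
    algProj K S i x = 0 := by
  induction hx using Submodule.span_induction with
  | mem y h =>
    obtain ⟨x, h, rfl⟩ := h
    rw [algProj_mk, pathProj_ofPath, if_neg (by omega), map_zero]
  | zero => exact map_zero _
  | add x y _ _ hx hy => rw [map_add, hx, hy, add_zero]
  | smul a x _ hx => rw [algProj_smul, hx, smul_zero]

theorem algProj_sum (x : Alg K S) :
    ∃ s : Finset ℤ, ∀ t, s ⊆ t → ∑ i ∈ t, algProj K S i x = x := by
  obtain ⟨x, rfl⟩ := Alg.mk_surjective K S x
  classical
  induction x using PathAlg.induction with
  | h0 => exact ⟨∅, fun t _ => by simp⟩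
  | hadd x y hx hy =>
    obtain ⟨s, hs⟩ := hx
    obtain ⟨s', hs'⟩ := hy
    refine ⟨s ∪ s', fun t ht => ?_⟩
    simp only [map_add, Finset.sum_add_distrib]
    rw [hs t (Finset.union_subset_left ht), hs' t (Finset.union_subset_right ht)]
  | hs a x =>
    refine ⟨{(x.len : ℤ)}, fun t ht => ?_⟩
    rw [Finset.sum_eq_single (x.len : ℤ)]
    · rw [algProj_mk, map_smul, pathProj_ofPath, if_pos rfl]
    · intro i _ hi
      rw [algProj_mk, map_smul, pathProj_ofPath, if_neg (Ne.symm hi), smul_zero, map_zero]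
    · intro h
      exact absurd (ht (Finset.mem_singleton_self _)) h

theorem algProj_cls_mul (i : ℤ) {a b : V} (p : Quiver.Path a b) (y : Alg K S) :
    algProj K S i (cls K S p * y) = cls K S p * algProj K S (i - p.length) y := by
  obtain ⟨y, rfl⟩ := Alg.mk_surjective K S y
  rw [cls, ← map_mul, algProj_mk, algProj_mk, pathProj_mul_left, map_mul]
  rfl

theorem algDeg_mul {i j : ℤ} {x y : Alg K S} (hx : x ∈ algDeg K S i) (hy : y ∈ algDeg K S j) :
    x * y ∈ algDeg K S (i + j) := by
  induction hx using Submodule.span_induction with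
  | zero => rw [zero_mul]; exact Submodule.zero_mem _
  | add x x' _ _ hx hx' => rw [add_mul]; exact Submodule.add_mem _ hx hx'
  | smul a x _ hx => rw [smul_mul_assoc]; exact Submodule.smul_mem _ _ hx
  | mem x h =>
  obtain ⟨⟨x1, x2, p⟩, h, rfl⟩ := h
  induction hy using Submodule.span_induction with
  | zero => rw [mul_zero]; exact Submodule.zero_mem _
  | add x x' _ _ hx hx' => rw [mul_add]; exact Submodule.add_mem _ hx hx'
  | smul a x _ hx => rw [mul_smul_comm]; exact Submodule.smul_mem _ _ hx
  | mem y h' =>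
  obtain ⟨⟨y1, y2, q⟩, h', rfl⟩ := h'
  rw [← map_mul, PathAlg.mul_def, mulBilin_ofPath]
  by_cases e : x2 = y1
  · subst e
    rw [pathMul_comp]
    refine Submodule.subset_span ⟨_, ?_, rfl⟩
    rw [← h, ← h']
    simp [TPath.len]
  · rw [pathMul_of_ne K (by exact e), map_zero]
    exact Submodule.zero_mem _

end PathAlgebra

/-! ### Perfect paths -/

section PerfectPaths

open Quiver

variable (K : Type w) [Field K] {V : Type u} [Quiver.{v} V] [Fintype V] (S : Set (TPath V))

/-- `(p, q)` is a perfect pair of paths. -/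
structure IsPerfectPair {a b c : V} (p : Path a b) (q : Path b c) : Prop where
  nonzero_left : cls K S p ≠ 0
  nonzero_right : cls K S q ≠ 0
  pos_left : 0 < p.length
  pos_right : 0 < q.length
  comp_eq_zero : cls K S (p.comp q) = 0
  right_minimal : ∀ {d : V} (q' : Path b d), cls K S q' ≠ 0 → cls K S (p.comp q') = 0 →
    ∃ x : Path c d, q' = q.comp x
  left_minimal : ∀ {d : V} (p' : Path d b), cls K S p' ≠ 0 → cls K S (p'.comp q) = 0 →
    ∃ x : Path d a, p' = x.comp p

variable (V) in
/-- A finite cyclic sequence `p₁, …, pₙ` (with `n ≥ 1`) of consecutive paths, `pₙ` being followed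
by `p₁`, extended to all integer indices by reading the indices modulo `n`. -/
structure CyclicSeq where
  n : ℕ
  n_pos : 0 < n
  vert : ℤ → V
  path : ∀ k : ℤ, Path (vert k) (vert (k + 1))
  periodic : ∀ k : ℤ, tot (path (k + n)) = tot (path k)

/-- The path `p_i p_{i+1} ⋯ p_{i+k-1}`, which is trivial for `k = 0`. -/
def CyclicSeq.seg (r : CyclicSeq V) (i : ℤ) : (k : ℕ) → Path (r.vert i) (r.vert (i + k))
  | 0 => (Path.nil : Path (r.vert i) (r.vert i)).cast rfl (by simp)
  | k + 1 => ((r.seg i k).comp (r.path (i + k))).cast rfl (by push_cast; rw [add_assoc])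

/-- The path `[i, j] = p_i p_{i+1} ⋯ p_j`, which is the trivial path at the source of `p_i` if
`j < i`. -/
def CyclicSeq.bracket (r : CyclicSeq V) (i j : ℤ) :
    Path (r.vert i) (r.vert (i + ((j + 1 - i).toNat : ℕ))) :=
  r.seg i (j + 1 - i).toNat

/-- The path `p₁ p₂ ⋯ pₙ`. -/
def CyclicSeq.total (r : CyclicSeq V) : TPath V := tot (r.bracket 1 r.n)

/-- `(p₁, …, pₙ, pₙ₊₁ = p₁)` is a perfect path sequence. -/
def CyclicSeq.IsPerfect (r : CyclicSeq V) : Prop :=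
  ∀ k : ℤ, IsPerfectPair K S (r.path k) (r.path (k + 1))

/-- A perfect path is a path that appears in a perfect path sequence. -/
def IsPerfect (p : TPath V) : Prop :=
  ∃ r : CyclicSeq V, r.IsPerfect K S ∧ ∃ k : ℤ, p = tot (r.path k)

/-- `p` is a left divisor of `q`. -/
def LeftDivisor (p q : TPath V) : Prop :=
  ∃ (a b c : V) (x : Path a b) (y : Path b c), p = tot x ∧ q = tot (x.comp y)

/-- `p ≺ q`: `p` is a proper left divisor of `q`. -/
def ProperLeftDivisor (p q : TPath V) : Prop := LeftDivisor p q ∧ p ≠ q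

/-- There is an arrow from `q` to `p` in the Hasse quiver of the perfect paths ordered by left
divisibility. -/
def HasseArrow (q p : TPath V) : Prop :=
  IsPerfect K S p ∧ IsPerfect K S q ∧ ProperLeftDivisor p q ∧
    ¬ ∃ x : TPath V, IsPerfect K S x ∧ ProperLeftDivisor p x ∧ ProperLeftDivisor x q

/-- A perfect path is co-elementary if it is a sink of this Hasse quiver. -/
def IsCoelementary (p : TPath V) : Prop :=
  IsPerfect K S p ∧ ∀ q : TPath V, ¬ HasseArrow K S p q

/-- Powers of a cycle. -/
def cyclePow {a : V} (c : Path a a) : ℕ → Path a a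
  | 0 => Path.nil
  | l + 1 => (cyclePow c l).comp c

/-- `x` is a power, with positive exponent, of the cycle `c`. -/
def IsCyclePow (x c : TPath V) : Prop :=
  ∃ (a : V) (d : Path a a) (l : ℕ), 0 < l ∧ c = tot d ∧ x = tot (cyclePow d l)

/-- `c` is an underlying cycle: the shortest cycle of which the product `p₁ ⋯ pₙ` of some perfect
path sequence `(p₁, …, pₙ, p₁)` is a power. -/
def IsUnderlyingCycle (c : TPath V) : Prop :=
  ∃ r : CyclicSeq V, r.IsPerfect K S ∧ IsCyclePow r.total c ∧
    ∀ c' : TPath V, IsCyclePow r.total c' → c.len ≤ c'.len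

/-- The number `m_c` of perfect paths having `r₁` as a left divisor, where `c = r₁ ⋯ rₙ`. -/
noncomputable def numPerfect (r : CyclicSeq V) : ℕ :=
  {p : TPath V | IsPerfect K S p ∧ LeftDivisor (tot (r.path 1)) p}.ncard

end PerfectPaths

/-! ### Gradings -/

section Grading

variable {M : Type*} [AddCommGroup M]

theorem isInternal_of_proj (A : ℤ → AddSubgroup M) (π : ℤ → M →+ M)
    (h1 : ∀ i x, π i x ∈ A i) (h2 : ∀ i, ∀ x ∈ A i, π i x = x)
    (h3 : ∀ i j, i ≠ j → ∀ x ∈ A j, π i x = 0)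
    (h4 : ∀ x, ∃ s : Finset ℤ, ∀ t, s ⊆ t → ∑ i ∈ t, π i x = x) : DirectSum.IsInternal A := by
  classical
  have key : ∀ (y : DirectSum ℤ fun i => A i) (j : ℤ),
      π j (DirectSum.coeAddMonoidHom A y) = y j := by
    intro y j
    induction y using DirectSum.induction_on with
    | zero => simp
    | of i x =>
      rw [DirectSum.coeAddMonoidHom_of]
      by_cases h : i = j
      · subst h
        rw [h2 _ _ x.2, DirectSum.of_eq_same]
      · rw [h3 _ _ (Ne.symm h) _ x.2, DirectSum.of_eq_of_ne _ _ _ (Ne.symm h)]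
        rfl
    | add x y hx hy => rw [map_add, map_add, hx, hy]; rfl
  refine ⟨fun x y h => ?_, fun x => ?_⟩
  · refine DFinsupp.ext fun j => Subtype.ext ?_
    rw [← key x j, ← key y j, h]
  · obtain ⟨s, hs⟩ := h4 x
    refine ⟨∑ i ∈ s, DirectSum.of (fun i => A i) i ⟨π i x, h1 i x⟩, ?_⟩
    rw [map_sum]
    simp only [DirectSum.coeAddMonoidHom_of]
    exact hs s (Finset.Subset.refl _)

theorem exists_proj_of_isInternal {A : ℤ → AddSubgroup M} (h : DirectSum.IsInternal A) :
    ∃ π : ℤ → M →+ M, (∀ i x, π i x ∈ A i) ∧ (∀ i, ∀ x ∈ A i, π i x = x) ∧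
      (∀ i j, i ≠ j → ∀ x ∈ A j, π i x = 0) ∧
      ∀ x, ∃ s : Finset ℤ, ∀ t, s ⊆ t → ∑ i ∈ t, π i x = x := by
  classical
  let e := AddEquiv.ofBijective (DirectSum.coeAddMonoidHom A) h
  have he : ∀ i (x : M) (hx : x ∈ A i), e.symm x = DirectSum.of (fun i => A i) i ⟨x, hx⟩ := by
    intro i x hx
    rw [AddEquiv.symm_apply_eq]
    exact (DirectSum.coeAddMonoidHom_of A i ⟨x, hx⟩).symm
  refine ⟨fun i => ((A i).subtype.comp (DFinsupp.evalAddMonoidHom i)).comp e.symm.toAddMonoidHom,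
    fun i x => SetLike.coe_mem _, fun i x hx => ?_, fun i j hij x hx => ?_, fun x => ?_⟩
  · show ((e.symm x) i : M) = x
    rw [he i x hx, DirectSum.of_eq_same]
  · show ((e.symm x) i : M) = 0
    rw [he j x hx, DirectSum.of_eq_of_ne _ _ _ hij]
    rfl
  · refine ⟨DFinsupp.support (e.symm x), fun t ht => ?_⟩
    show ∑ i ∈ t, ((e.symm x) i : M) = x
    have h1 : ∑ i ∈ t, DirectSum.of (fun i => A i) i ((e.symm x) i) = e.symm x := by
      conv_rhs => rw [← DirectSum.sum_support_of (e.symm x)]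
      symm
      refine Finset.sum_subset ht fun i _ hi => ?_
      rw [DFinsupp.notMem_support_iff.1 hi, map_zero]
    have h2 := congrArg e h1
    rw [AddEquiv.apply_symm_apply, map_sum] at h2
    rw [← h2]
    refine Finset.sum_congr rfl fun i _ => ?_
    exact (DirectSum.coeAddMonoidHom_of A i _).symm.trans (by rw [h2]; rfl)

end Grading

/-! ### Graded modules -/

section GradedModules

variable (K : Type w) [Field K] {V : Type u} [Quiver.{v} V] [Fintype V] (S : Set (TPath V))

/-- A finitely generated `ℤ`-graded right module over the graded algebra `KV/I`. -/
structure GrMod where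
  carrier : Type (max u v w)
  [addCommGroup : AddCommGroup carrier]
  [module : Module (Alg K S)ᵐᵒᵖ carrier]
  [finite : Module.Finite (Alg K S)ᵐᵒᵖ carrier]
  deg : ℤ → AddSubgroup carrier
  isInternal : DirectSum.IsInternal deg
  smul_mem : ∀ {i j : ℤ} {x : carrier} {a : Alg K S},
    x ∈ deg i → a ∈ algDeg K S j → MulOpposite.op a • x ∈ deg (i + j)

attribute [instance] GrMod.addCommGroup GrMod.module GrMod.finite

variable {K S}

noncomputable section

namespace GrMod

/-- Morphisms of graded modules: module homomorphisms preserving degrees. -/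
@[ext]
structure Hom (M N : GrMod K S) where
  lin : M.carrier →ₗ[(Alg K S)ᵐᵒᵖ] N.carrier
  map_deg : ∀ (i : ℤ) (x : M.carrier), x ∈ M.deg i → lin x ∈ N.deg i

instance : Category (GrMod K S) where
  Hom M N := Hom M N
  id M := ⟨LinearMap.id, fun _ _ h => h⟩
  comp f g := ⟨g.lin.comp f.lin, fun i x h => g.map_deg i _ (f.map_deg i x h)⟩

/-- The underlying linear map of a morphism. -/
def lin {M N : GrMod K S} (f : M ⟶ N) : M.carrier →ₗ[(Alg K S)ᵐᵒᵖ] N.carrier := Hom.lin f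

theorem lin_deg {M N : GrMod K S} (f : M ⟶ N) {i : ℤ} {x : M.carrier} (hx : x ∈ M.deg i) :
    lin f x ∈ N.deg i := Hom.map_deg f i x hx

/-- A degree preserving linear map, as a morphism of graded modules. -/
def ofLin {M N : GrMod K S} (f : M.carrier →ₗ[(Alg K S)ᵐᵒᵖ] N.carrier)
    (hf : ∀ (i : ℤ) (x : M.carrier), x ∈ M.deg i → f x ∈ N.deg i) : M ⟶ N :=
  Hom.mk f hf

@[simp] theorem lin_ofLin {M N : GrMod K S} (f : M.carrier →ₗ[(Alg K S)ᵐᵒᵖ] N.carrier) (hf) :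
    lin (ofLin f hf : M ⟶ N) = f := rfl

theorem lin_injective {M N : GrMod K S} : Function.Injective (lin : (M ⟶ N) → _) :=
  fun _ _ h => Hom.ext h

@[simp] theorem lin_id (M : GrMod K S) : lin (𝟙 M) = LinearMap.id := rfl
@[simp] theorem lin_comp {M N L : GrMod K S} (f : M ⟶ N) (g : N ⟶ L) :
    lin (f ≫ g) = (lin g).comp (lin f) := rfl

instance (M N : GrMod K S) : Zero (M ⟶ N) := ⟨ofLin 0 fun _ _ _ => zero_mem _⟩
instance (M N : GrMod K S) : Add (M ⟶ N) :=
  ⟨fun f g => ofLin (lin f + lin g) fun _ _ h => add_mem (lin_deg f h) (lin_deg g h)⟩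
instance (M N : GrMod K S) : Neg (M ⟶ N) :=
  ⟨fun f => ofLin (-lin f) fun _ _ h => neg_mem (lin_deg f h)⟩
instance (M N : GrMod K S) : Sub (M ⟶ N) :=
  ⟨fun f g => ofLin (lin f - lin g) fun _ _ h => sub_mem (lin_deg f h) (lin_deg g h)⟩
instance (M N : GrMod K S) : SMul ℕ (M ⟶ N) :=
  ⟨fun n f => ofLin (n • lin f) fun _ _ h => nsmul_mem (lin_deg f h) n⟩
instance (M N : GrMod K S) : SMul ℤ (M ⟶ N) :=
  ⟨fun n f => ofLin (n • lin f) fun _ _ h => zsmul_mem (lin_deg f h) n⟩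

@[simp] theorem lin_zero (M N : GrMod K S) : lin (0 : M ⟶ N) = 0 := rfl
@[simp] theorem lin_add {M N : GrMod K S} (f g : M ⟶ N) : lin (f + g) = lin f + lin g := rfl
@[simp] theorem lin_neg {M N : GrMod K S} (f : M ⟶ N) : lin (-f) = -lin f := rfl
@[simp] theorem lin_sub {M N : GrMod K S} (f g : M ⟶ N) : lin (f - g) = lin f - lin g := rfl

instance (M N : GrMod K S) : AddCommGroup (M ⟶ N) :=
  Function.Injective.addCommGroup lin lin_injective rfl (fun _ _ => rfl) (fun _ => rfl)
    (fun _ _ => rfl) (fun _ _ => rfl) (fun _ _ => rfl)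

instance : Preadditive (GrMod K S) where
  add_comp _ _ _ f f' g := lin_injective (by simp [LinearMap.comp_add])
  comp_add _ _ _ f g g' := lin_injective (by simp [LinearMap.add_comp])

/-- The degree shift `M(j)`, with `M(j)_i = M_{i+j}`. -/
def shift (M : GrMod K S) (j : ℤ) : GrMod K S where
  carrier := M.carrier
  deg i := M.deg (i + j)
  isInternal := by
    obtain ⟨π, h1, h2, h3, h4⟩ := exists_proj_of_isInternal M.isInternal
    refine isInternal_of_proj _ (fun i => π (i + j)) (fun i => h1 _) (fun i => h2 _)
      (fun i k hik => h3 _ _ (by omega)) (fun x => ?_)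
    classical
    obtain ⟨s, hs⟩ := h4 x
    refine ⟨s.map (Equiv.subRight j).toEmbedding, fun t ht => ?_⟩
    have h := hs (t.map (Equiv.addRight j).toEmbedding) fun k hk => by
      rw [Finset.mem_map]
      exact ⟨k - j, ht (Finset.mem_map_of_mem _ hk), by simp⟩
    rwa [Finset.sum_map] at h
  smul_mem := by
    intro i k x a hx ha
    rw [add_right_comm]
    exact M.smul_mem hx ha

/-- The direct sum of two graded modules. -/
def prod (M N : GrMod K S) : GrMod K S where
  carrier := M.carrier × N.carrier
  deg i := (M.deg i).prod (N.deg i)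
  isInternal := by
    obtain ⟨π, h1, h2, h3, h4⟩ := exists_proj_of_isInternal M.isInternal
    obtain ⟨π', h1', h2', h3', h4'⟩ := exists_proj_of_isInternal N.isInternal
    refine isInternal_of_proj _ (fun i => (π i).prodMap (π' i)) (fun i x => ⟨h1 _ _, h1' _ _⟩)
      (fun i x hx => Prod.ext (h2 _ _ hx.1) (h2' _ _ hx.2))
      (fun i k hik x hx => Prod.ext (h3 _ _ hik _ hx.1) (h3' _ _ hik _ hx.2)) (fun x => ?_)
    classical
    obtain ⟨s, hs⟩ := h4 x.1
    obtain ⟨s', hs'⟩ := h4' x.2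
    refine ⟨s ∪ s', fun t ht => Prod.ext ?_ ?_⟩
    · rw [Prod.fst_sum]
      exact hs t (Finset.union_subset_left ht)
    · rw [Prod.snd_sum]
      exact hs' t (Finset.union_subset_right ht)
  smul_mem := fun hx ha => ⟨M.smul_mem hx.1 ha, N.smul_mem hx.2 ha⟩

/-- The projections (`fst`, `snd`) and inclusions (`inl`, `inr`) of a direct sum. -/
def fst (M N : GrMod K S) : M.prod N ⟶ M :=
  ofLin (LinearMap.fst _ M.carrier N.carrier) fun _ _ h => h.1
def snd (M N : GrMod K S) : M.prod N ⟶ N :=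
  ofLin (LinearMap.snd _ M.carrier N.carrier) fun _ _ h => h.2
def inl (M N : GrMod K S) : M ⟶ M.prod N :=
  ofLin (LinearMap.inl _ M.carrier N.carrier) fun _ _ h => ⟨h, zero_mem _⟩
def inr (M N : GrMod K S) : N ⟶ M.prod N :=
  ofLin (LinearMap.inr _ M.carrier N.carrier) fun _ _ h => ⟨zero_mem _, h⟩

theorem inl_fst (M N : GrMod K S) : inl M N ≫ fst M N = 𝟙 M := rfl
theorem inr_snd (M N : GrMod K S) : inr M N ≫ snd M N = 𝟙 N := rfl
theorem inl_snd (M N : GrMod K S) : inl M N ≫ snd M N = 0 := rfl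
theorem inr_fst (M N : GrMod K S) : inr M N ≫ fst M N = 0 := rfl
theorem prod_total (M N : GrMod K S) :
    fst M N ≫ inl M N + snd M N ≫ inr M N = 𝟙 (M.prod N) :=
  lin_injective (LinearMap.ext fun x => by
    show ((x.1, 0) + (0, x.2) : M.carrier × N.carrier) = x
    exact Prod.ext (add_zero x.1) (zero_add x.2))

/-- The morphism `L → M ⊕ N` with components `f` and `g`. -/
def lift {L M N : GrMod K S} (f : L ⟶ M) (g : L ⟶ N) : L ⟶ M.prod N :=
  ofLin (LinearMap.prod (lin f) (lin g)) fun _ _ h => ⟨lin_deg f h, lin_deg g h⟩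

/-- The morphism `M ⊕ N → L` with components `f` and `g`. -/
def desc {L M N : GrMod K S} (f : M ⟶ L) (g : N ⟶ L) : M.prod N ⟶ L :=
  ofLin (LinearMap.coprod (lin f) (lin g)) fun _ _ h => add_mem (lin_deg f h.1) (lin_deg g h.2)

/-- The sequence `0 → A → B → C → 0` of graded modules is exact. -/
structure IsShortExact {A B C : GrMod K S} (f : A ⟶ B) (g : B ⟶ C) : Prop where
  injective : Function.Injective (lin f)
  exact : Function.Exact (lin f) (lin g)
  surjective : Function.Surjective (lin g)

/-- Projective objects of the category of graded modules. -/
def IsProjective (P : GrMod K S) : Prop :=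
  ∀ ⦃M N : GrMod K S⦄ (g : M ⟶ N), Function.Surjective (lin g) → ∀ f : P ⟶ N,
    ∃ h : P ⟶ M, h ≫ g = f

/-- The complex `⋯ → P i → P (i+1) → ⋯` of graded projective modules is totally acyclic: it is
exact, and so is the complex obtained by applying `Hom(-, Λ)`, where `Λ = KV/I`. -/
structure IsTotallyAcyclic (P : ℤ → GrMod K S) (d : ∀ i : ℤ, P i ⟶ P (i + 1)) : Prop where
  projective : ∀ i, IsProjective (P i)
  exact : ∀ i, Function.Exact (lin (d i)) (lin (d (i + 1)))
  hom_exact : ∀ (i : ℤ) (f : (P (i + 1)).carrier →ₗ[(Alg K S)ᵐᵒᵖ] Alg K S),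
    f.comp (lin (d i)) = 0 →
      ∃ g : (P (i + 1 + 1)).carrier →ₗ[(Alg K S)ᵐᵒᵖ] Alg K S, g.comp (lin (d (i + 1))) = f

/-- Graded Gorenstein-projective modules: the graded modules isomorphic to the kernel of `d 0` for
some totally acyclic complex of graded projective modules. -/
def IsGproj (M : GrMod K S) : Prop :=
  ∃ (P : ℤ → GrMod K S) (d : ∀ i : ℤ, P i ⟶ P (i + 1)), IsTotallyAcyclic P d ∧
    ∃ e : M ⟶ P 0, Function.Injective (lin e) ∧ Function.Exact (lin e) (lin (d 0))

theorem IsProjective.prod {P Q : GrMod K S} (hP : P.IsProjective) (hQ : Q.IsProjective) :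
    (P.prod Q).IsProjective := by
  intro M N g hg f
  obtain ⟨h, hh⟩ := hP g hg (inl P Q ≫ f)
  obtain ⟨h', hh'⟩ := hQ g hg (inr P Q ≫ f)
  refine ⟨fst P Q ≫ h + snd P Q ≫ h', ?_⟩
  rw [Preadditive.add_comp, Category.assoc, Category.assoc, hh, hh', ← Category.assoc,
    ← Category.assoc, ← Preadditive.add_comp, prod_total, Category.id_comp]

/-- The direct sum of two totally acyclic complexes is totally acyclic. -/
theorem IsGproj.prod {M N : GrMod K S} (hM : M.IsGproj) (hN : N.IsGproj) :
    (M.prod N).IsGproj := by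
  obtain ⟨P, d, hP, e, he, he'⟩ := hM
  obtain ⟨Q, d', hQ, i, hi, hi'⟩ := hN
  let D : ∀ k, (P k).prod (Q k) ⟶ (P (k + 1)).prod (Q (k + 1)) := fun k =>
    ofLin (LinearMap.prodMap (lin (d k)) (lin (d' k)))
      fun _ _ h => ⟨lin_deg (d k) h.1, lin_deg (d' k) h.2⟩
  have ex : ∀ {A B C A' B' C' : GrMod K S} (f : A.carrier →ₗ[(Alg K S)ᵐᵒᵖ] B.carrier)
      (g : B.carrier →ₗ[(Alg K S)ᵐᵒᵖ] C.carrier) (f' : A'.carrier →ₗ[(Alg K S)ᵐᵒᵖ] B'.carrier)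
      (g' : B'.carrier →ₗ[(Alg K S)ᵐᵒᵖ] C'.carrier), Function.Exact f g → Function.Exact f' g' →
      Function.Exact (LinearMap.prodMap f f') (LinearMap.prodMap g g') := by
    intro A B C A' B' C' f g f' g' h h' x
    rw [LinearMap.prodMap_apply, Prod.mk_eq_zero, h x.1, h' x.2]
    constructor
    · rintro ⟨⟨y, hy⟩, ⟨z, hz⟩⟩
      exact ⟨(y, z), Prod.ext hy hz⟩
    · rintro ⟨y, rfl⟩
      exact ⟨⟨y.1, rfl⟩, ⟨y.2, rfl⟩⟩
  refine ⟨fun k => (P k).prod (Q k), D, ⟨fun k => (hP.projective k).prod (hQ.projective k),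
    fun k => ex _ _ _ _ (hP.exact k) (hQ.exact k), fun k f hf => ?_⟩,
    ofLin (LinearMap.prodMap (lin e) (lin i)) fun _ _ h => ⟨lin_deg e h.1, lin_deg i h.2⟩,
    Function.Injective.prodMap he hi, ex _ _ _ _ he' hi'⟩
  obtain ⟨g, hg⟩ := hP.hom_exact k (f.comp (LinearMap.inl _ (P (k + 1)).carrier
      (Q (k + 1)).carrier)) (LinearMap.ext fun x => by
    have h := LinearMap.congr_fun hf (x, 0)
    have e : lin (D k) (x, 0) = (lin (d k) x, 0) := Prod.ext rfl (map_zero (lin (d' k)))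
    exact (congrArg f e).symm.trans h)
  obtain ⟨g', hg'⟩ := hQ.hom_exact k (f.comp (LinearMap.inr _ (P (k + 1)).carrier
      (Q (k + 1)).carrier)) (LinearMap.ext fun x => by
    have h := LinearMap.congr_fun hf (0, x)
    have e : lin (D k) (0, x) = (0, lin (d' k) x) := Prod.ext (map_zero (lin (d k))) rfl
    exact (congrArg f e).symm.trans h)
  refine ⟨g.coprod g', LinearMap.ext fun x => ?_⟩
  have h1 := LinearMap.congr_fun hg x.1
  have h2 := LinearMap.congr_fun hg' x.2
  exact (congrArg₂ (· + ·) h1 h2).trans ((map_add f _ _).symm.trans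
    (congrArg f (Prod.ext (add_zero x.1) (zero_add x.2))))

end GrMod

/-! ### The modules generated by paths -/

section PathModules

variable (K S)

open Quiver

/-- The right ideal `pΛ` of `Λ = KV/I` generated by the class of a path. -/
def pathIdeal {a b : V} (p : Path a b) : Submodule (Alg K S)ᵐᵒᵖ (Alg K S) :=
  Submodule.span (Alg K S)ᵐᵒᵖ {cls K S p}

theorem algProj_mem_pathIdeal {a b : V} (p : Path a b) (i : ℤ) {x : Alg K S}
    (hx : x ∈ pathIdeal K S p) : algProj K S i x ∈ pathIdeal K S p := by
  obtain ⟨y, rfl⟩ := Submodule.mem_span_singleton.1 hx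
  have h : y • cls K S p = cls K S p * y.unop := rfl
  rw [h, algProj_cls_mul]
  exact Submodule.mem_span_singleton.2 ⟨MulOpposite.op _, rfl⟩

/-- The graded module `pΛ`, with the grading induced from `Λ`, so that its generator `p` has degree
the length of `p`. For the trivial path `p = e_a` this is the projective module `e_a Λ`. -/
def pathMod {a b : V} (p : Path a b) : GrMod K S where
  carrier := pathIdeal K S p
  finite := Module.Finite.span_singleton _ _
  deg i := (algDeg K S i).toAddSubgroup.comap (pathIdeal K S p).subtype.toAddMonoidHom
  isInternal := by
    refine isInternal_of_proj _ (fun i =>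
      { toFun := fun x => ⟨algProj K S i x.1, algProj_mem_pathIdeal K S p i x.2⟩
        map_zero' := Subtype.ext (map_zero _)
        map_add' := fun x y => Subtype.ext (map_add _ _ _) })
      (fun i x => algProj_mem K S i x.1)
      (fun i x hx => Subtype.ext (algProj_of_mem K S i hx))
      (fun i j hij x hx => Subtype.ext (algProj_of_mem_ne K S hij hx)) (fun x => ?_)
    obtain ⟨s, hs⟩ := algProj_sum K S x.1
    refine ⟨s, fun t ht => Subtype.ext ?_⟩
    rw [AddSubmonoidClass.coe_finsetSum]
    exact hs t ht
  smul_mem := fun hx ha => algDeg_mul K S hx ha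

variable {K S}

/-- The homomorphism `f : pΛ → qΛ` is the left multiplication by `a`. For `a = 1` this says that
`f` is the inclusion of `pΛ` in `qΛ`. -/
def IsLeftMul (a : Alg K S) {x y z t : V} {p : Path x y} {q : Path z t}
    (f : pathIdeal K S p →ₗ[(Alg K S)ᵐᵒᵖ] pathIdeal K S q) : Prop :=
  ∀ m : pathIdeal K S p, (f m : Alg K S) = a * m

end PathModules

/-! ### The stable category of graded Gorenstein-projective modules -/

section StableCategory

open GrMod

variable (K S)

/-- Two morphisms of graded modules are identified in the stable category if their difference
factors through a graded projective module. -/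
def stableRel : HomRel (GrMod K S) := fun M N f g =>
  ∃ (P : GrMod K S) (a : M ⟶ P) (b : P ⟶ N), P.IsProjective ∧ f - g = a ≫ b

theorem stableRel_add ⦃M N : GrMod K S⦄ (f₁ f₂ g₁ g₂ : M ⟶ N) (hf : stableRel K S f₁ f₂)
    (hg : stableRel K S g₁ g₂) : stableRel K S (f₁ + g₁) (f₂ + g₂) := by
  obtain ⟨P, a, b, hP, h⟩ := hf
  obtain ⟨Q, a', b', hQ, h'⟩ := hg
  refine ⟨P.prod Q, a ≫ inl P Q + a' ≫ inr P Q, fst P Q ≫ b + snd P Q ≫ b', hP.prod hQ, ?_⟩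
  have e : f₁ + g₁ - (f₂ + g₂) = (f₁ - f₂) + (g₁ - g₂) := by abel
  rw [e, h, h']
  refine lin_injective (LinearMap.ext fun x => ?_)
  show lin b (lin a x) + lin b' (lin a' x) =
    lin b (lin a x + 0) + lin b' (0 + lin a' x)
  rw [add_zero, zero_add]

/-- The zero module. -/
def zeroMod : GrMod K S where
  carrier := PUnit
  deg _ := ⊤
  isInternal := isInternal_of_proj _ 0 (fun _ _ => trivial) (fun _ _ _ => rfl)
    (fun _ _ _ _ _ => rfl) (fun _ => ⟨∅, fun _ _ => rfl⟩)
  smul_mem := fun _ _ => trivial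

theorem zeroMod_isProjective : (zeroMod K S).IsProjective := fun M N _ _ f =>
  ⟨0, lin_injective (LinearMap.ext fun x => by
    have : x = 0 := rfl
    rw [this, map_zero, map_zero])⟩

instance : Congruence (stableRel K S) where
  equivalence :=
    { refl := fun f => ⟨zeroMod K S, 0, 0, zeroMod_isProjective K S, by simp⟩
      symm := fun ⟨P, a, b, hP, h⟩ => ⟨P, a, -b, hP, by rw [Preadditive.comp_neg, ← h, neg_sub]⟩
      trans := fun {f g h} hfg hgh => by
        obtain ⟨P, a, b, hP, e⟩ := stableRel_add K S _ _ _ _ hfg hgh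
        exact ⟨P, a, b, hP, by rw [← e]; abel⟩ }
  comp_left := fun f _ _ ⟨P, a, b, hP, h⟩ =>
    ⟨P, f ≫ a, b, hP, by rw [← Preadditive.comp_sub, h, Category.assoc]⟩
  comp_right := fun g ⟨P, a, b, hP, h⟩ =>
    ⟨P, a, b ≫ g, hP, by rw [← Preadditive.sub_comp, h, Category.assoc]⟩

/-- The stable category of finitely generated graded modules. -/
abbrev StMod := CategoryTheory.Quotient (stableRel K S)

instance : Preadditive (StMod K S) := Quotient.preadditive (stableRel K S) (stableRel_add K S)

/-- The graded Gorenstein-projective modules, as a class of objects of the stable category. -/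
def gprojProp : ObjectProperty (StMod K S) := fun X => X.as.IsGproj

/-- The stable category of graded Gorenstein-projective modules: the full subcategory of the stable
category of graded modules formed by these modules. -/
abbrev StGproj := (gprojProp K S).FullSubcategory

variable {K S}

/-- A graded Gorenstein-projective module, as an object of the stable category. -/
def stObj (M : GrMod K S) (hM : M.IsGproj) : StGproj K S := ⟨⟨M⟩, hM⟩

/-- The morphism of the stable category represented by a morphism of graded modules. -/
def stMap {M N : GrMod K S} {hM : M.IsGproj} {hN : N.IsGproj} (f : M ⟶ N) :
    stObj M hM ⟶ stObj N hN :=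
  ObjectProperty.homMk ((CategoryTheory.Quotient.functor (stableRel K S)).map f)

theorem stMap_comp {M N L : GrMod K S} {hM : M.IsGproj} {hN : N.IsGproj} {hL : L.IsGproj}
    (f : M ⟶ N) (g : N ⟶ L) :
    (stMap (f ≫ g) : stObj M hM ⟶ stObj L hL) = (stMap f : _ ⟶ stObj N hN) ≫ stMap g := rfl
theorem stMap_id {M : GrMod K S} {hM : M.IsGproj} :
    (stMap (𝟙 M) : stObj M hM ⟶ stObj M hM) = 𝟙 _ := rfl
theorem stMap_add {M N : GrMod K S} {hM : M.IsGproj} {hN : N.IsGproj} (f g : M ⟶ N) :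
    (stMap (f + g) : stObj M hM ⟶ stObj N hN) = stMap f + stMap g := rfl
theorem stMap_zero {M N : GrMod K S} {hM : M.IsGproj} {hN : N.IsGproj} :
    (stMap (0 : M ⟶ N) : stObj M hM ⟶ stObj N hN) = 0 := rfl

/-- Direct sums exist in the stable category of graded Gorenstein-projective modules. -/
instance : HasBinaryBiproducts (StGproj K S) where
  has_binary_biproduct X Y := by
    obtain ⟨⟨M⟩, hM⟩ := X
    obtain ⟨⟨N⟩, hN⟩ := Y
    have hMN : (M.prod N).IsGproj := IsGproj.prod hM hN
    exact hasBinaryBiproduct_of_total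
      { pt := stObj (M.prod N) hMN
        fst := (stMap (fst M N) : stObj (M.prod N) hMN ⟶ stObj M hM)
        snd := (stMap (snd M N) : stObj (M.prod N) hMN ⟶ stObj N hN)
        inl := (stMap (inl M N) : stObj M hM ⟶ stObj (M.prod N) hMN)
        inr := (stMap (inr M N) : stObj N hN ⟶ stObj (M.prod N) hMN)
        inl_fst := rfl
        inl_snd := rfl
        inr_fst := rfl
        inr_snd := rfl }
      (by
        show stMap (fst M N ≫ inl M N + snd M N ≫ inr M N) = 𝟙 (stObj (M.prod N) hMN)
        rw [prod_total, stMap_id])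

/-! ### Triangles -/

/-- A suspension of a graded module `A`: an exact sequence `0 → A → I → ΣA → 0` with `I` graded
projective and `ΣA` graded Gorenstein-projective. (If `A` is Gorenstein-projective, such a sequence
exists, and any two choices of `ΣA` are canonically isomorphic in the stable category.) -/
structure Suspension (A : GrMod K S) where
  I : GrMod K S
  susp : GrMod K S
  incl : A ⟶ I
  proj : I ⟶ susp
  isProjective : I.IsProjective
  isGproj : susp.IsGproj
  isShortExact : IsShortExact incl proj

/-- A sextuple `A → B → C → ΣA` in the stable category, the suspension `ΣA` being computed by the
exact sequence `σ`. -/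
structure StTriangle where
  A : GrMod K S
  B : GrMod K S
  C : GrMod K S
  hA : A.IsGproj
  hB : B.IsGproj
  hC : C.IsGproj
  σ : Suspension A
  f : stObj A hA ⟶ stObj B hB
  g : stObj B hB ⟶ stObj C hC
  h : stObj C hC ⟶ stObj σ.susp σ.isGproj

namespace StTriangle

/-- The sextuple induced by a short exact sequence `0 → A → B → C → 0` of graded
Gorenstein-projective modules: `f` and `g` are the classes of `u : A → B` and `v : B → C`, and `h`
is the class of a morphism `w : C → ΣA` fitting into a morphism of short exact sequences
from `0 → A → B → C → 0` to `0 → A → I → ΣA → 0` that is the identity on `A`. -/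
def IsStandard (T : StTriangle (K := K) (S := S)) : Prop :=
  ∃ (u : T.A ⟶ T.B) (v : T.B ⟶ T.C) (φ : T.B ⟶ T.σ.I) (w : T.C ⟶ T.σ.susp),
    IsShortExact u v ∧ u ≫ φ = T.σ.incl ∧ φ ≫ T.σ.proj = v ≫ w ∧
      T.f = stMap u ∧ T.g = stMap v ∧ T.h = stMap w

/-- `s = Σa`, where the suspensions are computed by the exact sequences `σ` and `σ'`. -/
def IsSuspensionMap {A A' : GrMod K S} {hA : A.IsGproj} {hA' : A'.IsGproj} (σ : Suspension A)
    (σ' : Suspension A') (a : stObj A hA ⟶ stObj A' hA')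
    (s : stObj σ.susp σ.isGproj ⟶ stObj σ'.susp σ'.isGproj) : Prop :=
  ∃ (α : A ⟶ A') (β : σ.I ⟶ σ'.I) (γ : σ.susp ⟶ σ'.susp),
    α ≫ σ'.incl = σ.incl ≫ β ∧ β ≫ σ'.proj = σ.proj ≫ γ ∧ a = stMap α ∧ s = stMap γ

/-- The (distinguished) triangles of the triangulated category of graded Gorenstein-projective
modules modulo projectives: the sextuples isomorphic to the ones induced by short exact sequences
of graded Gorenstein-projective modules. -/
def IsDistinguished (T : StTriangle (K := K) (S := S)) : Prop :=
  ∃ (T' : StTriangle (K := K) (S := S)), T'.IsStandard ∧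
    ∃ (a : stObj T.A T.hA ≅ stObj T'.A T'.hA) (b : stObj T.B T.hB ≅ stObj T'.B T'.hB)
      (c : stObj T.C T.hC ≅ stObj T'.C T'.hC)
      (s : stObj T.σ.susp T.σ.isGproj ≅ stObj T'.σ.susp T'.σ.isGproj),
      IsSuspensionMap T.σ T'.σ a.hom s.hom ∧
      T.f ≫ b.hom = a.hom ≫ T'.f ∧ T.g ≫ c.hom = b.hom ≫ T'.g ∧ T.h ≫ s.hom = c.hom ≫ T'.h

/-- Auslander–Reiten triangles in the stable category of graded Gorenstein-projective modules. -/
structure IsAuslanderReiten (T : StTriangle (K := K) (S := S)) : Prop where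
  isDistinguished : T.IsDistinguished
  indecomposable_left : Indecomposable (stObj T.A T.hA)
  indecomposable_right : Indecomposable (stObj T.C T.hC)
  ne_zero : T.h ≠ 0
  factors : ∀ (W : StGproj K S) (α : W ⟶ stObj T.C T.hC), ¬ IsSplitEpi α →
    ∃ β : W ⟶ stObj T.B T.hB, β ≫ T.g = α

end StTriangle

end StableCategory

end

end GradedModules

end MonAlg

open CategoryTheory MonAlg

namespace MonAlg

/-! ### Paths and perfect paths -/

section PathCombinatorics

open Quiver

variable {V : Type u} [Quiver.{v} V]

/-! Write p = ρw with ρ = r_i, let g = r_{i+m} and u = [i+m-m_c, i-1], and let e be the trivial path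
at the end of ρ. Up to shifts the claimed triangle is wgΛ → wΛ ⊕ ρwgΛ → ρwΛ → uρΛ, where ΣA = uρΛ is
the cokernel of wgΛ → eΛ.

The first ingredient is combinatorial. The perfect successor and predecessor of a path are unique
and there are only finitely many non-zero paths, so a path starting an infinite chain of perfect
pairs lies on a periodic chain and is perfect (`isPerfect_of_forall_exists`). Building such chains
shows that a perfect prefix of a perfect path can be cancelled (`IsPerfect.of_comp`) and restricts
how two perfect paths overlap inside a non-zero path (`IsPerfect.of_overlap`,
`IsMinPerfect.overlap_cases`). On the cycle c it follows that a product of t > 0 consecutive r_k is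
perfect exactly when t ≤ m_c, and that its successor is the product of the next m_c + 1 - t of them
(`CyclicSeq.perfect_segments`). This is all that the homological part needs to know about c; it is
recorded in `ARConfig`.

Left multiplications by the members of a perfect path sequence form a totally acyclic complex, so
perfect paths generate Gorenstein-projective modules (`isGproj_of_perfect_sequence`). Exactness of
the short sequence and ξ ≠ 0 then come from the minimality in the perfect pairs, and
indecomposability from the fact that every degree-zero endomorphism of pΛ is a scalar.

For the Auslander–Reiten property let f : M → pΛ be given. The module B is the pullback of pΛ → ΣA ←
eΛ, so f factors through B as soon as ξf lifts to eΛ (`exists_factorization`). Lifting is an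
additive condition, and the identity of M is a sum of idempotents that split off modules xΛ
generated by paths (`GrMod.IsGproj.id_mem`), so one may take M = xΛ. Total acyclicity forces xΛ to
be projective or x to end in a perfect path x' with the same annihilator
(`GrMod.IsGproj.exists_isPerfectPair`). The image of x in pΛ is a combination of paths, and the
overlap lemma shows that each of them lifts, except p itself when x' = p
(`ARConfig.exists_of_path`). If p does occur in this exceptional way, f has a section. -/

/-- Two left divisors of the same path are comparable. -/
theorem comp_eq_comp_cases {a b b' c : V} {p : Path a b} {x : Path b c} {p' : Path a b'}
    {x' : Path b' c} (h : p.comp x = p'.comp x') :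
    (∃ z : Path b b', p' = p.comp z ∧ x = z.comp x') ∨
      ∃ z : Path b' b, p = p'.comp z ∧ x' = z.comp x := by
  induction x with
  | nil => exact Or.inr ⟨x', h, rfl⟩
  | cons x e ih =>
    cases x' with
    | nil => exact Or.inl ⟨_, h.symm, rfl⟩
    | cons x' e' =>
      rw [Path.comp_cons, Path.comp_cons] at h
      injection h with h1 h2 h3 h4
      subst h1
      obtain rfl := eq_of_heq h4
      rcases ih (eq_of_heq h3) with ⟨z, hz, hz'⟩ | ⟨z, hz, hz'⟩
      · exact Or.inl ⟨z, hz, by rw [hz', Path.comp_cons]⟩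
      · exact Or.inr ⟨z, hz, by rw [hz', Path.comp_cons]⟩

theorem tot_inj {a b : V} {p q : Path a b} : tot p = tot q ↔ p = q :=
  ⟨fun h => by cases h; rfl, fun h => h ▸ rfl⟩

theorem tot_cast {a b a' b' : V} (ha : a = a') (hb : b = b') (p : Path a b) :
    tot (p.cast ha hb) = tot p := by
  subst ha hb; rfl

theorem finite_paths_of_length [Finite V] [∀ a b : V, Finite (a ⟶ b)] (n : ℕ) :
    {x : TPath V | x.len = n}.Finite := by
  induction n with
  | zero =>
    refine (Set.finite_range fun a : V => tot (Path.nil : Path a a)).subset ?_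
    rintro ⟨a, b, p⟩ h
    obtain rfl := Path.eq_of_length_zero p h
    exact ⟨a, by rw [Path.eq_nil_of_length_zero p h]⟩
  | succ n ih =>
    have := ih.to_subtype
    let F : (Σ (x : {x : TPath V | x.len = n}) (b : V), (x.1.2.1 ⟶ b)) → TPath V :=
      fun y => tot (y.1.1.2.2.cons y.2.2)
    refine (Set.finite_range F).subset ?_
    rintro ⟨a, b, p⟩ h
    cases p with
    | nil => exact absurd h (by simp [TPath.len])
    | cons p e =>
      exact ⟨⟨⟨tot p, Nat.succ_injective h⟩, _, e⟩, rfl⟩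

theorem leftDivisor_tot {a b c : V} (p : Path a b) (x : Path b c) :
    LeftDivisor (tot p) (tot (p.comp x)) := ⟨_, _, _, p, x, rfl, rfl⟩

theorem LeftDivisor.exists_comp {a b a' c : V} {p : Path a b} {q : Path a' c}
    (h : LeftDivisor (tot p) (tot q)) : ∃ x : Path b c, tot q = tot (p.comp x) := by
  obtain ⟨_, _, _, x, y, h1, h2⟩ := h
  cases h1
  cases h2
  exact ⟨y, rfl⟩

end PathCombinatorics

/-! ### Perfect pairs: uniqueness, periodic chains, cancellation of a perfect prefix -/

section PerfectPathLemmas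

open Quiver

variable {K : Type w} [Field K] {V : Type u} [Quiver.{v} V] [Fintype V] {S : Set (TPath V)}

theorem cls_comp {a b c : V} (p : Path a b) (q : Path b c) :
    cls K S (p.comp q) = cls K S p * cls K S q := by
  rw [cls, cls, cls, ← map_mul, PathAlg.mul_def, mulBilin_ofPath, pathMul_comp]

theorem cls_mul_of_ne {a b c d : V} (p : Path a b) (q : Path c d) (h : b ≠ c) :
    cls K S p * cls K S q = 0 := by
  rw [cls, cls, ← map_mul, PathAlg.mul_def, mulBilin_ofPath, pathMul_of_ne K (by exact h), map_zero]

theorem cls_ne_zero_left {a b c : V} {p : Path a b} {q : Path b c} (h : cls K S (p.comp q) ≠ 0) :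
    cls K S p ≠ 0 := fun h' => h (by rw [cls_comp, h', zero_mul])

theorem cls_ne_zero_right {a b c : V} {p : Path a b} {q : Path b c} (h : cls K S (p.comp q) ≠ 0) :
    cls K S q ≠ 0 := fun h' => h (by rw [cls_comp, h', mul_zero])

theorem finite_nonzero_paths [∀ a b : V, Finite (a ⟶ b)] (hS : IsAdmissible K S) :
    {x : TPath V | cls K S x.2.2 ≠ 0}.Finite := by
  obtain ⟨-, N, hN⟩ := hS
  refine ((Set.finite_Iio N).biUnion fun n _ => finite_paths_of_length (V := V) n).subset ?_
  intro x hx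
  simp only [Set.mem_iUnion]
  refine ⟨x.len, ?_, rfl⟩
  by_contra h
  exact hx ((Alg.mk_eq_zero K S).2 (hN x (not_lt.1 h)))

variable (K S) in
/-- `(x, y)` is a perfect pair of consecutive paths. -/
def PerfectSucc (x y : TPath V) : Prop :=
  ∃ (a b c : V) (p : Path a b) (q : Path b c), x = tot p ∧ y = tot q ∧ IsPerfectPair K S p q

theorem perfectSucc_tot {a b c : V} {p : Path a b} {q : Path b c} :
    PerfectSucc K S (tot p) (tot q) ↔ IsPerfectPair K S p q := by
  refine ⟨?_, fun h => ⟨_, _, _, _, _, rfl, rfl, h⟩⟩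
  rintro ⟨a', b', c', p', q', h, h', hp⟩
  cases h
  cases h'
  exact hp

theorem IsPerfectPair.right_unique {a b c c' : V} {p : Path a b} {q : Path b c} {q' : Path b c'}
    (h : IsPerfectPair K S p q) (h' : IsPerfectPair K S p q') : tot q = tot q' := by
  obtain ⟨x, hx⟩ := h.right_minimal q' h'.nonzero_right h'.comp_eq_zero
  obtain ⟨y, hy⟩ := h'.right_minimal q h.nonzero_right h.comp_eq_zero
  have h1 := congrArg Path.length hx
  have h2 := congrArg Path.length hy
  rw [Path.length_comp] at h1 h2
  have h0 : x.length = 0 := by omega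
  obtain rfl := Path.eq_of_length_zero x h0
  obtain rfl := Path.eq_nil_of_length_zero x h0
  rw [hx, Path.comp_nil]

theorem IsPerfectPair.left_unique {a a' b c : V} {p : Path a b} {p' : Path a' b} {q : Path b c}
    (h : IsPerfectPair K S p q) (h' : IsPerfectPair K S p' q) : tot p = tot p' := by
  obtain ⟨x, hx⟩ := h.left_minimal p' h'.nonzero_left h'.comp_eq_zero
  obtain ⟨y, hy⟩ := h'.left_minimal p h.nonzero_left h.comp_eq_zero
  have h1 := congrArg Path.length hx
  have h2 := congrArg Path.length hy
  rw [Path.length_comp] at h1 h2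
  have h0 : x.length = 0 := by omega
  obtain rfl := Path.eq_of_length_zero x h0
  obtain rfl := Path.eq_nil_of_length_zero x h0
  rw [hx, Path.nil_comp]

theorem PerfectSucc.left_unique {x x' y : TPath V} (h : PerfectSucc K S x y)
    (h' : PerfectSucc K S x' y) : x = x' := by
  obtain ⟨a, b, c, p, q, rfl, rfl, h⟩ := h
  obtain ⟨a', b', c', p', q', rfl, e, h'⟩ := h'
  cases e
  exact h.left_unique h'

theorem PerfectSucc.right_unique {x y y' : TPath V} (h : PerfectSucc K S x y)
    (h' : PerfectSucc K S x y') : y = y' := by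
  obtain ⟨a, b, c, p, q, rfl, rfl, h⟩ := h
  obtain ⟨a', b', c', p', q', e, rfl, h'⟩ := h'
  cases e
  exact h.right_unique h'

theorem IsPerfect.exists_succ {a b : V} {p : Path a b} (h : IsPerfect K S (tot p)) :
    ∃ (c : V) (q : Path b c), IsPerfectPair K S p q ∧ IsPerfect K S (tot q) := by
  obtain ⟨r, hr, k, e⟩ := h
  cases e
  exact ⟨_, r.path (k + 1), hr k, r, hr, _, rfl⟩

theorem IsPerfect.exists_pred {a b : V} {q : Path a b} (h : IsPerfect K S (tot q)) :
    ∃ (c : V) (p : Path c a), IsPerfectPair K S p q ∧ IsPerfect K S (tot p) := by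
  obtain ⟨r, hr, k, e⟩ := h
  obtain ⟨k, rfl⟩ : ∃ k', k = k' + 1 := ⟨k - 1, by ring⟩
  cases e
  exact ⟨_, r.path k, hr k, r, hr, _, rfl⟩

theorem IsPerfect.ne_zero {a b : V} {p : Path a b} (h : IsPerfect K S (tot p)) :
    cls K S p ≠ 0 := by
  obtain ⟨c, q, hq, -⟩ := h.exists_succ
  exact hq.nonzero_left

theorem IsPerfect.length_pos {a b : V} {p : Path a b} (h : IsPerfect K S (tot p)) :
    0 < p.length := by
  obtain ⟨c, q, hq, -⟩ := h.exists_succ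
  exact hq.pos_left

theorem IsPerfectPair.isPerfect_left {a b c : V} {p : Path a b} {q : Path b c}
    (h : IsPerfectPair K S p q) (hq : IsPerfect K S (tot q)) : IsPerfect K S (tot p) := by
  obtain ⟨c', p', hp, hp'⟩ := hq.exists_pred
  rwa [h.left_unique hp]

/-- Allows chains to be built in the type of all paths, where consecutive endpoints agree only
propositionally; the casts demanded by `CyclicSeq` are dealt with once, here. -/
theorem isPerfect_of_periodic (f : ℤ → TPath V) (n : ℕ) (hn : 0 < n) (hf : ∀ k, f (k + n) = f k)
    (h : ∀ k, PerfectSucc K S (f k) (f (k + 1))) (k : ℤ) : IsPerfect K S (f k) := by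
  have hv : ∀ k, (f k).2.1 = (f (k + 1)).1 := by
    intro k
    obtain ⟨a, b, c, p, q, h1, h2, -⟩ := h k
    rw [h1, h2]
  have ht : ∀ k, tot ((f k).2.2.cast rfl (hv k)) = f k := fun k => tot_cast _ _ _
  refine ⟨⟨n, hn, fun k => (f k).1, fun k => (f k).2.2.cast rfl (hv k), fun k => ?_⟩,
    fun k => ?_, k, ?_⟩
  · rw [ht, ht, hf]
  · refine perfectSucc_tot.1 ?_
    have e : ∀ x y, x = f k → y = f (k + 1) → PerfectSucc K S x y := by
      rintro _ _ rfl rfl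
      exact h k
    exact e _ _ (ht k) (ht (k + 1))
  · exact (ht k).symm

/-- A path from which an infinite sequence of perfect pairs starts is perfect. -/
theorem isPerfect_of_forall_exists [∀ a b : V, Finite (a ⟶ b)] (hS : IsAdmissible K S)
    (X : TPath V → Prop) (hX : ∀ x, X x → ∃ y, X y ∧ PerfectSucc K S x y) {x : TPath V}
    (hx : X x) : IsPerfect K S x := by
  choose nxt h1 h2 using hX
  let g : {x // X x} → {x // X x} := fun y => ⟨nxt y.1 y.2, h1 y.1 y.2⟩
  have hg : ∀ y, PerfectSucc K S y.1 (g y).1 := fun y => h2 y.1 y.2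
  have : Finite {x // X x} := by
    have := (finite_nonzero_paths hS).to_subtype
    refine Finite.of_injective
      (fun y => (⟨y.1, ?_⟩ : {x : TPath V | cls K S x.2.2 ≠ 0})) fun y z h => ?_
    · obtain ⟨a, b, c, p, q, e1, e2, hp⟩ := hg y
      rw [e1]
      exact hp.nonzero_left
    · exact Subtype.ext (congrArg (fun t => t.1) h)
  -- Predecessors are unique, so the successor map is injective; on a finite set each of its points
  -- is periodic.
  have hinj : Function.Injective g := fun y z h =>
    Subtype.ext ((hg y).left_unique (h ▸ hg z))
  obtain ⟨n, hn, hp⟩ := (Function.Injective.mem_periodicPts hinj ⟨x, hx⟩)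
  have hper : ∀ k, g^[k % n] ⟨x, hx⟩ = g^[k] ⟨x, hx⟩ := fun k => hp.iterate_mod_apply k
  have hn' : (n : ℤ) ≠ 0 := by omega
  have key := isPerfect_of_periodic (K := K) (S := S)
    (fun k : ℤ => (g^[(k % n).toNat] ⟨x, hx⟩).1) n hn (fun k => by simp) (fun k => by
      have h3 : (g^[((k + 1) % n).toNat] ⟨x, hx⟩) = g^[(k % n).toNat + 1] ⟨x, hx⟩ := by
        rw [← hper ((k % n).toNat + 1)]
        congr 2
        have h4 := Int.emod_nonneg k hn'
        zify
        rw [Int.toNat_of_nonneg (Int.emod_nonneg _ hn'), Int.toNat_of_nonneg h4]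
        simp
      rw [h3, Function.iterate_succ_apply']
      exact hg _) 0
  simpa using key

/-- If `r` and its proper extension `rz` are perfect then so is `z`. -/
theorem IsPerfect.of_comp [∀ a b : V, Finite (a ⟶ b)] (hS : IsAdmissible K S) {a b c : V}
    {r : Path a b} {z : Path b c} (hr : IsPerfect K S (tot r))
    (hrz : IsPerfect K S (tot (r.comp z))) (hz : 0 < z.length) :
    IsPerfect K S (tot z) ∧ ∃ (d e : V) (s : Path c d) (y : Path d e),
      IsPerfectPair K S r (z.comp s) ∧ IsPerfectPair K S (r.comp z) s ∧
      IsPerfectPair K S z (s.comp y) := by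
  -- The chain starting at z alternates between two kinds of paths: tails z of perfect paths r and
  -- rz, and products sr where (s, rz) is a perfect pair. Each kind has a successor of the other
  -- kind.
  let X₁ : TPath V → Prop := fun x => ∃ (a b c : V) (r : Path a b) (z : Path b c),
    x = tot z ∧ IsPerfect K S (tot r) ∧ IsPerfect K S (tot (r.comp z)) ∧ 0 < z.length
  let X₂ : TPath V → Prop := fun x => ∃ (a b c d : V) (s : Path a b) (r : Path b c) (z : Path c d),
    x = tot (s.comp r) ∧ IsPerfect K S (tot r) ∧ IsPerfectPair K S s (r.comp z) ∧ 0 < z.length ∧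
      IsPerfect K S (tot (r.comp z)) ∧ cls K S (s.comp r) ≠ 0
  have H₁ : ∀ {a b c : V} (r : Path a b) (z : Path b c), IsPerfect K S (tot r) →
      IsPerfect K S (tot (r.comp z)) → 0 < z.length → ∃ (d e : V) (s : Path c d) (y : Path d e),
        IsPerfectPair K S r (z.comp s) ∧ IsPerfectPair K S (r.comp z) s ∧
        IsPerfectPair K S z (s.comp y) ∧ X₂ (tot (s.comp y)) := by
    intro a b c r z hr hrz hz
    obtain ⟨d₁, t, ht, ht'⟩ := hr.exists_succ
    obtain ⟨d, s, hs, hs'⟩ := hrz.exists_succ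
    have hzs0 : cls K S (r.comp (z.comp s)) = 0 := by rw [← Path.comp_assoc]; exact hs.comp_eq_zero
    -- Otherwise left minimality of (rz, s) would make rz a right divisor of the shorter path z.
    have hzs : cls K S (z.comp s) ≠ 0 := by
      intro h0
      obtain ⟨x, hx⟩ := hs.left_minimal z (cls_ne_zero_right hs.nonzero_left) h0
      have := congrArg Path.length hx
      have := hr.length_pos
      simp only [Path.length_comp] at *
      omega
    obtain ⟨x, hx⟩ := ht.right_minimal _ hzs hzs0
    -- The successor t of r divides zs. If t = zy, then minimality of (rz, s) makes s a left divisor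
    -- of y, so t is all of zs; and t cannot divide z, because rz is non-zero.
    have hx0 : x.length = 0 := by
      rcases comp_eq_comp_cases hx with ⟨y, hy, hy'⟩ | ⟨y, hy, hy'⟩
      · obtain ⟨y', hy''⟩ := hs.right_minimal y (cls_ne_zero_right (hy ▸ ht.nonzero_right))
          (by rw [Path.comp_assoc, ← hy]; exact ht.comp_eq_zero)
        have h1 := congrArg Path.length hy'
        have h2 := congrArg Path.length hy''
        simp only [Path.length_comp] at h1 h2
        omega
      · exact absurd ht.comp_eq_zero (fun h0 => hrz.ne_zero (by
          rw [hy, ← Path.comp_assoc, cls_comp, h0, zero_mul]))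
    obtain rfl := Path.eq_of_length_zero x hx0
    obtain rfl := Path.eq_nil_of_length_zero x hx0
    rw [Path.comp_nil] at hx
    subst hx
    obtain ⟨e, r₂, hr₂, hr₂'⟩ := ht'.exists_succ
    obtain ⟨f, p₂, hp₂, hp₂'⟩ := hs'.exists_succ
    -- The successors of zs and of s are r₂ and r₂z₂, so z₂ is again a tail of the first kind.
    obtain ⟨z₂, hz₂⟩ := hr₂.right_minimal p₂ hp₂.nonzero_right (by
      rw [Path.comp_assoc, cls_comp, hp₂.comp_eq_zero, mul_zero])
    subst hz₂
    have hsr : cls K S (s.comp r₂) ≠ 0 := by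
      intro h0
      obtain ⟨x, hx⟩ := hr₂.left_minimal s hs.nonzero_right h0
      have := congrArg Path.length hx
      simp only [Path.length_comp] at this
      omega
    have hz₂ : 0 < z₂.length := by
      rw [Nat.pos_iff_ne_zero]
      intro h0
      obtain rfl := Path.eq_of_length_zero z₂ h0
      obtain rfl := Path.eq_nil_of_length_zero z₂ h0
      exact hsr (by simpa using hp₂.comp_eq_zero)
    refine ⟨_, e, s, r₂, ht, hs, ⟨cls_ne_zero_right hrz.ne_zero, hsr, hz, ?_, ?_, ?_, ?_⟩,
      _, _, _, _, s, r₂, z₂, rfl, hr₂', hp₂, hz₂, hp₂', hsr⟩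
    · have := hr₂'.length_pos
      simp only [Path.length_comp]
      omega
    · rw [← Path.comp_assoc]
      exact hr₂.comp_eq_zero
    · intro d' q hq h0
      obtain ⟨q', rfl⟩ := hs.right_minimal q hq (by
        rw [Path.comp_assoc, cls_comp, h0, mul_zero])
      obtain ⟨q'', rfl⟩ := hr₂.right_minimal q' (cls_ne_zero_right hq) (by
        rw [Path.comp_assoc]; exact h0)
      exact ⟨q'', (Path.comp_assoc _ _ _).symm⟩
    · intro d' q hq h0
      by_cases h1 : cls K S (q.comp s) = 0
      · obtain ⟨q', rfl⟩ := hs.left_minimal q hq h1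
        exact ⟨q'.comp r, (Path.comp_assoc _ _ _).symm⟩
      · obtain ⟨q', hq'⟩ := hr₂.left_minimal _ h1 (by rw [Path.comp_assoc]; exact h0)
        rw [← Path.comp_assoc] at hq'
        exact ⟨q', Path.comp_injective_left s hq'⟩
  have hX : ∀ x, X₁ x ∨ X₂ x → ∃ y, (X₁ y ∨ X₂ y) ∧ PerfectSucc K S x y := by
    rintro x (⟨a, b, c, r, z, rfl, hr, hrz, hz⟩ | ⟨a, b, c, d, s, r, z, rfl, hr, hs, hz, hrz, hsr⟩)
    · obtain ⟨d, e, s, y, -, -, h1, h2⟩ := H₁ r z hr hrz hz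
      exact ⟨_, Or.inr h2, perfectSucc_tot.2 h1⟩
    · obtain ⟨e, -, t, -, ht, ht', -, -⟩ := H₁ r z hr hrz hz
      refine ⟨tot z, Or.inl ⟨_, _, _, r, z, rfl, hr, hrz, hz⟩, perfectSucc_tot.2
        ⟨hsr, cls_ne_zero_right hrz.ne_zero, ?_, hz, ?_, ?_, ?_⟩⟩
      · have := hr.length_pos
        simp only [Path.length_comp]
        omega
      · rw [Path.comp_assoc]
        exact hs.comp_eq_zero
      · intro d' q hq h0
        by_cases h1 : cls K S (r.comp q) = 0
        · obtain ⟨q', rfl⟩ := ht.right_minimal q hq h1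
          exact ⟨t.comp q', Path.comp_assoc _ _ _⟩
        · obtain ⟨q', hq'⟩ := hs.right_minimal _ h1 (by rw [← Path.comp_assoc]; exact h0)
          rw [Path.comp_assoc] at hq'
          exact ⟨q', Path.comp_injective_right r hq'⟩
      · intro d' q hq h0
        obtain ⟨q', rfl⟩ := ht.left_minimal q hq (by
          rw [← Path.comp_assoc, cls_comp, h0, zero_mul])
        obtain ⟨q'', rfl⟩ := hs.left_minimal q' (cls_ne_zero_left hq) (by
          rw [← Path.comp_assoc]; exact h0)
        exact ⟨q'', Path.comp_assoc _ _ _⟩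
  obtain ⟨d, e, s, y, h1, h2, h3, -⟩ := H₁ r z hr hrz hz
  exact ⟨isPerfect_of_forall_exists hS (fun x => X₁ x ∨ X₂ x) hX
    (Or.inl ⟨_, _, _, r, z, rfl, hr, hrz, hz⟩), d, e, s, y, h1, h2, h3⟩

end PerfectPathLemmas


/-! ### Overlaps of perfect paths and minimal perfect paths -/

section Overlaps

open Quiver

variable {K : Type w} [Field K] {V : Type u} [Quiver.{v} V] [Fintype V] {S : Set (TPath V)}

/-- Passing to successors turns the overlap of ab and by in b into an overlap of yc and cd in c.
Moreover the overlap b is followed by the new union ycd, and the old union aby by the new overlap c,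
which is what makes an infinite chain. -/
theorem exists_overlap_succ {s₁ s₂ s₃ s₄ : V} {a : Path s₁ s₂} {b : Path s₂ s₃} {y : Path s₃ s₄}
    (hp : IsPerfect K S (tot (a.comp b))) (hx : IsPerfect K S (tot (b.comp y)))
    (hb : 0 < b.length) (h : cls K S (a.comp (b.comp y)) ≠ 0) :
    ∃ (t₁ t₂ : V) (c : Path s₄ t₁) (d : Path t₁ t₂), IsPerfect K S (tot (y.comp c)) ∧
      IsPerfect K S (tot (c.comp d)) ∧ 0 < c.length ∧ cls K S (y.comp (c.comp d)) ≠ 0 ∧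
      IsPerfectPair K S b (y.comp (c.comp d)) ∧ IsPerfectPair K S (a.comp (b.comp y)) c := by
  obtain ⟨t₁, p₁, hp₁, hp₁'⟩ := hp.exists_succ
  obtain ⟨t₂, x₁, hx₁, hx₁'⟩ := hx.exists_succ
  have hne : cls K S (y.comp x₁) ≠ 0 := by
    intro h0
    obtain ⟨z, hz⟩ := hx₁.left_minimal y (cls_ne_zero_right hx.ne_zero) h0
    have := congrArg Path.length hz
    simp only [Path.length_comp] at this
    omega
  obtain ⟨d, hd⟩ := hp₁.right_minimal _ hne (by
    rw [Path.comp_assoc, ← Path.comp_assoc b, cls_comp, hx₁.comp_eq_zero, mul_zero])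
  rcases comp_eq_comp_cases hd with ⟨c, rfl, rfl⟩ | ⟨z, rfl, -⟩
  swap
  · refine absurd ?_ h
    rw [← Path.comp_assoc, ← Path.comp_assoc, cls_comp, hp₁.comp_eq_zero, zero_mul]
  have hc : 0 < c.length := by
    rw [Nat.pos_iff_ne_zero]
    intro h0
    obtain rfl := Path.eq_of_length_zero c h0
    obtain rfl := Path.eq_nil_of_length_zero c h0
    exact h (by simpa using hp₁.comp_eq_zero)
  refine ⟨t₁, t₂, c, d, hp₁', hx₁', hc, hne,
    ⟨cls_ne_zero_left hx.ne_zero, hne, hb, ?_, ?_, ?_, ?_⟩,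
    ⟨h, cls_ne_zero_left hx₁'.ne_zero, ?_, hc, ?_, ?_, ?_⟩⟩
  · simp only [Path.length_comp]
    omega
  · rw [← Path.comp_assoc]
    exact hx₁.comp_eq_zero
  · intro e q hq h0
    obtain ⟨q', rfl⟩ := hp₁.right_minimal q hq (by
      rw [Path.comp_assoc, cls_comp, h0, mul_zero])
    rw [Path.comp_assoc] at hq
    obtain ⟨q'', hq''⟩ := hx₁.right_minimal (c.comp q') (cls_ne_zero_right hq) (by
      rw [← h0]; simp only [Path.comp_assoc])
    exact ⟨q'', by rw [Path.comp_assoc, hq'', Path.comp_assoc, Path.comp_assoc, Path.comp_assoc]⟩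
  · intro e q hq h0
    by_cases h1 : cls K S (q.comp y) = 0
    · obtain ⟨z, rfl⟩ := hp₁.left_minimal q hq (by
        rw [← Path.comp_assoc, cls_comp, h1, zero_mul])
      exact ⟨z.comp a, (Path.comp_assoc _ _ _).symm⟩
    · obtain ⟨z, hz⟩ := hx₁.left_minimal _ h1 (by rw [Path.comp_assoc]; exact h0)
      rw [← Path.comp_assoc] at hz
      exact ⟨z, Path.comp_injective_left y hz⟩
  · simp only [Path.length_comp]
    omega
  · rw [← hp₁.comp_eq_zero]
    simp only [Path.comp_assoc]
  · intro e q hq h0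
    by_cases h1 : cls K S (y.comp q) = 0
    · obtain ⟨q', rfl⟩ := hx₁.right_minimal q hq (by
        rw [Path.comp_assoc, cls_comp, h1, mul_zero])
      exact ⟨d.comp q', Path.comp_assoc _ _ _⟩
    · obtain ⟨q', hq'⟩ := hp₁.right_minimal _ h1 (by
        rw [← h0]; simp only [Path.comp_assoc])
      rw [Path.comp_assoc] at hq'
      exact ⟨q', Path.comp_injective_right y hq'⟩
  · intro e q hq h0
    obtain ⟨q', rfl⟩ := hx₁.left_minimal q hq (by
      rw [← Path.comp_assoc, cls_comp, h0, zero_mul])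
    obtain ⟨z, hz⟩ := hp₁.left_minimal (q'.comp b)
      (cls_ne_zero_left (q := y) (by rwa [Path.comp_assoc]))
      (by rw [← h0]; simp only [Path.comp_assoc])
    refine ⟨z, ?_⟩
    rw [← Path.comp_assoc, hz]
    simp only [Path.comp_assoc]

/-- If the perfect paths `ab` and `by` overlap in the non-trivial path `b`, and `aby` is non-zero,
then `b` is perfect, and so is `p₀a` for the perfect path `p₀` preceding `ab`. -/
theorem IsPerfect.of_overlap [∀ a b : V, Finite (a ⟶ b)] (hS : IsAdmissible K S)
    {s₁ s₂ s₃ s₄ : V} {a : Path s₁ s₂} {b : Path s₂ s₃} {y : Path s₃ s₄}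
    (hp : IsPerfect K S (tot (a.comp b))) (hx : IsPerfect K S (tot (b.comp y)))
    (hb : 0 < b.length) (h : cls K S (a.comp (b.comp y)) ≠ 0) :
    ∃ (s₀ : V) (p₀ : Path s₀ s₁), IsPerfect K S (tot p₀) ∧ IsPerfect K S (tot (p₀.comp a)) := by
  -- Overlaps and unions together are closed under taking successors.
  let X : TPath V → Prop := fun x => ∃ (s₁ s₂ s₃ s₄ : V) (a : Path s₁ s₂) (b : Path s₂ s₃)
    (y : Path s₃ s₄), (x = tot b ∨ x = tot (a.comp (b.comp y))) ∧ IsPerfect K S (tot (a.comp b)) ∧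
      IsPerfect K S (tot (b.comp y)) ∧ 0 < b.length ∧ cls K S (a.comp (b.comp y)) ≠ 0
  have hbp : IsPerfect K S (tot b) := by
    refine isPerfect_of_forall_exists hS X ?_ ⟨_, _, _, _, a, b, y, Or.inl rfl, hp, hx, hb, h⟩
    rintro x ⟨s₁, s₂, s₃, s₄, a, b, y, hxx, hp, hx, hb, h⟩
    obtain ⟨t₁, t₂, c, d, h1, h2, h3, h4, h5, h6⟩ := exists_overlap_succ hp hx hb h
    rcases hxx with rfl | rfl
    · exact ⟨_, ⟨_, _, _, _, y, c, d, Or.inr rfl, h1, h2, h3, h4⟩, perfectSucc_tot.2 h5⟩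
    · exact ⟨_, ⟨_, _, _, _, y, c, d, Or.inl rfl, h1, h2, h3, h4⟩, perfectSucc_tot.2 h6⟩
  obtain ⟨s₀, p₀, hp₀, hp₀'⟩ := hp.exists_pred
  obtain ⟨t₀, x₀, hx₀, hx₀'⟩ := hx.exists_pred
  have hne : cls K S (p₀.comp a) ≠ 0 := by
    intro h0
    obtain ⟨z, hz⟩ := hp₀.right_minimal a (cls_ne_zero_left hp.ne_zero) h0
    have := congrArg Path.length hz
    simp only [Path.length_comp] at this
    omega
  have h0 : cls K S ((p₀.comp a).comp b) = 0 := by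
    rw [Path.comp_assoc]
    exact hp₀.comp_eq_zero
  obtain ⟨z, hz⟩ := hx₀.left_minimal _ hne (by
    rw [← Path.comp_assoc, cls_comp, h0, zero_mul])
  have hz' : ∃ z' : Path t₀ s₁, x₀ = z'.comp a := by
    rcases comp_eq_comp_cases hz with ⟨z', -, hz'⟩ | ⟨z', -, hz'⟩
    · refine absurd ?_ h
      rw [hz', Path.comp_assoc, cls_comp, hx₀.comp_eq_zero, mul_zero]
    · exact ⟨z', hz'⟩
  obtain ⟨z', rfl⟩ := hz'
  -- Since b is already known to be perfect, it is enough to identify p₀a as its perfect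
  -- predecessor.
  have hpair : IsPerfectPair K S (p₀.comp a) b := by
    refine ⟨hne, hbp.ne_zero, ?_, hb, h0, ?_, ?_⟩
    · have := hp₀.pos_left
      simp only [Path.length_comp]
      omega
    · intro e q hq h1
      by_cases h2 : cls K S (a.comp q) = 0
      · obtain ⟨q', rfl⟩ := hx₀.right_minimal q hq (by
          rw [Path.comp_assoc, cls_comp, h2, mul_zero])
        exact ⟨y.comp q', Path.comp_assoc _ _ _⟩
      · obtain ⟨q', hq'⟩ := hp₀.right_minimal _ h2 (by rw [← Path.comp_assoc]; exact h1)
        rw [Path.comp_assoc] at hq'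
        exact ⟨q', Path.comp_injective_right a hq'⟩
    · intro e q hq h1
      obtain ⟨q', rfl⟩ := hx₀.left_minimal q hq (by
        rw [← Path.comp_assoc, cls_comp, h1, zero_mul])
      rw [← Path.comp_assoc] at hq
      obtain ⟨q'', hq''⟩ := hp₀.left_minimal (q'.comp z') (cls_ne_zero_left hq) (by
        rw [← h1]; simp only [Path.comp_assoc])
      exact ⟨q'', by rw [← Path.comp_assoc, hq'', Path.comp_assoc]⟩
  exact ⟨s₀, p₀, hp₀', hpair.isPerfect_left hbp⟩

variable (K S) in
/-- A perfect path without perfect proper left divisors. -/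
def IsMinPerfect {a b : V} (p : Path a b) : Prop :=
  IsPerfect K S (tot p) ∧ ∀ {c : V} (x : Path a c) (y : Path c b), p = x.comp y →
    IsPerfect K S (tot x) → y.length = 0

theorem IsPerfect.exists_isMinPerfect {a b : V} {p : Path a b} (hp : IsPerfect K S (tot p)) :
    ∃ (c : V) (x : Path a c) (y : Path c b), p = x.comp y ∧ IsMinPerfect K S x := by
  induction hn : p.length using Nat.strong_induction_on generalizing b with
  | _ n ih =>
  by_cases h : IsMinPerfect K S p
  · exact ⟨b, p, Path.nil, rfl, h⟩
  · have h' : ∃ (c : V) (x : Path a c) (y : Path c b), p = x.comp y ∧ IsPerfect K S (tot x) ∧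
        y.length ≠ 0 := by
      by_contra h1
      push Not at h1
      exact h ⟨hp, fun x y => h1 _ x y⟩
    obtain ⟨c, x, y, rfl, hx, hy⟩ := h'
    rw [Path.length_comp] at hn
    obtain ⟨d, x', y', rfl, h1⟩ := ih _ (by omega) hx rfl
    exact ⟨d, x', y'.comp y, Path.comp_assoc _ _ _, h1⟩

theorem IsMinPerfect.eq_of_comp_eq {a b b' c : V} {p : Path a b} {p' : Path a b'} {x : Path b c}
    {x' : Path b' c} (hp : IsMinPerfect K S p) (hp' : IsMinPerfect K S p')
    (h : p.comp x = p'.comp x') : tot p = tot p' := by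
  rcases comp_eq_comp_cases h with ⟨z, rfl, -⟩ | ⟨z, rfl, -⟩
  · have h0 := hp'.2 _ _ rfl hp.1
    obtain rfl := Path.eq_of_length_zero z h0
    obtain rfl := Path.eq_nil_of_length_zero z h0
    rfl
  · have h0 := hp.2 _ _ rfl hp'.1
    obtain rfl := Path.eq_of_length_zero z h0
    obtain rfl := Path.eq_nil_of_length_zero z h0
    rfl

/-- A longest proper perfect left divisor would be the target of a Hasse arrow. Induction on the
length of the cofactor y reaches such a divisor. -/
theorem IsCoelementary.isMinPerfect {a b : V} {p : Path a b} (h : IsCoelementary K S (tot p)) :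
    IsMinPerfect K S p := by
  refine ⟨h.1, ?_⟩
  intro c x y hxy hx
  by_contra hy
  induction hn : y.length using Nat.strong_induction_on generalizing c with
  | _ n ih =>
  refine h.2 (tot x) ⟨hx, h.1, ⟨hxy ▸ leftDivisor_tot x y, ?_⟩, ?_⟩
  · intro e
    have h1 : x.length = p.length := congrArg TPath.len e
    rw [hxy, Path.length_comp] at h1
    omega
  · rintro ⟨⟨d₁, d, z⟩, hz, ⟨h1, h1'⟩, h2, h2'⟩
    obtain ⟨x', hx'⟩ := h1.exists_comp
    cases hx'
    obtain ⟨y', hy'⟩ := h2.exists_comp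
    rw [tot_inj, hxy, Path.comp_assoc] at hy'
    have hy'' := Path.comp_injective_right x hy'
    subst hy''
    have h3 : x'.length ≠ 0 := by
      intro h0
      obtain rfl := Path.eq_of_length_zero x' h0
      obtain rfl := Path.eq_nil_of_length_zero x' h0
      exact h1' rfl
    have h4 : y'.length ≠ 0 := by
      intro h0
      obtain rfl := Path.eq_of_length_zero y' h0
      obtain rfl := Path.eq_nil_of_length_zero y' h0
      exact h2' (by rw [hxy]; rfl)
    rw [Path.length_comp] at hn
    exact ih y'.length (by omega) (x.comp x') y' (by rw [hxy, Path.comp_assoc]) hz h4 rfl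

/-- The overlaps of a perfect path `ρw` with another perfect path `by`. -/
theorem IsMinPerfect.overlap_cases [∀ a b : V, Finite (a ⟶ b)] (hS : IsAdmissible K S)
    {s₁ s₂ s₃ s₄ t t' t'' : V} {ρ : Path s₁ t} {w : Path t s₃} {g : Path s₃ t'} {v : Path t' t''}
    {a : Path s₁ s₂} {b : Path s₂ s₃} {y : Path s₃ s₄} {c : Path s₄ t''}
    (hρ : IsMinPerfect K S ρ) (hg : IsMinPerfect K S g) (hp : IsPerfect K S (tot (ρ.comp w)))
    (hab : ρ.comp w = a.comp b) (hx : IsPerfect K S (tot (b.comp y))) (hb : 0 < b.length)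
    (hne : cls K S (a.comp (b.comp y)) ≠ 0) (hv : g.comp v = y.comp c) :
    (∃ a', a = ρ.comp a') ∨ (∃ y', y = g.comp y') ∨ (a.length = 0 ∧ y.length = 0) := by
  rcases comp_eq_comp_cases hab with ⟨a', ha', -⟩ | ⟨z, hz, -⟩
  · exact Or.inl ⟨a', ha'⟩
  rcases comp_eq_comp_cases hv with ⟨y', hy', -⟩ | ⟨z', hz', -⟩
  · exact Or.inr (Or.inl ⟨y', hy'⟩)
  -- What remains is that a divides ρ and y divides g. If a is trivial, cancelling ρw = b from by
  -- makes a non-trivial y perfect, so y = g by minimality; if a is non-trivial, it is perfect by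
  -- `IsPerfect.of_overlap` and cancellation of p₀, so a = ρ.
  by_cases ha : a.length = 0
  · by_cases hy : y.length = 0
    · exact Or.inr (Or.inr ⟨ha, hy⟩)
    · obtain rfl := Path.eq_of_length_zero a ha
      obtain rfl := Path.eq_nil_of_length_zero a ha
      rw [Path.nil_comp] at hab
      rw [hab] at hp
      have h1 := (hp.of_comp hS hx (Nat.pos_of_ne_zero hy)).1
      have h2 := hg.2 _ _ hz' h1
      obtain rfl := Path.eq_of_length_zero z' h2
      obtain rfl := Path.eq_nil_of_length_zero z' h2
      exact Or.inr (Or.inl ⟨Path.nil, by simpa using hz'.symm⟩)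
  · rw [hab] at hp
    obtain ⟨s₀, p₀, h1, h2⟩ := IsPerfect.of_overlap hS hp hx hb hne
    have h3 := (h1.of_comp hS h2 (Nat.pos_of_ne_zero ha)).1
    have h4 := hρ.2 _ _ hz h3
    obtain rfl := Path.eq_of_length_zero z h4
    obtain rfl := Path.eq_nil_of_length_zero z h4
    exact Or.inl ⟨Path.nil, by simpa using hz.symm⟩

end Overlaps


/-! ### Segments of a cyclic word -/

section Words

open Quiver

variable {V : Type u} [Quiver.{v} V]

theorem tot_comp_congr {a b c a' b' c' : V} {p : Path a b} {x : Path b c} {p' : Path a' b'}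
    {x' : Path b' c'} (hp : tot p = tot p') (hx : tot x = tot x') :
    tot (p.comp x) = tot (p'.comp x') := by
  cases hp
  cases hx
  rfl

theorem tot_eq_of_comp {a b c a' b' c' : V} {p : Path a b} {x : Path b c} {p' : Path a' b'}
    {x' : Path b' c'} (h : tot (p.comp x) = tot (p'.comp x')) (hp : tot p = tot p') :
    tot x = tot x' := by
  cases hp
  have h' := h
  obtain ⟨-, h⟩ := Sigma.mk.inj h
  obtain ⟨rfl, -⟩ := Sigma.mk.inj (eq_of_heq h)
  rw [tot_inj] at h' ⊢
  exact Path.comp_injective_right p h'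

theorem LeftDivisor.trans {x y z : TPath V} (h : LeftDivisor x y) (h' : LeftDivisor y z) :
    LeftDivisor x z := by
  obtain ⟨a, b, c, p, q, rfl, rfl⟩ := h
  obtain ⟨x, hx⟩ := LeftDivisor.exists_comp (q := z.2.2) h'
  exact ⟨_, _, _, p, q.comp x, rfl, by rw [← Path.comp_assoc]; exact hx⟩

theorem LeftDivisor.refl (x : TPath V) : LeftDivisor x x :=
  ⟨_, _, _, x.2.2, Path.nil, rfl, rfl⟩

theorem LeftDivisor.exists_left {x : TPath V} {a b : V} {q : Path a b}
    (h : LeftDivisor x (tot q)) :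
    ∃ (c : V) (p : Path a c) (y : Path c b), x = tot p ∧ q = p.comp y := by
  obtain ⟨_, _, _, p, y, h1, h2⟩ := h
  cases h2
  exact ⟨_, p, y, h1, rfl⟩

theorem cyclePow_add {a : V} (c : Path a a) (k l : ℕ) :
    cyclePow c (k + l) = (cyclePow c k).comp (cyclePow c l) := by
  induction l with
  | zero => rfl
  | succ l ih => rw [← add_assoc, cyclePow, ih, cyclePow, Path.comp_assoc]

theorem cyclePow_mul {a : V} (c : Path a a) (k l : ℕ) :
    cyclePow c (k * l) = cyclePow (cyclePow c k) l := by
  induction l with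
  | zero => rfl
  | succ l ih => rw [Nat.mul_succ, cyclePow_add, ih, cyclePow]

namespace CyclicSeq

variable (r : CyclicSeq V)

variable {r} in
theorem tot_path_congr {i j : ℤ} (h : i = j) : tot (r.path i) = tot (r.path j) := by rw [h]

variable {r} in
theorem tot_seg_congr {i j : ℤ} (h : i = j) (k : ℕ) : tot (r.seg i k) = tot (r.seg j k) := by
  rw [h]

theorem tot_seg_succ (i : ℤ) (k : ℕ) :
    tot (r.seg i (k + 1)) = tot ((r.seg i k).comp (r.path (i + k))) := tot_cast _ _ _

/-- The tail is compared with a segment only after applying `tot`, because endpoints such as `i + (s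
+ t)` and `i + s + t` are equal only propositionally. The same convention is used for all segments
below. -/
theorem seg_add (i : ℤ) (s t : ℕ) : ∃ q : Path (r.vert (i + s)) (r.vert (i + (s + t : ℕ))),
    tot q = tot (r.seg (i + s) t) ∧ r.seg i (s + t) = (r.seg i s).comp q := by
  have h : ∃ (d : V) (q : Path (r.vert (i + s)) d),
      tot q = tot (r.seg (i + s) t) ∧ tot (r.seg i (s + t)) = tot ((r.seg i s).comp q) := by
    induction t with
    | zero => exact ⟨_, Path.nil, (tot_cast _ _ _).symm, rfl⟩
    | succ t ih =>
      obtain ⟨d, q, h1, h2⟩ := ih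
      refine ⟨_, _, rfl, (r.tot_seg_succ i (s + t)).trans ?_⟩
      obtain ⟨-, h3⟩ := Sigma.mk.inj h1
      obtain ⟨rfl, h3⟩ := Sigma.mk.inj (eq_of_heq h3)
      obtain rfl := eq_of_heq h3
      have h4 : tot (r.path (i + (s + t : ℕ))) = tot (r.path (i + s + t)) :=
        tot_path_congr (by push_cast; ring)
      refine (tot_comp_congr h2 h4).trans ?_
      rw [Path.comp_assoc]
      exact tot_comp_congr rfl (r.tot_seg_succ _ _).symm
  obtain ⟨d, q, h1, h2⟩ := h
  obtain ⟨-, h3⟩ := Sigma.mk.inj h2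
  obtain ⟨rfl, h3⟩ := Sigma.mk.inj (eq_of_heq h3)
  exact ⟨q, h1, eq_of_heq h3⟩

theorem tot_comp_seg {a b c : V} {p : Path a b} {x : Path b c} {i : ℤ} {s t : ℕ}
    (hp : tot p = tot (r.seg i s)) (hx : tot x = tot (r.seg (i + s) t)) :
    tot (p.comp x) = tot (r.seg i (s + t)) := by
  obtain ⟨q, h1, h2⟩ := r.seg_add i s t
  rw [h2]
  exact tot_comp_congr hp (hx.trans h1.symm)

theorem tot_seg_split {a b c : V} {p : Path a b} {x : Path b c} {i : ℤ} {s t : ℕ}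
    (hp : tot p = tot (r.seg i s)) (h : tot (p.comp x) = tot (r.seg i (s + t))) :
    tot x = tot (r.seg (i + s) t) := by
  obtain ⟨q, h1, h2⟩ := r.seg_add i s t
  rw [h2] at h
  exact (tot_eq_of_comp h hp).trans h1

theorem tot_seg_one (i : ℤ) : tot (r.seg i 1) = tot (r.path i) := by
  refine (r.tot_seg_succ i 0).trans ?_
  have h : tot (r.path (i + (0 : ℕ))) = tot (r.path i) := tot_path_congr (by simp)
  refine (tot_comp_congr (p' := Path.nil) (tot_cast _ _ _) h).trans ?_
  rw [Path.nil_comp]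

theorem tot_seg_periodic (i : ℤ) (k : ℕ) : tot (r.seg (i + r.n) k) = tot (r.seg i k) := by
  induction k with
  | zero =>
    have h : r.vert (i + r.n) = r.vert i := congrArg Sigma.fst (r.periodic i)
    refine (tot_cast _ _ _).trans (Eq.trans ?_ (tot_cast _ _ _).symm)
    rw [h]
  | succ k ih =>
    refine (r.tot_seg_succ _ _).trans (Eq.trans ?_ (r.tot_seg_succ _ _).symm)
    refine tot_comp_congr ih ?_
    rw [add_right_comm]
    exact r.periodic _

theorem tot_seg_periodic_mul (i : ℤ) (k l : ℕ) :
    tot (r.seg (i + (r.n * l : ℕ)) k) = tot (r.seg i k) := by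
  induction l with
  | zero => exact tot_seg_congr (by simp) k
  | succ l ih =>
    rw [← ih, ← r.tot_seg_periodic (i + (r.n * l : ℕ))]
    exact tot_seg_congr (by push_cast; ring) k

theorem exists_eq_path_comp {i : ℤ} {b : V} {x : Path (r.vert i) b} {t : ℕ}
    (hx : tot x = tot (r.seg i (t + 1))) :
    ∃ y : Path (r.vert (i + 1)) b, x = (r.path i).comp y ∧ tot y = tot (r.seg (i + 1) t) := by
  rw [add_comm t 1] at hx
  obtain ⟨q, h1, h2⟩ := r.seg_add i 1 t
  rw [h2] at hx
  have h3 := r.tot_seg_one i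
  obtain ⟨-, h4⟩ := Sigma.mk.inj h3
  obtain ⟨h5, h4⟩ := Sigma.mk.inj (eq_of_heq h4)
  obtain ⟨-, h6⟩ := Sigma.mk.inj hx
  obtain ⟨rfl, h6⟩ := Sigma.mk.inj (eq_of_heq h6)
  refine ⟨q.cast h5 rfl, ?_, (tot_cast _ _ _).trans h1⟩
  rw [← tot_inj, hx]
  exact tot_comp_congr h3 (tot_cast _ _ _).symm

/-- `x` is a left divisor of the infinite word `r_j r_{j+1} ⋯`. -/
def IsPrefix (j : ℤ) (x : TPath V) : Prop := ∃ k : ℕ, LeftDivisor x (tot (r.seg j k))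

variable {r}

theorem seg_leftDivisor (j : ℤ) {k l : ℕ} (h : k ≤ l) :
    LeftDivisor (tot (r.seg j k)) (tot (r.seg j l)) := by
  obtain ⟨t, rfl⟩ := Nat.exists_eq_add_of_le h
  obtain ⟨q, -, h2⟩ := r.seg_add j k t
  rw [h2]
  exact leftDivisor_tot _ _

theorem IsPrefix.of_leftDivisor {j : ℤ} {x y : TPath V} (h : r.IsPrefix j y)
    (hx : LeftDivisor x y) : r.IsPrefix j x := by
  obtain ⟨k, hk⟩ := h
  exact ⟨k, hx.trans hk⟩

theorem isPrefix_seg (j : ℤ) (k : ℕ) : r.IsPrefix j (tot (r.seg j k)) := ⟨k, LeftDivisor.refl _⟩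

theorem isPrefix_path (j : ℤ) : r.IsPrefix j (tot (r.path j)) := by
  rw [← r.tot_seg_one]
  exact isPrefix_seg j 1

theorem IsPrefix.exists_comp_eq {j : ℤ} {b b' : V} {p : Path (r.vert j) b}
    {p' : Path (r.vert j) b'} (h : r.IsPrefix j (tot p)) (h' : r.IsPrefix j (tot p')) :
    ∃ (c : V) (x : Path b c) (x' : Path b' c), p.comp x = p'.comp x' := by
  obtain ⟨k, h⟩ := h
  obtain ⟨k', h'⟩ := h'
  obtain ⟨x, hx⟩ := (h.trans (seg_leftDivisor j (le_max_left k k'))).exists_comp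
  obtain ⟨x', hx'⟩ := (h'.trans (seg_leftDivisor j (le_max_right k k'))).exists_comp
  exact ⟨_, x, x', tot_inj.1 (hx.symm.trans hx')⟩

theorem IsPrefix.of_comp {j : ℤ} {a b c : V} {p : Path a b} {x : Path b c} {t : ℕ}
    (h : r.IsPrefix j (tot (p.comp x))) (hp : tot p = tot (r.seg j t)) :
    r.IsPrefix (j + t) (tot x) := by
  obtain ⟨k, h⟩ := h
  obtain ⟨y, hy⟩ := (h.trans (seg_leftDivisor j (Nat.le_add_left k t))).exists_comp
  rw [Path.comp_assoc] at hy
  exact ⟨k, _, _, _, x, y, rfl, (r.tot_seg_split hp hy.symm).symm⟩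

theorem tot_seg_mul {a : V} {d : Path a a} (h : tot (r.seg 1 r.n) = tot d) (k : ℕ) :
    tot (r.seg 1 (r.n * k)) = tot (cyclePow d k) := by
  induction k with
  | zero =>
    obtain ⟨h, -⟩ := Sigma.mk.inj h
    subst h
    exact tot_cast _ _ _
  | succ k ih =>
    rw [Nat.mul_succ]
    exact (r.tot_comp_seg ih.symm (h.symm.trans (r.tot_seg_periodic_mul 1 r.n k).symm)).symm

theorem tot_bracket {i j : ℤ} {k : ℕ} (h : j + 1 - i = k) :
    tot (r.bracket i j) = tot (r.seg i k) := by
  have : (j + 1 - i).toNat = k := by omega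
  subst this
  rfl

theorem length_seg_lt (hr : ∀ k : ℤ, 0 < (r.path k).length) (j : ℤ) :
    StrictMono fun t => (r.seg j t).length := by
  refine strictMono_nat_of_lt_succ fun t => ?_
  have h : (r.seg j (t + 1)).length = _ := congrArg TPath.len (r.tot_seg_succ j t)
  have h' : (tot ((r.seg j t).comp (r.path (j + t)))).len =
    (r.seg j t).length + (r.path (j + t)).length := Path.length_comp _ _
  rw [h, h']
  exact Nat.lt_add_of_pos_right (hr _)

end CyclicSeq

end Words

/-! ### Perfect paths on a cycle of co-elementary paths -/

section CoelementaryCycles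

open Quiver

variable {K : Type w} [Field K] {V : Type u} [Quiver.{v} V] [Fintype V] {S : Set (TPath V)}
  [∀ a b : V, Finite (a ⟶ b)]

namespace CyclicSeq

variable {r r' : CyclicSeq V}

/-- The minimal perfect left divisor of z must be r_j. Cancelling it leaves a shorter perfect path
read from position j + 1, and the argument repeats. -/
theorem IsPrefix.exists_eq_seg (hS : IsAdmissible K S)
    (hr : ∀ k : ℤ, IsMinPerfect K S (r.path k)) {j : ℤ} {b : V} {z : Path (r.vert j) b}
    (hz : MonAlg.IsPerfect K S (tot z)) (h : r.IsPrefix j (tot z)) :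
    ∃ t : ℕ, tot z = tot (r.seg j (t + 1)) := by
  induction hn : z.length using Nat.strong_induction_on generalizing j with
  | _ n ih =>
  obtain ⟨c, x, y, rfl, hx⟩ := hz.exists_isMinPerfect
  obtain ⟨d, x₁, x₂, e⟩ := (h.of_leftDivisor (leftDivisor_tot x y)).exists_comp_eq
    (isPrefix_path j)
  have hx' := hx.eq_of_comp_eq (hr j) e
  cases hx'
  by_cases hy : y.length = 0
  · obtain rfl := Path.eq_of_length_zero y hy
    obtain rfl := Path.eq_nil_of_length_zero y hy
    exact ⟨0, (r.tot_seg_one j).symm⟩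
  · have hy' := ((hr j).1.of_comp hS hz (Nat.pos_of_ne_zero hy)).1
    have h1 := (hr j).1.length_pos
    rw [Path.length_comp] at hn
    obtain ⟨t, ht⟩ := ih _ (by omega) hy' (h.of_comp (t := 1) (r.tot_seg_one j).symm) rfl
    refine ⟨t + 1, ?_⟩
    rw [add_comm (t + 1) 1]
    exact r.tot_comp_seg (r.tot_seg_one j).symm ht

/-- A perfect segment of the word of `r` starts at position `j`, the perfect path following it
starts with `r'_k`, and the word of `r` continues as the word of `r'` from position `k` on. -/
def Aligned (K : Type w) [Field K] (S : Set (TPath V)) (r r' : CyclicSeq V) (j : ℤ) : Prop :=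
  ∃ (k : ℤ) (b d : V) (z : Path (r.vert j) b) (s : Path b d) (t : ℕ),
    tot z = tot (r.seg j (t + 1)) ∧ MonAlg.IsPerfect K S (tot z) ∧ IsPerfectPair K S z s ∧
      LeftDivisor (tot (r'.path k)) (tot s) ∧
      ∀ l, r.IsPrefix (j + (t + 1 : ℕ)) (tot (r'.seg k l))

/-- The path r'_k, being perfect and read along r, is a segment of r. Its successor is r'_{k+1}, and
this is the index that witnesses `Aligned`. -/
theorem aligned_of_isPrefix (hS : IsAdmissible K S) (hr : ∀ k : ℤ, IsMinPerfect K S (r.path k))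
    (hr' : r'.IsPerfect K S) {j k : ℤ} (h : ∀ l, r.IsPrefix j (tot (r'.seg k l))) :
    ∃ t : ℕ, tot (r'.path k) = tot (r.seg j (t + 1)) ∧ Aligned K S r r' j := by
  have h1 : r.IsPrefix j (tot (r'.path k)) := by
    rw [← r'.tot_seg_one]
    exact h 1
  have hp : MonAlg.IsPerfect K S (tot (r'.path k)) := ⟨r', hr', k, rfl⟩
  have h2 : ∃ (b : V) (z : Path (r.vert j) b), tot (r'.path k) = tot z := by
    obtain ⟨l, h1⟩ := h1
    obtain ⟨c, p, y, h2, -⟩ := h1.exists_left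
    exact ⟨c, p, h2⟩
  obtain ⟨b, z, hz⟩ := h2
  have hs := perfectSucc_tot.2 (hr' k)
  rw [hz] at hp h1 hs
  obtain ⟨t, ht⟩ := h1.exists_eq_seg hS hr hp
  obtain ⟨d, s, hzs, -⟩ := hp.exists_succ
  refine ⟨t, hz.trans ht, k + 1, b, d, z, s, t, ht, hp, hzs, ?_, fun l => ?_⟩
  · rw [hs.right_unique (perfectSucc_tot.2 hzs)]
    exact LeftDivisor.refl _
  · obtain ⟨q, hq, e⟩ := r'.seg_add k 1 l
    have h3 := h (1 + l)
    rw [e] at h3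
    have h4 := h3.of_comp (t := t + 1) ((r'.tot_seg_one k).trans (hz.trans ht))
    rw [hq] at h4
    exact h4

/-- Alignment moves along the word one letter at a time, and at each letter it reveals that the
successor of r_j begins with r_{j+1}. -/
theorem Aligned.succ (hS : IsAdmissible K S) (hr : ∀ k : ℤ, IsMinPerfect K S (r.path k))
    (hr' : r'.IsPerfect K S) {j : ℤ} (h : Aligned K S r r' j) :
    Aligned K S r r' (j + 1) ∧
      ∃ s, PerfectSucc K S (tot (r.path j)) s ∧ LeftDivisor (tot (r.path (j + 1))) s := by
  obtain ⟨k, b, d, z, s, t, ht, hz, hzs, hk, hl⟩ := h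
  obtain ⟨z', rfl, hz'⟩ := r.exists_eq_path_comp ht
  -- If the segment is r_j alone, the next path of r' takes over. If it is longer,
  -- `IsPerfect.of_comp` strips r_j, and the successor sy of the remaining tail still begins with
  -- r'_k.
  cases t with
  | zero =>
    have h0 : z'.length = 0 := by
      have := congrArg TPath.len hz'
      refine this.trans ?_
      exact congrArg TPath.len (tot_cast (p := Path.nil) _ _)
    obtain rfl := Path.eq_of_length_zero z' h0
    obtain rfl := Path.eq_nil_of_length_zero z' h0
    obtain ⟨t', ht', h1⟩ := aligned_of_isPrefix hS hr hr' hl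
    refine ⟨h1, tot s, perfectSucc_tot.2 hzs, LeftDivisor.trans ?_ hk⟩
    rw [ht']
    have := seg_leftDivisor (r := r) (j + 1) (Nat.le_add_left 1 t')
    rwa [r.tot_seg_one] at this
  | succ t =>
    have hpos : 0 < z'.length := by
      obtain ⟨y, rfl, -⟩ := r.exists_eq_path_comp hz'
      have := (hr (j + 1)).1.length_pos
      rw [Path.length_comp]
      omega
    obtain ⟨hp, _, e, s', y, h1, h2, h3⟩ := (hr j).1.of_comp hS hz hpos
    have e2 := h2.right_unique hzs
    cases e2
    refine ⟨⟨k, b, _, z', s.comp y, t, hz', hp, h3, hk.trans (leftDivisor_tot _ _), fun l => ?_⟩,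
      _, perfectSucc_tot.2 h1, ?_⟩
    · have := hl l
      have e3 : j + 1 + ((t + 1 : ℕ) : ℤ) = j + ((t + 1 + 1 : ℕ) : ℤ) := by push_cast; ring
      rwa [e3]
    · obtain ⟨y', rfl, -⟩ := r.exists_eq_path_comp hz'
      rw [Path.comp_assoc]
      exact leftDivisor_tot _ _

/-- The hypothesis only says that some perfect sequence r' has a power of c as its product;
minimality of c plays no role. Reading r' along the word of r gives alignment at position 1, hence
at all later positions, and periodicity does the rest. -/
theorem exists_succ_of_isUnderlyingCycle (hS : IsAdmissible K S)
    (hc : IsUnderlyingCycle K S r.total) (hr : ∀ k : ℤ, IsMinPerfect K S (r.path k)) (j : ℤ) :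
    ∃ s, PerfectSucc K S (tot (r.path j)) s ∧ LeftDivisor (tot (r.path (j + 1))) s := by
  obtain ⟨r', hr', ⟨a, d, l, -, h1, h2⟩, -⟩ := hc
  have h1' : tot (r.seg 1 r.n) = tot d := (tot_bracket (by ring)).symm.trans h1
  have h2' : tot (r'.seg 1 r'.n) = tot (cyclePow d l) := (tot_bracket (by ring)).symm.trans h2
  have h0 : Aligned K S r r' 1 := by
    refine (aligned_of_isPrefix hS hr hr' (k := 1) fun k => ?_).choose_spec.2
    refine ⟨r.n * (l * k), ?_⟩
    rw [tot_seg_mul h1', cyclePow_mul, ← tot_seg_mul h2']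
    exact seg_leftDivisor 1 (Nat.le_mul_of_pos_left k r'.n_pos)
  have h3 : ∀ k : ℕ, Aligned K S r r' (1 + k) := by
    intro k
    induction k with
    | zero => simpa using h0
    | succ k ih =>
      have := (ih.succ hS hr hr').1
      rwa [add_assoc] at this
  -- The index j is moved by a multiple of the period to a position at least 1.
  obtain ⟨k, hk⟩ : ∃ k : ℕ, j + (r.n * j.natAbs + r.n : ℕ) = 1 + k := by
    have h4 := r.n_pos
    have h5 : j.natAbs ≤ r.n * j.natAbs := Nat.le_mul_of_pos_left _ h4
    generalize r.n * j.natAbs = l at h5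
    exact ⟨(j + (l + r.n : ℕ) - 1).toNat, by omega⟩
  obtain ⟨s, hs, hs'⟩ := ((h3 k).succ hS hr hr').2
  rw [← hk] at hs hs'
  have e : ∀ i : ℤ, tot (r.path (i + (r.n * j.natAbs + r.n : ℕ))) = tot (r.path i) := by
    intro i
    rw [← tot_seg_one, ← tot_seg_one, ← Nat.mul_succ, tot_seg_periodic_mul]
  rw [e] at hs
  rw [add_right_comm, e] at hs'
  exact ⟨s, hs, hs'⟩

/-- The tail y is perfect, and it is a left divisor of the successor ys of r_j, which also begins
with r_{j+1}. So the minimal perfect left divisor of y is r_{j+1}, and induction applies to what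
follows it. -/
theorem exists_eq_seg_of_succ (hS : IsAdmissible K S)
    (hr : ∀ k : ℤ, IsMinPerfect K S (r.path k))
    (hJ : ∀ j, ∃ s, PerfectSucc K S (tot (r.path j)) s ∧ LeftDivisor (tot (r.path (j + 1))) s)
    {j : ℤ} {b : V} (y : Path (r.vert (j + 1)) b)
    (h : MonAlg.IsPerfect K S (tot ((r.path j).comp y))) :
    ∃ t : ℕ, tot ((r.path j).comp y) = tot (r.seg j (t + 1)) := by
  induction hn : y.length using Nat.strong_induction_on generalizing j with
  | _ n ih =>
  by_cases hy : y.length = 0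
  · obtain rfl := Path.eq_of_length_zero y hy
    obtain rfl := Path.eq_nil_of_length_zero y hy
    exact ⟨0, (r.tot_seg_one j).symm⟩
  · obtain ⟨hy', d, e, s, y₂, h1, -, -⟩ := (hr j).1.of_comp hS h (Nat.pos_of_ne_zero hy)
    obtain ⟨s', h2, h3⟩ := hJ j
    rw [h2.right_unique (perfectSucc_tot.2 h1)] at h3
    obtain ⟨q, hq⟩ := h3.exists_comp
    obtain ⟨c, x, y', rfl, hx⟩ := hy'.exists_isMinPerfect
    rw [tot_inj, Path.comp_assoc] at hq
    have h5 := hx.eq_of_comp_eq (hr (j + 1)) hq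
    cases h5
    have h6 := (hr (j + 1)).1.length_pos
    rw [Path.length_comp] at hn
    obtain ⟨t, ht⟩ := ih y'.length (by omega) y' hy' rfl
    refine ⟨t + 1, ?_⟩
    rw [add_comm (t + 1) 1]
    exact r.tot_comp_seg (r.tot_seg_one j).symm ht

/-- The perfect paths on an underlying cycle `c = r₁ ⋯ rₙ` with all `r_k` co-elementary. -/
theorem perfect_segments (hS : IsAdmissible K S)
    (hc : IsUnderlyingCycle K S r.total) (hr : ∀ k : ℤ, IsMinPerfect K S (r.path k)) :
    (∀ (j : ℤ) (t : ℕ), 0 < t → (MonAlg.IsPerfect K S (tot (r.seg j t)) ↔ t ≤ numPerfect K S r)) ∧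
    (∀ (j : ℤ) (t : ℕ), 0 < t → t ≤ numPerfect K S r →
      PerfectSucc K S (tot (r.seg j t)) (tot (r.seg (j + t) (numPerfect K S r + 1 - t)))) := by
  have hJ := exists_succ_of_isUnderlyingCycle hS hc hr
  have hlen := length_seg_lt fun k => (hr k).1.length_pos
  have hinj : ∀ (j : ℤ) (s t : ℕ), tot (r.seg j s) = tot (r.seg j t) → s = t := fun j s t h =>
    (hlen j).injective (congrArg TPath.len h)
  -- The successor of r_j is perfect and begins with r_{j+1}, hence is a segment. Its number of
  -- factors, M j + 1, turns out to be m_c.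
  have h1 : ∀ j, ∃ M : ℕ, PerfectSucc K S (tot (r.path j)) (tot (r.seg (j + 1) (M + 1))) := by
    intro j
    obtain ⟨s, hs, hs'⟩ := hJ j
    obtain ⟨d, q, hq, hq'⟩ := (hr j).1.exists_succ
    rw [hs.right_unique (perfectSucc_tot.2 hq)] at hs'
    obtain ⟨x, hx⟩ := hs'.exists_comp
    rw [hx] at hq'
    obtain ⟨t, ht⟩ := exists_eq_seg_of_succ hS hr hJ x hq'
    exact ⟨t, by rw [← ht, ← hx]; exact perfectSucc_tot.2 hq⟩
  choose M hM using h1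
  have h2 : ∀ (j : ℤ) (t : ℕ), MonAlg.IsPerfect K S (tot (r.seg j (t + 1))) → t ≤ M j ∧
      (0 < t → MonAlg.IsPerfect K S (tot (r.seg (j + 1) t))) ∧
      PerfectSucc K S (tot (r.seg j (t + 1))) (tot (r.seg (j + (t + 1 : ℕ)) (M j + 1 - t))) := by
    intro j t ht
    obtain ⟨z, hz, hz'⟩ := r.exists_eq_path_comp (x := r.seg j (t + 1)) rfl
    rw [hz] at ht ⊢
    by_cases h0 : t = 0
    · subst h0
      have h0 : z.length = 0 := by
        refine (congrArg TPath.len hz').trans ?_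
        exact congrArg TPath.len (tot_cast (p := Path.nil) _ _)
      refine ⟨Nat.zero_le _, fun h => absurd h (lt_irrefl _), ?_⟩
      rw [← hz]
      have h3 := hM j
      rw [← r.tot_seg_one] at h3
      exact h3
    · obtain ⟨t, rfl⟩ := Nat.exists_eq_succ_of_ne_zero h0
      obtain ⟨y, hy, -⟩ := r.exists_eq_path_comp hz'
      have hpos : 0 < z.length := by
        have := (hr (j + 1)).1.length_pos
        rw [hy, Path.length_comp]
        omega
      obtain ⟨hp, d, e, s, y₂, h3, h4, -⟩ := (hr j).1.of_comp hS ht hpos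
      have h5 := (perfectSucc_tot.2 h3).right_unique (hM j)
      -- The successor of r_j is the tail z followed by the non-trivial path s, hence strictly
      -- longer than z.
      have h6 : t + 1 < M j + 1 := by
        by_contra h6
        have h7 := (hlen (j + 1)).monotone (not_lt.1 h6)
        have h8 : z.length = (r.seg (j + 1) (t + 1)).length := congrArg TPath.len hz'
        have h9 : (z.comp s).length = (r.seg (j + 1) (M j + 1)).length := congrArg TPath.len h5
        have h10 := h4.pos_right
        rw [Path.length_comp] at h9
        omega
      refine ⟨by omega, fun _ => hz' ▸ hp, ?_⟩
      obtain ⟨l, hl⟩ := Nat.exists_eq_add_of_le h6.le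
      rw [hl] at h5
      have h7 := r.tot_seg_split hz' h5
      have h8 : tot (r.seg (j + (t.succ + 1 : ℕ)) (M j + 1 - t.succ)) = tot s := by
        have h9 : M j + 1 - t.succ = l := by omega
        rw [h7, h9]
        exact tot_seg_congr (by push_cast; ring) l
      rw [h8]
      exact perfectSucc_tot.2 h4
  have hMp : ∀ j, MonAlg.IsPerfect K S (tot (r.seg (j + 1) (M j + 1))) := by
    intro j
    obtain ⟨d, q, hq, hq'⟩ := (hr j).1.exists_succ
    rwa [(hM j).right_unique (perfectSucc_tot.2 hq)]
  -- The successor of r_j is a perfect segment at j + 1 with M j + 1 factors, and M (j + 1) bounds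
  -- such segments.
  have hmono : ∀ j, M j ≤ M (j + 1) := fun j => (h2 _ _ (hMp j)).1
  have hper : ∀ j, M (j + r.n) = M j := by
    intro j
    have h3 := hM (j + r.n)
    have h4 : tot (r.path (j + r.n)) = tot (r.path j) := r.periodic j
    rw [h4, add_right_comm, r.tot_seg_periodic] at h3
    exact Nat.succ_injective (hinj _ _ _ (h3.right_unique (hM j)))
  have hmono' : ∀ (j : ℤ) (k : ℕ), M j ≤ M (j + k) := by
    intro j k
    induction k with
    | zero => simp
    | succ k ih => exact ih.trans (by have := hmono (j + k); rwa [add_assoc] at this)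
  -- Going once around the cycle restores M, so monotonicity leaves no room for an increase.
  have hstep : ∀ j, M (j + 1) = M j := by
    intro j
    refine le_antisymm ?_ (hmono j)
    have h3 := hmono' (j + 1) (r.n - 1)
    have h4 : j + 1 + ((r.n - 1 : ℕ) : ℤ) = j + r.n := by
      have := r.n_pos
      omega
    rwa [h4, hper] at h3
  have hconst : ∀ j, M j = M 0 := by
    intro j
    induction j using Int.induction_on with
    | zero => rfl
    | succ j ih => rw [hstep, ih]
    | pred j ih => rw [← ih, ← hstep (-j - 1), sub_add_cancel]
  -- Descending induction from the longest segments: each shorter one is the tail of a perfect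
  -- segment starting one position earlier.
  have hdown : ∀ (k : ℕ) (j : ℤ) (t : ℕ), t + k = M 0 → MonAlg.IsPerfect K S (tot (r.seg j (t + 1))) := by
    intro k
    induction k with
    | zero =>
      intro j t ht
      have h3 := hMp (j - 1)
      rw [sub_add_cancel, hconst, ← ht] at h3
      exact h3
    | succ k ih =>
      intro j t ht
      have h3 := ih (j - 1) (t + 1) (by omega)
      have h4 := (h2 _ _ h3).2.1 (by omega)
      rwa [sub_add_cancel] at h4
  have hiff : ∀ (j : ℤ) (t : ℕ), 0 < t → (MonAlg.IsPerfect K S (tot (r.seg j t)) ↔ t ≤ M 0 + 1) := by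
    intro j t ht
    obtain ⟨t, rfl⟩ := Nat.exists_eq_succ_of_ne_zero ht.ne'
    refine ⟨fun h => ?_, fun h => hdown (M 0 - t) j t (by omega)⟩
    have := (h2 _ _ h).1
    rw [hconst] at this
    omega
  have hnum : numPerfect K S r = M 0 + 1 := by
    have h3 : {p : TPath V | MonAlg.IsPerfect K S p ∧
        LeftDivisor (tot (r.path 1)) p} =
        (fun t => tot (r.seg 1 t)) '' (Finset.Icc 1 (M 0 + 1) : Finset ℕ) := by
      ext ⟨a, b, p⟩
      constructor
      · rintro ⟨h3, h4⟩
        obtain ⟨x, hx⟩ := h4.exists_comp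
        have h3' : MonAlg.IsPerfect K S (tot p) := h3
        rw [hx] at h3'
        obtain ⟨t, ht⟩ := exists_eq_seg_of_succ hS hr hJ x h3'
        rw [ht] at h3'
        refine ⟨t + 1, ?_, (hx.trans ht).symm⟩
        simpa using (hiff 1 (t + 1) (by omega)).1 h3'
      · rintro ⟨t, ht, ht'⟩
        simp only [Finset.coe_Icc, Set.mem_Icc] at ht
        have ht'' : tot (r.seg 1 t) = ⟨a, b, p⟩ := ht'
        rw [← ht'']
        refine ⟨(hiff 1 t (by omega)).2 ht.2, ?_⟩
        rw [← r.tot_seg_one]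
        exact seg_leftDivisor 1 ht.1
    rw [numPerfect, h3, Set.ncard_image_of_injective _ fun s t h => hinj 1 s t h,
      Set.ncard_coe_finset]
    simp
  rw [hnum]
  refine ⟨hiff, fun j t ht ht' => ?_⟩
  obtain ⟨t, rfl⟩ := Nat.exists_eq_succ_of_ne_zero ht.ne'
  have := (h2 j t ((hiff j _ ht).2 ht')).2.2
  rw [hconst] at this
  have h4 : M 0 + 1 + 1 - t.succ = M 0 + 1 - t := by omega
  rw [h4]
  exact this

end CyclicSeq

end CoelementaryCycles


/-! ### Left and right divisors -/

section Divisors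

open Quiver

variable {V : Type u} [Quiver.{v} V]

/-- `x` is a right divisor of `y`. -/
def RightDivisor (x y : TPath V) : Prop :=
  ∃ (a b c : V) (p : Path a b) (q : Path b c), x = tot q ∧ y = tot (p.comp q)

/-- The length bound keeps x inside p. It is what makes selecting paths by a fixed prefix compatible
with right multiplication. -/
theorem leftDivisor_comp_iff {x : TPath V} {a b c : V} {p : Path a b} {q : Path b c}
    (h : x.len ≤ p.length) : LeftDivisor x (tot (p.comp q)) ↔ LeftDivisor x (tot p) := by
  refine ⟨fun hx => ?_, fun hx => hx.trans (leftDivisor_tot p q)⟩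
  obtain ⟨d, y, z, rfl, e⟩ := hx.exists_left
  rcases comp_eq_comp_cases e with ⟨t, rfl, -⟩ | ⟨t, rfl, -⟩
  · have h' : (p.comp t).length ≤ p.length := h
    rw [Path.length_comp] at h'
    have h0 : t.length = 0 := by omega
    obtain rfl := Path.eq_of_length_zero t h0
    obtain rfl := Path.eq_nil_of_length_zero t h0
    exact LeftDivisor.refl _
  · exact leftDivisor_tot _ _

theorem rightDivisor_comp_iff {x : TPath V} {a b c : V} {p : Path b c} {q : Path a b}
    (h : x.len ≤ p.length) : RightDivisor x (tot (q.comp p)) ↔ RightDivisor x (tot p) := by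
  constructor
  · rintro ⟨_, d, _, y, z, rfl, e⟩
    have e' := e
    obtain ⟨rfl, e⟩ := Sigma.mk.inj e
    obtain ⟨rfl, -⟩ := Sigma.mk.inj (eq_of_heq e)
    rcases comp_eq_comp_cases (tot_inj.1 e') with ⟨t, -, rfl⟩ | ⟨t, -, rfl⟩
    · exact ⟨_, _, _, t, z, rfl, rfl⟩
    · have h' : (t.comp p).length ≤ p.length := h
      rw [Path.length_comp] at h'
      have h0 : t.length = 0 := by omega
      obtain rfl := Path.eq_of_length_zero t h0
      obtain rfl := Path.eq_nil_of_length_zero t h0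
      exact ⟨_, _, _, Path.nil, p, by rw [Path.nil_comp], by rw [Path.nil_comp]⟩
  · rintro ⟨_, _, _, y, z, rfl, e⟩
    cases e
    exact ⟨_, _, _, q.comp y, z, rfl, by rw [Path.comp_assoc]⟩

theorem eq_of_single_ne_zero {K : Type w} [Field K] {x z : TPath V} (h : Finsupp.single x (1 : K) z ≠ 0) : x = z := by
  classical
  by_contra h'
  exact h (Finsupp.single_eq_of_ne (Ne.symm h'))

end Divisors

/-! ### The basis of non-zero paths -/

section Coefficients

open Quiver

variable (K : Type w) [Field K] {V : Type u} [Quiver.{v} V] [Fintype V] (S : Set (TPath V))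

open Classical in
/-- The coefficients of an element of the path algebra at the paths that are non-zero in `KV/I`. -/
noncomputable def pathRep : PathAlg K V →ₗ[K] (TPath V →₀ K) :=
  Finsupp.linearCombination K fun x : TPath V =>
    if cls K S x.2.2 = 0 then 0 else Finsupp.single x 1

open Classical in
theorem pathRep_ofPath (x : TPath V) :
    pathRep K S (ofPath K x) = if cls K S x.2.2 = 0 then 0 else Finsupp.single x 1 :=
  linearCombination_ofPath K _ x

theorem pathRep_pathMul_left (x y : TPath V) (h : cls K S y.2.2 = 0) :
    pathRep K S (pathMul K x y) = 0 := by
  obtain ⟨a, b, p⟩ := x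
  obtain ⟨c, d, q⟩ := y
  by_cases e : b = c
  · subst e
    rw [pathMul_comp, pathRep_ofPath, if_pos]
    exact (cls_comp p q).trans (by rw [show cls K S q = 0 from h, mul_zero])
  · rw [pathMul_of_ne K (by exact e), map_zero]

theorem pathRep_pathMul_right (x y : TPath V) (h : cls K S x.2.2 = 0) :
    pathRep K S (pathMul K x y) = 0 := by
  obtain ⟨a, b, p⟩ := x
  obtain ⟨c, d, q⟩ := y
  by_cases e : b = c
  · subst e
    rw [pathMul_comp, pathRep_ofPath, if_pos]
    exact (cls_comp p q).trans (by rw [show cls K S p = 0 from h, zero_mul])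
  · rw [pathMul_of_ne K (by exact e), map_zero]

theorem pathRep_mul_left (x : TPath V) (m : PathAlg K V) :
    pathRep K S (ofPath K x * m) = Finsupp.linearCombination K
      (fun y => pathRep K S (pathMul K x y)) (pathRep K S m) := by
  induction m using PathAlg.induction with
  | h0 => simp
  | hadd y z hy hz => rw [mul_add, map_add, hy, hz, map_add, map_add]
  | hs a y =>
    rw [mul_smul_comm, map_smul, map_smul, map_smul, pathRep_ofPath, PathAlg.mul_def,
      mulBilin_ofPath]
    split_ifs with h
    · rw [pathRep_pathMul_left K S x y h, map_zero]
    · rw [Finsupp.linearCombination_single, one_smul]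

theorem pathRep_mul_right (x : TPath V) (m : PathAlg K V) :
    pathRep K S (m * ofPath K x) = Finsupp.linearCombination K
      (fun y => pathRep K S (pathMul K y x)) (pathRep K S m) := by
  induction m using PathAlg.induction with
  | h0 => simp
  | hadd y z hy hz => rw [add_mul, map_add, hy, hz, map_add, map_add]
  | hs a y =>
    rw [smul_mul_assoc, map_smul, map_smul, map_smul, pathRep_ofPath, PathAlg.mul_def,
      mulBilin_ofPath]
    split_ifs with h
    · rw [pathRep_pathMul_right K S y x h, map_zero]
    · rw [Finsupp.linearCombination_single, one_smul]

/-- Here monomiality enters: the ideal is generated by paths, so the non-zero paths stay linearly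
independent in the quotient and coefficients are well defined. -/
theorem pathRep_eq_zero {x : PathAlg K V} (hx : x ∈ relIdeal K S) : pathRep K S x = 0 := by
  induction hx using TwoSidedIdeal.span_induction with
  | mem x h =>
    obtain ⟨y, hy, rfl⟩ := h
    rw [pathRep_ofPath, if_pos]
    exact (Alg.mk_eq_zero K S).2 (TwoSidedIdeal.subset_span ⟨y, hy, rfl⟩)
  | zero => exact map_zero _
  | add x y _ _ hx hy => rw [map_add, hx, hy, add_zero]
  | neg x _ hx => rw [map_neg, hx, neg_zero]
  | left_absorb a x _ hx =>
    induction a using PathAlg.induction with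
    | h0 => rw [zero_mul, map_zero]
    | hadd y z hy hz => rw [add_mul, map_add, hy, hz, add_zero]
    | hs a y => rw [smul_mul_assoc, map_smul, pathRep_mul_left, hx, map_zero, smul_zero]
  | right_absorb a x _ hx =>
    induction a using PathAlg.induction with
    | h0 => rw [mul_zero, map_zero]
    | hadd y z hy hz => rw [mul_add, map_add, hy, hz, add_zero]
    | hs a y => rw [mul_smul_comm, map_smul, pathRep_mul_right, hx, map_zero, smul_zero]

/-- The coefficients of an element of `KV/I` with respect to the basis of the non-zero paths. -/
noncomputable def rep : Alg K S →ₗ[K] (TPath V →₀ K) where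
  toFun := Quotient.lift (fun x => pathRep K S x) (by
    intro x y h
    have h' : x - y ∈ relIdeal K S := (TwoSidedIdeal.rel_iff _ _ _).1 h
    have := pathRep_eq_zero K S h'
    rwa [map_sub, sub_eq_zero] at this)
  map_add' := by
    intro x y
    obtain ⟨x, rfl⟩ := Alg.mk_surjective K S x
    obtain ⟨y, rfl⟩ := Alg.mk_surjective K S y
    exact map_add (pathRep K S) x y
  map_smul' := by
    intro a x
    obtain ⟨x, rfl⟩ := Alg.mk_surjective K S x
    exact map_smul (pathRep K S) a x

variable {K S}

theorem rep_cls {a b : V} (p : Path a b) (h : cls K S p ≠ 0) :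
    rep K S (cls K S p) = Finsupp.single (tot p) 1 :=
  (pathRep_ofPath K S (tot p)).trans (if_neg h)

theorem Alg.induction {P : Alg K S → Prop} (x : Alg K S) (h0 : P 0)
    (hadd : ∀ x y, P x → P y → P (x + y))
    (hs : ∀ (c : K) {a b : V} (p : Path a b), cls K S p ≠ 0 → P (c • cls K S p)) : P x := by
  obtain ⟨x, rfl⟩ := Alg.mk_surjective K S x
  induction x using PathAlg.induction with
  | h0 => rwa [map_zero]
  | hadd x y hx hy => rw [map_add]; exact hadd _ _ hx hy
  | hs c x =>
    rw [Alg.mk_smul]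
    by_cases h : cls K S x.2.2 = 0
    · have h' : Alg.mk K S (ofPath K x) = 0 := h
      rwa [h', smul_zero]
    · exact hs c x.2.2 h

theorem linearCombination_rep (x : Alg K S) :
    Finsupp.linearCombination K (fun y : TPath V => cls K S y.2.2) (rep K S x) = x := by
  induction x using Alg.induction with
  | h0 => simp
  | hadd x y hx hy => rw [map_add, map_add, hx, hy]
  | hs c p h => rw [map_smul, map_smul, rep_cls p h, Finsupp.linearCombination_single, one_smul]

theorem rep_injective : Function.Injective (rep K S) := fun x y h => by
  rw [← linearCombination_rep x, h, linearCombination_rep]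

theorem cls_ne_zero_of_rep {x : Alg K S} {a b : V} {p : Path a b} (h : rep K S x (tot p) ≠ 0) :
    cls K S p ≠ 0 := by
  induction x using Alg.induction with
  | h0 => simp at h
  | hadd x y hx hy =>
    rw [map_add, Finsupp.add_apply] at h
    by_cases h' : rep K S x (tot p) = 0
    · rw [h', zero_add] at h
      exact hy h
    · exact hx h'
  | hs c q hq =>
    rw [map_smul, rep_cls q hq] at h
    cases eq_of_single_ne_zero (right_ne_zero_of_mul h)
    exact hq

theorem mem_of_rep {N : Submodule K (Alg K S)} {x : Alg K S}
    (h : ∀ {a b : V} (p : Path a b), rep K S x (tot p) ≠ 0 → cls K S p ∈ N) : x ∈ N := by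
  rw [← linearCombination_rep x, Finsupp.linearCombination_apply]
  refine Submodule.finsuppSum_mem _ _ _ _ fun y hy => ?_
  exact N.smul_mem _ (h y.2.2 hy)

/-- Left cancellation of paths: q is the only basis element that left multiplication by p sends to
pq, so no other coefficient contributes. -/
theorem rep_cls_mul {a b c : V} {p : Path a b} {q : Path b c} (h : cls K S (p.comp q) ≠ 0)
    (x : Alg K S) : rep K S (cls K S p * x) (tot (p.comp q)) = rep K S x (tot q) := by
  induction x using Alg.induction with
  | h0 => simp
  | hadd x y hx hy => simp only [mul_add, map_add, Finsupp.add_apply, hx, hy]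
  | hs e y hy =>
    rename_i a' b'
    rw [mul_smul_comm, map_smul, map_smul, Finsupp.smul_apply, Finsupp.smul_apply]
    congr 1
    rw [rep_cls y hy]
    by_cases hb : b = a'
    · subst hb
      rw [← cls_comp]
      by_cases e : tot y = tot q
      · cases e
        rw [rep_cls _ h, Finsupp.single_eq_same, Finsupp.single_eq_same]
      · rw [Finsupp.single_eq_of_ne (Ne.symm e)]
        by_cases h' : cls K S (p.comp y) = 0
        · rw [h']
          simp
        · rw [rep_cls _ h', Finsupp.single_eq_of_ne]
          exact fun e' => e (tot_eq_of_comp e'.symm rfl)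
    · rw [cls_mul_of_ne p y hb, Finsupp.single_eq_of_ne]
      · simp
      · intro e
        cases e
        exact hb rfl

theorem rep_mul_cls {a b c : V} {p : Path b c} {q : Path a b} (h : cls K S (q.comp p) ≠ 0)
    (x : Alg K S) : rep K S (x * cls K S p) (tot (q.comp p)) = rep K S x (tot q) := by
  induction x using Alg.induction with
  | h0 => simp
  | hadd x y hx hy => simp only [add_mul, map_add, Finsupp.add_apply, hx, hy]
  | hs e y hy =>
    rename_i a' b'
    rw [smul_mul_assoc, map_smul, map_smul, Finsupp.smul_apply, Finsupp.smul_apply]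
    congr 1
    rw [rep_cls y hy]
    by_cases hb : b' = b
    · subst hb
      rw [← cls_comp]
      by_cases e : tot y = tot q
      · cases e
        rw [rep_cls _ h, Finsupp.single_eq_same, Finsupp.single_eq_same]
      · rw [Finsupp.single_eq_of_ne (Ne.symm e)]
        by_cases h' : cls K S (y.comp p) = 0
        · rw [h']
          simp
        · rw [rep_cls _ h', Finsupp.single_eq_of_ne]
          intro e'
          obtain ⟨h1, h2⟩ := Sigma.mk.inj e'
          subst h1
          exact e (tot_inj.2 (Path.comp_injective_left p (tot_inj.1 e'.symm)))
    · rw [cls_mul_of_ne y p hb, Finsupp.single_eq_of_ne]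
      · simp
      · intro e
        cases e
        exact hb rfl

theorem exists_of_rep_cls_mul {a b : V} {p : Path a b} {x : Alg K S} {z : TPath V}
    (h : rep K S (cls K S p * x) z ≠ 0) : ∃ (c : V) (q : Path b c), z = tot (p.comp q) := by
  induction x using Alg.induction with
  | h0 => simp at h
  | hadd x y hx hy =>
    rw [mul_add, map_add, Finsupp.add_apply] at h
    by_cases h' : rep K S (cls K S p * x) z = 0
    · rw [h', zero_add] at h
      exact hy h
    · exact hx h'
  | hs e y hy =>
    rename_i a' b'
    rw [mul_smul_comm, map_smul] at h
    have h := right_ne_zero_of_mul h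
    by_cases hb : b = a'
    · subst hb
      rw [← cls_comp] at h
      have h' : cls K S (p.comp y) ≠ 0 := fun h' => h (by rw [h']; simp)
      rw [rep_cls _ h'] at h
      exact ⟨_, y, (eq_of_single_ne_zero h).symm⟩
    · rw [cls_mul_of_ne p y hb] at h
      simp at h

theorem exists_of_rep_mul_cls {a b : V} {p : Path a b} {x : Alg K S} {z : TPath V}
    (h : rep K S (x * cls K S p) z ≠ 0) : ∃ (c : V) (q : Path c a), z = tot (q.comp p) := by
  induction x using Alg.induction with
  | h0 => simp at h
  | hadd x y hx hy =>
    rw [add_mul, map_add, Finsupp.add_apply] at h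
    by_cases h' : rep K S (x * cls K S p) z = 0
    · rw [h', zero_add] at h
      exact hy h
    · exact hx h'
  | hs e y hy =>
    rename_i a' b'
    rw [smul_mul_assoc, map_smul] at h
    have h := right_ne_zero_of_mul h
    by_cases hb : b' = a
    · subst hb
      rw [← cls_comp] at h
      have h' : cls K S (y.comp p) ≠ 0 := fun h' => h (by rw [h']; simp)
      rw [rep_cls _ h'] at h
      exact ⟨_, y, (eq_of_single_ne_zero h).symm⟩
    · rw [cls_mul_of_ne y p hb] at h
      simp at h

theorem mem_algDeg_iff {i : ℤ} {x : Alg K S} :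
    x ∈ algDeg K S i ↔ ∀ z : TPath V, rep K S x z ≠ 0 → (z.len : ℤ) = i := by
  constructor
  · intro hx z
    induction hx using Submodule.span_induction with
    | mem y h =>
      obtain ⟨x, h, rfl⟩ := h
      by_cases h0 : cls K S x.2.2 = 0
      · have h0' : Alg.mk K S (ofPath K x) = 0 := h0
        rw [h0']
        simp
      · have h0' : rep K S (Alg.mk K S (ofPath K x)) = _ := rep_cls x.2.2 h0
        rw [h0']
        intro h1
        rw [← eq_of_single_ne_zero h1]
        exact h
    | zero => simp
    | add x y _ _ hx hy =>
      intro h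
      rw [map_add, Finsupp.add_apply] at h
      by_cases h' : rep K S x z = 0
      · rw [h', zero_add] at h
        exact hy h
      · exact hx h'
    | smul a x _ hx =>
      intro h
      rw [map_smul] at h
      exact hx (right_ne_zero_of_mul h)
  · intro h
    exact mem_of_rep fun p hp => Submodule.subset_span ⟨tot p, h _ hp, rfl⟩

theorem cls_mem_algDeg {a b : V} (p : Path a b) : cls K S p ∈ algDeg K S p.length :=
  Submodule.subset_span ⟨tot p, rfl, rfl⟩

theorem algProj_mul_cls (i : ℤ) {a b : V} (p : Path a b) (y : Alg K S) :
    algProj K S i (y * cls K S p) = algProj K S (i - p.length) y * cls K S p := by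
  obtain ⟨y, rfl⟩ := Alg.mk_surjective K S y
  rw [cls, ← map_mul, algProj_mk, algProj_mk, pathProj_mul_right, map_mul]
  rfl

variable (K S) in
/-- The class of the trivial path at `a`. -/
noncomputable abbrev idem (a : V) : Alg K S := cls K S (Path.nil : Path a a)

theorem idem_mul_cls {a b : V} (p : Path a b) : idem K S a * cls K S p = cls K S p := by
  rw [← cls_comp, Path.nil_comp]

theorem cls_mul_idem {a b : V} (p : Path a b) : cls K S p * idem K S b = cls K S p := by
  rw [← cls_comp, Path.comp_nil]

theorem exists_of_rep_idem_mul {a : V} {x : Alg K S} {z : TPath V}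
    (h : rep K S (idem K S a * x) z ≠ 0) : ∃ (c : V) (q : Path a c), z = tot q := by
  obtain ⟨c, q, rfl⟩ := exists_of_rep_cls_mul h
  exact ⟨c, q, by rw [Path.nil_comp]⟩

/-- Left multiplication by a homogeneous element of degree zero acts on the paths with a given
source by a scalar. -/
theorem exists_algProj_zero_mul (y : Alg K S) (a : V) :
    ∃ c : K, ∀ {b : V} (q : Path a b), algProj K S 0 y * cls K S q = c • cls K S q := by
  induction y using Alg.induction with
  | h0 => exact ⟨0, fun q => by simp⟩
  | hadd x y hx hy =>
    obtain ⟨c, hc⟩ := hx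
    obtain ⟨d, hd⟩ := hy
    exact ⟨c + d, fun q => by rw [map_add, add_mul, hc, hd, add_smul]⟩
  | hs c p hp =>
    rename_i a' b'
    rw [algProj_smul]
    by_cases h : p.length = 0
    · have h1 : algProj K S 0 (cls K S p) = cls K S p :=
        algProj_of_mem K S 0 (by have := cls_mem_algDeg (K := K) (S := S) p; rwa [h] at this)
      obtain rfl := Path.eq_of_length_zero p h
      obtain rfl := Path.eq_nil_of_length_zero p h
      rw [h1]
      by_cases e : a' = a
      · subst e
        exact ⟨c, fun q => by rw [smul_mul_assoc, idem_mul_cls]⟩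
      · exact ⟨0, fun q => by rw [smul_mul_assoc, cls_mul_of_ne _ _ e, smul_zero, zero_smul]⟩
    · have h1 : algProj K S 0 (cls K S p) = 0 :=
        algProj_of_mem_ne K S (j := p.length) (by omega) (cls_mem_algDeg p)
      exact ⟨0, fun q => by rw [h1, smul_zero, zero_mul, zero_smul]⟩

/-! ### Filtering by a property of paths -/

open Classical in
/-- The part of an element supported on the paths with the property `Q`. -/
noncomputable def filt (Q : TPath V → Prop) : Alg K S →ₗ[K] Alg K S :=
  (Finsupp.linearCombination K fun y : TPath V => if Q y then cls K S y.2.2 else 0) ∘ₗ rep K S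

open Classical in
theorem filt_cls (Q : TPath V → Prop) {a b : V} (p : Path a b) :
    filt Q (cls K S p) = if Q (tot p) then cls K S p else 0 := by
  by_cases h : cls K S p = 0
  · rw [h]
    simp
  · rw [filt, LinearMap.comp_apply, rep_cls p h, Finsupp.linearCombination_single, one_smul]

theorem filt_cls_pos {Q : TPath V → Prop} {a b : V} {p : Path a b} (h : Q (tot p)) :
    filt Q (cls K S p) = cls K S p := by
  rw [filt_cls, if_pos h]

theorem filt_cls_neg {Q : TPath V → Prop} {a b : V} {p : Path a b} (h : ¬ Q (tot p)) :
    filt Q (cls K S p) = 0 := by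
  rw [filt_cls, if_neg h]

theorem Alg.eq_sum (x : Alg K S) : x = ∑ y ∈ (rep K S x).support, rep K S x y • cls K S y.2.2 := by
  conv_lhs => rw [← linearCombination_rep x]
  rfl

open Classical in
theorem rep_filt (Q : TPath V → Prop) (x : Alg K S) (z : TPath V) :
    rep K S (filt Q x) z = if Q z then rep K S x z else 0 := by
  induction x using Alg.induction with
  | h0 => simp
  | hadd x y hx hy =>
    rw [map_add, map_add, map_add, Finsupp.add_apply, Finsupp.add_apply, hx, hy]
    split_ifs <;> simp
  | hs c p hp =>
    rw [map_smul, map_smul, map_smul, Finsupp.smul_apply, Finsupp.smul_apply, filt_cls,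
      rep_cls p hp]
    by_cases h : tot p = z
    · subst h
      split_ifs
      · rw [rep_cls p hp]
      · simp
    · rw [Finsupp.single_eq_of_ne (Ne.symm h)]
      split_ifs <;> simp [rep_cls p hp, Finsupp.single_eq_of_ne (Ne.symm h)]

/-- This turns `filt` into a homomorphism of right modules wherever Q does not change when a path of
the support is prolonged. It serves to construct retractions and test maps into Λ. -/
theorem filt_mul_of_forall {Q : TPath V → Prop} {x : Alg K S} (y : Alg K S)
    (h : ∀ {a b c : V} (p : Path a b) (q : Path b c), rep K S x (tot p) ≠ 0 →
      (Q (tot (p.comp q)) ↔ Q (tot p))) : filt Q (x * y) = filt Q x * y := by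
  induction y using Alg.induction with
  | h0 => simp
  | hadd y z hy hz => rw [mul_add, map_add, hy, hz, mul_add]
  | hs e q hq =>
    rw [mul_smul_comm, mul_smul_comm, map_smul]
    congr 1
    rw [Alg.eq_sum x, Finset.sum_mul, map_sum, map_sum, Finset.sum_mul]
    refine Finset.sum_congr rfl fun z hz => ?_
    obtain ⟨a, b, p⟩ := z
    rw [smul_mul_assoc, map_smul, map_smul, smul_mul_assoc]
    congr 1
    rename_i a' b'
    by_cases e : b = a'
    · subst e
      have h1 := h p q (Finsupp.mem_support_iff.1 hz)
      show filt Q (cls K S p * cls K S q) = filt Q (cls K S p) * cls K S q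
      rw [← cls_comp, filt_cls, filt_cls]
      by_cases hp : Q (tot p)
      · rw [if_pos hp, if_pos (h1.2 hp), cls_comp]
      · rw [if_neg hp, if_neg (fun h' => hp (h1.1 h')), zero_mul]
    · show filt Q (cls K S p * cls K S q) = filt Q (cls K S p) * cls K S q
      rw [cls_mul_of_ne _ _ e, filt_cls]
      split_ifs
      · rw [cls_mul_of_ne _ _ e, map_zero]
      · rw [zero_mul, map_zero]

theorem filt_mul_of_forall' {Q : TPath V → Prop} {x : Alg K S} (y : Alg K S)
    (h : ∀ {a b c : V} (p : Path b c) (q : Path a b), rep K S x (tot p) ≠ 0 →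
      (Q (tot (q.comp p)) ↔ Q (tot p))) : filt Q (y * x) = y * filt Q x := by
  induction y using Alg.induction with
  | h0 => simp
  | hadd y z hy hz => rw [add_mul, map_add, hy, hz, add_mul]
  | hs e q hq =>
    rw [smul_mul_assoc, smul_mul_assoc, map_smul]
    congr 1
    rw [Alg.eq_sum x, Finset.mul_sum, map_sum, map_sum, Finset.mul_sum]
    refine Finset.sum_congr rfl fun z hz => ?_
    obtain ⟨a, b, p⟩ := z
    rw [mul_smul_comm, map_smul, map_smul, mul_smul_comm]
    congr 1
    rename_i a' b'
    by_cases e : b' = a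
    · subst e
      have h1 := h p q (Finsupp.mem_support_iff.1 hz)
      show filt Q (cls K S q * cls K S p) = cls K S q * filt Q (cls K S p)
      rw [← cls_comp, filt_cls, filt_cls]
      by_cases hp : Q (tot p)
      · rw [if_pos hp, if_pos (h1.2 hp), cls_comp]
      · rw [if_neg hp, if_neg (fun h' => hp (h1.1 h')), mul_zero]
    · show filt Q (cls K S q * cls K S p) = cls K S q * filt Q (cls K S p)
      rw [cls_mul_of_ne _ _ e, filt_cls]
      split_ifs
      · rw [cls_mul_of_ne _ _ e, map_zero]
      · rw [mul_zero, map_zero]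

theorem filt_mem_algDeg (Q : TPath V → Prop) {i : ℤ} {x : Alg K S} (hx : x ∈ algDeg K S i) :
    filt Q x ∈ algDeg K S i := by
  rw [mem_algDeg_iff] at hx ⊢
  intro z hz
  rw [rep_filt] at hz
  split_ifs at hz
  · exact hx z hz
  · exact absurd rfl hz

/-! ### Annihilators -/

/-- By cancellation, the annihilator of a path is spanned by the paths it contains, so divisibility
of those paths by q suffices. -/
theorem exists_mul_right_of_forall {a b c : V} {p : Path a b} {q : Path b c}
    (h : ∀ {d : V} (q' : Path b d), cls K S q' ≠ 0 → cls K S (p.comp q') = 0 →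
      ∃ x : Path c d, q' = q.comp x) {x : Alg K S} (hx : cls K S p * x = 0) :
    ∃ y, idem K S b * x = cls K S q * y := by
  have hx' : cls K S p * (idem K S b * x) = 0 := by rw [← mul_assoc, cls_mul_idem, hx]
  have : idem K S b * x ∈ LinearMap.range (LinearMap.mulLeft K (cls K S q)) := by
    refine mem_of_rep fun {s t} z hz => ?_
    obtain ⟨d, z, e⟩ := exists_of_rep_idem_mul hz
    cases e
    have h0 : cls K S (p.comp z) = 0 := by
      by_contra h0
      rw [← rep_cls_mul h0, hx'] at hz
      exact hz (by simp)
    obtain ⟨t, rfl⟩ := h z (cls_ne_zero_of_rep hz) h0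
    exact ⟨cls K S t, (cls_comp q t).symm⟩
  obtain ⟨y, hy⟩ := this
  exact ⟨y, hy.symm⟩

theorem IsPerfectPair.exists_mul_right {a b c : V} {p : Path a b} {q : Path b c}
    (h : IsPerfectPair K S p q) {x : Alg K S} (hx : cls K S p * x = 0) :
    ∃ y, idem K S b * x = cls K S q * y :=
  exists_mul_right_of_forall h.right_minimal hx

theorem IsPerfectPair.exists_mul_left {a b c : V} {p : Path a b} {q : Path b c}
    (h : IsPerfectPair K S p q) {x : Alg K S} (hx : x * cls K S q = 0) :
    ∃ y, x * idem K S b = y * cls K S p := by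
  have hx' : (x * idem K S b) * cls K S q = 0 := by rw [mul_assoc, idem_mul_cls, hx]
  have : x * idem K S b ∈ LinearMap.range (LinearMap.mulRight K (cls K S p)) := by
    refine mem_of_rep fun {s t} z hz => ?_
    obtain ⟨d, z', e⟩ := exists_of_rep_mul_cls hz
    rw [Path.comp_nil] at e
    cases e
    have h0 : cls K S (z'.comp q) = 0 := by
      by_contra h0
      rw [← rep_mul_cls h0, hx'] at hz
      exact hz (by simp)
    obtain ⟨t, rfl⟩ := h.left_minimal z' (cls_ne_zero_of_rep hz) h0
    exact ⟨cls K S t, (cls_comp t p).symm⟩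
  obtain ⟨y, hy⟩ := this
  exact ⟨y, hy.symm⟩

theorem finite_alg [∀ a b : V, Finite (a ⟶ b)] (hS : IsAdmissible K S) :
    Module.Finite K (Alg K S) := by
  refine ⟨⟨((finite_nonzero_paths hS).image fun x : TPath V => cls K S x.2.2).toFinset, ?_⟩⟩
  rw [eq_top_iff]
  intro x _
  refine mem_of_rep fun p hp => Submodule.subset_span ?_
  simp only [Set.Finite.coe_toFinset]
  exact ⟨tot p, cls_ne_zero_of_rep hp, rfl⟩

theorem isNoetherianRing_mulOpposite_alg [∀ a b : V, Finite (a ⟶ b)] (hS : IsAdmissible K S) :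
    IsNoetherianRing (Alg K S)ᵐᵒᵖ := by
  have := finite_alg hS
  have : Module.Finite K (Alg K S)ᵐᵒᵖ := Module.Finite.equiv (MulOpposite.opLinearEquiv K)
  exact IsNoetherianRing.of_finite K _

end Coefficients


/-! ### Graded modules, projectives, and modules generated by paths -/

section GradedModuleLemmas

open Quiver

variable {K : Type w} [Field K] {V : Type u} [Quiver.{v} V] [Fintype V] {S : Set (TPath V)}

noncomputable section

namespace GrMod

/-- The homogeneous components of the elements of a graded module. -/
def component (M : GrMod K S) : ℤ → M.carrier →+ M.carrier :=
  (exists_proj_of_isInternal M.isInternal).choose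

theorem component_mem (M : GrMod K S) (i : ℤ) (x : M.carrier) : M.component i x ∈ M.deg i :=
  (exists_proj_of_isInternal M.isInternal).choose_spec.1 i x

theorem component_of_mem {M : GrMod K S} {i : ℤ} {x : M.carrier} (hx : x ∈ M.deg i) :
    M.component i x = x :=
  (exists_proj_of_isInternal M.isInternal).choose_spec.2.1 i x hx

theorem component_of_mem_ne {M : GrMod K S} {i j : ℤ} (hij : i ≠ j) {x : M.carrier}
    (hx : x ∈ M.deg j) : M.component i x = 0 :=
  (exists_proj_of_isInternal M.isInternal).choose_spec.2.2.1 i j hij x hx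

theorem exists_sum_component (M : GrMod K S) (x : M.carrier) :
    ∃ s : Finset ℤ, ∀ t, s ⊆ t → ∑ i ∈ t, M.component i x = x :=
  (exists_proj_of_isInternal M.isInternal).choose_spec.2.2.2 x

theorem component_eq_of_graded {M : GrMod K S} {A : Type*} [AddCommGroup A] (f : M.carrier →+ A)
    (π : A →+ A) (i : ℤ) (h1 : ∀ x ∈ M.deg i, π (f x) = f x)
    (h2 : ∀ j, j ≠ i → ∀ x ∈ M.deg j, π (f x) = 0) (x : M.carrier) :
    f (M.component i x) = π (f x) := by
  obtain ⟨s, hs⟩ := M.exists_sum_component x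
  have h := hs (insert i s) (Finset.subset_insert i s)
  conv_rhs => rw [← h, map_sum, map_sum]
  rw [Finset.sum_eq_single i, h1 _ (M.component_mem i x)]
  · exact fun j _ hj => h2 j hj _ (M.component_mem j x)
  · exact fun h => absurd (Finset.mem_insert_self i s) h

theorem lin_component {M N : GrMod K S} (f : M ⟶ N) (i : ℤ) (x : M.carrier) :
    lin f (M.component i x) = N.component i (lin f x) :=
  component_eq_of_graded (lin f).toAddMonoidHom (N.component i) i
    (fun _ hx => component_of_mem (lin_deg f hx))
    (fun _ hj _ hx => component_of_mem_ne (Ne.symm hj) (lin_deg f hx)) x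

theorem exists_homogeneous_lift {M N : GrMod K S} (g : M ⟶ N) {i : ℤ} {n : N.carrier}
    (hn : n ∈ N.deg i) (h : ∃ m, lin g m = n) : ∃ m ∈ M.deg i, lin g m = n := by
  obtain ⟨m, rfl⟩ := h
  exact ⟨_, M.component_mem i m, by rw [lin_component, component_of_mem hn]⟩

/-- The identity, as a morphism from `M` to `M(0)`. -/
def toShiftZero (M : GrMod K S) : M ⟶ M.shift 0 :=
  ofLin (LinearMap.id : M.carrier →ₗ[(Alg K S)ᵐᵒᵖ] M.carrier) fun i x hx => by
    show x ∈ M.deg (i + 0)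
    rwa [add_zero]

/-- The identity, as a morphism from `M(0)` to `M`. -/
def ofShiftZero (M : GrMod K S) : M.shift 0 ⟶ M :=
  ofLin (LinearMap.id : M.carrier →ₗ[(Alg K S)ᵐᵒᵖ] M.carrier) fun i x hx => by
    have hx' : x ∈ M.deg (i + 0) := hx
    rwa [add_zero] at hx'

/-- An equality of objects rather than an isomorphism: it carries results about shifted modules over
to the unshifted ones of the triangle. -/
theorem shift_zero (M : GrMod K S) : M.shift 0 = M := by
  obtain ⟨c, d, h1, h2⟩ := M
  simp only [shift, mk.injEq, heq_eq_eq, true_and]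
  funext i
  rw [add_zero]

theorem lin_surjective_of_comp_eq_id {M N : GrMod K S} {f : M ⟶ N} {g : N ⟶ M} (h : g ≫ f = 𝟙 N)
    (x : N.carrier) : lin f (lin g x) = x := LinearMap.congr_fun (congrArg lin h) x

instance : Module.Finite (Alg K S)ᵐᵒᵖ (Alg K S) :=
  ⟨⟨{1}, eq_top_iff.2 fun x _ => by
    rw [Finset.coe_singleton]
    exact Submodule.mem_span_singleton.2 ⟨MulOpposite.op x, one_mul x⟩⟩⟩

/-- The free graded module with generators in the degrees `-t j`. -/
def freeMod {n : ℕ} (t : Fin n → ℤ) : GrMod K S where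
  carrier := Fin n → Alg K S
  finite := inferInstanceAs (Module.Finite (Alg K S)ᵐᵒᵖ (Fin n → Alg K S))
  deg i := AddSubgroup.pi Set.univ fun j => (algDeg K S (i + t j)).toAddSubgroup
  isInternal := by
    refine isInternal_of_proj _
      (fun i => AddMonoidHom.pi fun j => (algProj K S (i + t j)).comp (Pi.evalAddMonoidHom _ j))
      (fun i x j _ => algProj_mem K S _ _)
      (fun i x hx => funext fun j => algProj_of_mem K S _ (hx j trivial))
      (fun i k hik x hx => funext fun j => algProj_of_mem_ne K S (by omega) (hx j trivial))
      (fun x => ?_)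
    classical
    choose s hs using fun j => algProj_sum K S (x j)
    refine ⟨Finset.univ.biUnion fun j => (s j).map (Equiv.subRight (t j)).toEmbedding,
      fun T hT => funext fun j => ?_⟩
    have h := hs j (T.map (Equiv.addRight (t j)).toEmbedding) fun k hk => by
      rw [Finset.mem_map]
      exact ⟨k - t j, hT (Finset.mem_biUnion.2
        ⟨j, Finset.mem_univ j, Finset.mem_map_of_mem _ hk⟩), by simp⟩
    rw [Finset.sum_map] at h
    rw [Finset.sum_apply]
    exact h
  smul_mem := by
    intro i k x a hx ha j _
    have := algDeg_mul K S (hx j trivial) ha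
    rw [add_right_comm] at this
    exact this

/-- The linear map from a free module with given values on the basis. -/
def freeLin {n : ℕ} {M : Type*} [AddCommGroup M] [Module (Alg K S)ᵐᵒᵖ M] (m : Fin n → M) :
    (Fin n → Alg K S) →ₗ[(Alg K S)ᵐᵒᵖ] M where
  toFun z := ∑ j, MulOpposite.op (z j) • m j
  map_add' x y := by simp [add_smul, Finset.sum_add_distrib]
  map_smul' a x := by simp [Finset.smul_sum, mul_smul]

theorem freeLin_single {n : ℕ} {M : Type*} [AddCommGroup M] [Module (Alg K S)ᵐᵒᵖ M]
    (m : Fin n → M) (j : Fin n) : freeLin (K := K) (S := S) m (Pi.single j 1) = m j := by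
  show ∑ k, MulOpposite.op ((Pi.single j 1 : Fin n → Alg K S) k) • m k = m j
  rw [Finset.sum_eq_single j]
  · simp
  · intro k _ hk
    simp [Pi.single_eq_of_ne hk]
  · simp

theorem eq_freeLin {n : ℕ} {M : Type*} [AddCommGroup M] [Module (Alg K S)ᵐᵒᵖ M]
    (f : (Fin n → Alg K S) →ₗ[(Alg K S)ᵐᵒᵖ] M) : f = freeLin fun j => f (Pi.single j 1) := by
  refine LinearMap.ext fun z => ?_
  have h : z = ∑ j, MulOpposite.op (z j) • (Pi.single j 1 : Fin n → Alg K S) := by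
    funext k
    rw [Finset.sum_apply, Finset.sum_eq_single k]
    · simp
    · intro j _ hj
      simp [Pi.single_eq_of_ne (Ne.symm hj)]
    · simp
  conv_lhs => rw [h, map_sum]
  exact Finset.sum_congr rfl fun j _ => map_smul f _ _

theorem one_mem_algDeg : (1 : Alg K S) ∈ algDeg K S 0 := by
  have h : (1 : Alg K S) = ∑ a : V, idem K S a := by
    have h1 : Alg.mk K S (pathOne K) = 1 := map_one (Alg.mk K S)
    exact h1.symm.trans (map_sum (Alg.mk K S) _ _)
  rw [h]
  exact Submodule.sum_mem _ fun a _ => by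
    have := cls_mem_algDeg (K := K) (S := S) (Path.nil : Path a a)
    simpa using this

theorem mem_freeMod_deg {n : ℕ} {t : Fin n → ℤ} {i : ℤ} {z : Fin n → Alg K S} :
    z ∈ (freeMod (K := K) (S := S) t).deg i ↔ ∀ j, z j ∈ algDeg K S (i + t j) :=
  ⟨fun h j => h j trivial, fun h j _ => h j⟩

theorem freeLin_deg {n : ℕ} (t : Fin n → ℤ) {M : GrMod K S} {m : Fin n → M.carrier}
    (hm : ∀ j, m j ∈ M.deg (-t j)) (i : ℤ) (z : Fin n → Alg K S)
    (hz : z ∈ (freeMod (K := K) (S := S) t).deg i) : freeLin m z ∈ M.deg i := by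
  refine AddSubgroup.sum_mem (M.deg i) (t := Finset.univ)
    (f := fun j => MulOpposite.op (z j) • m j) fun j _ => ?_
  have := M.smul_mem (hm j) (hz j trivial)
  have e : -t j + (i + t j) = i := by ring
  rwa [e] at this

theorem exists_homogeneous_generators (M : GrMod K S) : ∃ (n : ℕ) (t : Fin n → ℤ)
    (m : Fin n → M.carrier), (∀ j, m j ∈ M.deg (-t j)) ∧
      Submodule.span (Alg K S)ᵐᵒᵖ (Set.range m) = ⊤ := by
  classical
  obtain ⟨s, hs⟩ := M.finite.fg_top
  choose T hT using M.exists_sum_component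
  let I := (s ×ˢ s.biUnion T : Finset (M.carrier × ℤ))
  let e := I.equivFin.symm
  refine ⟨I.card, fun j => -(e j).1.2, fun j => M.component (e j).1.2 (e j).1.1, fun j => ?_, ?_⟩
  · rw [neg_neg]
    exact M.component_mem _ _
  · rw [eq_top_iff, ← hs, Submodule.span_le]
    intro x hx
    have hx : x ∈ s := hx
    rw [← hT x (s.biUnion T) (Finset.subset_biUnion_of_mem T hx)]
    refine Submodule.sum_mem _ fun i hi => Submodule.subset_span ?_
    exact ⟨e.symm ⟨(x, i), Finset.mk_mem_product hx hi⟩, by simp⟩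

/-- Every graded projective module is a direct summand of a free graded module. -/
theorem IsProjective.exists_freeMod {P : GrMod K S} (hP : P.IsProjective) :
    ∃ (n : ℕ) (t : Fin n → ℤ) (p : freeMod t ⟶ P) (i : P ⟶ freeMod t), i ≫ p = 𝟙 P := by
  obtain ⟨n, t, m, hm, hs⟩ := P.exists_homogeneous_generators
  refine ⟨n, t, ofLin (freeLin m) (freeLin_deg t hm), ?_⟩
  refine hP _ ?_ (𝟙 P)
  show Function.Surjective (freeLin m)
  rw [← LinearMap.range_eq_top, eq_top_iff, ← hs, Submodule.span_le]
  rintro _ ⟨j, rfl⟩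
  exact ⟨_, freeLin_single m j⟩

/-- Graded projective modules are Gorenstein-projective. -/
theorem IsProjective.isGproj {P : GrMod K S} (hP : P.IsProjective) : P.IsGproj := by
  -- The contractible complex with P ⊕ P everywhere and d(x, y) = (0, x); its cycles are the second
  -- summand.
  let d : P.prod P ⟶ P.prod P := ofLin (LinearMap.prod 0 (LinearMap.fst _ P.carrier P.carrier))
    fun i x hx => ⟨zero_mem _, hx.1⟩
  have hd : Function.Exact (lin d) (lin d) := by
    rintro ⟨x, y⟩
    constructor
    · intro h
      have h' : x = 0 := congrArg Prod.snd h
      exact ⟨(y, 0), by rw [h']; rfl⟩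
    · rintro ⟨⟨x', y'⟩, h⟩
      cases h
      rfl
  refine ⟨fun _ => P.prod P, fun _ => d, ⟨fun _ => hP.prod hP, fun _ => hd, fun i f hf => ?_⟩,
    inr P P, fun x y h => congrArg Prod.snd h, ?_⟩
  · refine ⟨(f.comp (LinearMap.inl _ P.carrier P.carrier)).comp
      (LinearMap.snd _ P.carrier P.carrier), LinearMap.ext ?_⟩
    rintro ⟨x, y⟩
    have h1 : f (0, y) = 0 := LinearMap.congr_fun hf (y, 0)
    have h2 : f (x, y) = f (x, 0) + f (0, y) :=
      (congrArg f (Prod.ext (add_zero x).symm (zero_add y).symm)).trans (map_add f (x, 0) (0, y))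
    exact ((h2.trans (congrArg (f (x, 0) + ·) h1)).trans (add_zero _)).symm
  · rintro ⟨x, y⟩
    constructor
    · intro h
      have h' : x = 0 := congrArg Prod.snd h
      exact ⟨y, by rw [h']; rfl⟩
    · rintro ⟨y', h⟩
      cases h
      rfl

end GrMod

/-! ### Homomorphisms from and to the modules generated by paths -/

open GrMod

theorem mem_pathIdeal_iff {a b : V} {p : Path a b} {z : Alg K S} :
    z ∈ pathIdeal K S p ↔ ∃ y, z = cls K S p * y := by
  rw [pathIdeal, Submodule.mem_span_singleton]
  constructor
  · rintro ⟨y, rfl⟩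
    exact ⟨y.unop, rfl⟩
  · rintro ⟨y, rfl⟩
    exact ⟨MulOpposite.op y, rfl⟩

theorem mem_pathIdeal_iff_rep {a b : V} {p : Path a b} {z : Alg K S} :
    z ∈ pathIdeal K S p ↔ ∀ y, rep K S z y ≠ 0 → LeftDivisor (tot p) y := by
  rw [mem_pathIdeal_iff]
  constructor
  · rintro ⟨y, rfl⟩ z hz
    obtain ⟨c, q, rfl⟩ := exists_of_rep_cls_mul hz
    exact leftDivisor_tot p q
  · intro h
    have : z ∈ LinearMap.range (LinearMap.mulLeft K (cls K S p)) := by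
      refine mem_of_rep fun {s t} q hq => ?_
      obtain ⟨c, p', x, e, rfl⟩ := (h _ hq).exists_left
      cases e
      exact ⟨cls K S x, (cls_comp _ _).symm⟩
    obtain ⟨y, hy⟩ := this
    exact ⟨y, hy.symm⟩

variable (K S) in
/-- The generator of `pΛ`. -/
def gen {a b : V} (p : Path a b) : pathIdeal K S p :=
  ⟨cls K S p, Submodule.mem_span_singleton_self _⟩

theorem exists_smul_gen {a b : V} {p : Path a b} (z : pathIdeal K S p) :
    ∃ y : Alg K S, z = MulOpposite.op y • gen K S p := by
  obtain ⟨y, hy⟩ := mem_pathIdeal_iff.1 z.2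
  exact ⟨y, Subtype.ext hy⟩

theorem pathIdeal_hom_ext {a b : V} {p : Path a b} {N : Type*} [AddCommGroup N]
    [Module (Alg K S)ᵐᵒᵖ N] {f g : pathIdeal K S p →ₗ[(Alg K S)ᵐᵒᵖ] N}
    (h : f (gen K S p) = g (gen K S p)) : f = g := by
  refine LinearMap.ext fun z => ?_
  obtain ⟨y, rfl⟩ := exists_smul_gen z
  rw [map_smul, map_smul, h]

theorem pathMod_hom_ext {a b : V} {p : Path a b} {t : ℤ} {N : GrMod K S}
    {f g : (pathMod K S p).shift t ⟶ N} (h : lin f (gen K S p) = lin g (gen K S p)) : f = g :=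
  lin_injective (pathIdeal_hom_ext h)

/-- The module pΛ is Λ modulo the annihilator of p, so a homomorphism may send p to any element
killed by that annihilator. -/
theorem exists_pathIdeal_hom {a b : V} {p : Path a b} {N : Type*} [AddCommGroup N]
    [Module (Alg K S)ᵐᵒᵖ N] (n : N) (h : ∀ y, cls K S p * y = 0 → MulOpposite.op y • n = 0) :
    ∃ f : pathIdeal K S p →ₗ[(Alg K S)ᵐᵒᵖ] N, f (gen K S p) = n := by
  let φ := LinearMap.toSpanSingleton (Alg K S)ᵐᵒᵖ (pathIdeal K S p) (gen K S p)
  let ψ := LinearMap.toSpanSingleton (Alg K S)ᵐᵒᵖ N n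
  have hφ : Function.Surjective φ := fun z => by
    obtain ⟨y, rfl⟩ := exists_smul_gen z
    exact ⟨MulOpposite.op y, rfl⟩
  have hk : LinearMap.ker φ ≤ LinearMap.ker ψ := by
    intro y hy
    exact h y.unop (congrArg Subtype.val (LinearMap.mem_ker.1 hy))
  refine ⟨((LinearMap.ker φ).liftQ ψ hk).comp (φ.quotKerEquivOfSurjective hφ).symm.toLinearMap, ?_⟩
  have h1 : gen K S p = φ.quotKerEquivOfSurjective hφ (Submodule.Quotient.mk 1) := by
    show _ = φ 1
    exact (one_smul _ _).symm
  rw [LinearMap.comp_apply]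
  conv_lhs => rw [h1]
  erw [LinearEquiv.symm_apply_apply]
  exact one_smul _ n

theorem exists_pathMod_hom {a b : V} {p : Path a b} {t k : ℤ} {N : GrMod K S} {n : N.carrier}
    (hn : n ∈ N.deg k) (hk : k + t = p.length)
    (h : ∀ y, cls K S p * y = 0 → MulOpposite.op y • n = 0) :
    ∃ f : (pathMod K S p).shift t ⟶ N, lin f (gen K S p) = n := by
  obtain ⟨f, hf⟩ := exists_pathIdeal_hom n h
  refine ⟨ofLin f fun i x hx => ?_, hf⟩
  obtain ⟨y, hy⟩ := mem_pathIdeal_iff.1 x.2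
  have hx' : x.1 ∈ algDeg K S (i + t) := hx
  have h1 := algProj_of_mem K S _ hx'
  rw [hy, algProj_cls_mul] at h1
  have h2 : x = MulOpposite.op (algProj K S (i + t - p.length) y) • gen K S p :=
    Subtype.ext (hy.trans h1.symm)
  have h3 : f x = MulOpposite.op (algProj K S (i + t - p.length) y) • n :=
    (congrArg f h2).trans ((map_smul f _ _).trans (by rw [hf]))
  have := N.smul_mem hn (algProj_mem K S (i + t - p.length) y)
  have e : k + (i + t - p.length) = i := by omega
  rw [e, ← h3] at this
  exact this

theorem gen_mem_deg {a b : V} (p : Path a b) (t : ℤ) :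
    (gen K S p : ((pathMod K S p).shift t).carrier) ∈
      ((pathMod K S p).shift t).deg (p.length - t) := by
  show cls K S p ∈ algDeg K S (p.length - t + t)
  rw [sub_add_cancel]
  exact cls_mem_algDeg p

theorem smul_idem_gen {a b : V} (p : Path a b) :
    MulOpposite.op (idem K S b) • gen K S p = gen K S p :=
  Subtype.ext (cls_mul_idem p)

/-- The hypothesis says that left multiplication by p is injective on e_bΛ, so pΛ is a shifted copy
of this projective module. -/
theorem pathMod_isProjective_of_forall {a b : V} {p : Path a b}
    (hp : ∀ y, cls K S p * y = 0 → idem K S b * y = 0) (t : ℤ) :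
    ((pathMod K S p).shift t).IsProjective := by
  intro M N g hg f
  obtain ⟨m, hm, hm'⟩ := exists_homogeneous_lift g (lin_deg f (gen_mem_deg p t)) (hg _)
  have h1 := M.smul_mem hm (cls_mem_algDeg (Path.nil : Path b b))
  obtain ⟨h, hh⟩ := exists_pathMod_hom (p := p) (t := t) h1 (by simp)
    (fun y hy => by rw [← mul_smul, ← MulOpposite.op_mul, hp y hy, MulOpposite.op_zero, zero_smul])
  refine ⟨h, pathMod_hom_ext ?_⟩
  refine (congrArg (lin g) hh).trans ((map_smul (lin g) _ _).trans ?_)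
  rw [hm']
  exact (map_smul (lin f) _ _).symm.trans (congrArg (lin f) (smul_idem_gen _))

theorem pathMod_nil_isProjective (a : V) (t : ℤ) :
    ((pathMod K S (Path.nil : Path a a)).shift t).IsProjective :=
  pathMod_isProjective_of_forall (fun _ h => h) t

theorem pathMod_isProjective_of_eq_zero {a b : V} {p : Path a b} (h : cls K S p = 0) (t : ℤ) :
    ((pathMod K S p).shift t).IsProjective := by
  intro M N g _ f
  refine ⟨0, pathMod_hom_ext ?_⟩
  have h0 : gen K S p = 0 := Subtype.ext h
  rw [h0]
  exact (map_zero (lin _)).trans (map_zero (lin f)).symm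

/-- Left multiplication by `c`, as a homomorphism of right ideals generated by paths. -/
def lmulMap (c : Alg K S) {x y z t : V} {p : Path x y} {q : Path z t}
    (h : c * cls K S p ∈ pathIdeal K S q) :
    pathIdeal K S p →ₗ[(Alg K S)ᵐᵒᵖ] pathIdeal K S q where
  toFun m := ⟨c * m, by
    obtain ⟨y, hy⟩ := mem_pathIdeal_iff.1 m.2
    obtain ⟨y', hy'⟩ := mem_pathIdeal_iff.1 h
    rw [hy, ← mul_assoc, hy', mul_assoc]
    exact mem_pathIdeal_iff.2 ⟨_, rfl⟩⟩
  map_add' m m' := Subtype.ext (mul_add c m.1 m'.1)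
  map_smul' a m := Subtype.ext (mul_assoc c m.1 a.unop).symm

/-- Left multiplication by the homogeneous element `c`, as a morphism of graded modules. -/
def lmulHom (c : Alg K S) {x y z t : V} (p : Path x y) (q : Path z t) (i j : ℤ)
    (h : c * cls K S p ∈ pathIdeal K S q) (hc : c ∈ algDeg K S (j - i)) :
    (pathMod K S p).shift i ⟶ (pathMod K S q).shift j :=
  ofLin (lmulMap c h) fun k m hm => by
    have h1 := algDeg_mul K S hc (show m.1 ∈ algDeg K S (k + i) from hm)
    have e : j - i + (k + i) = k + j := by ring
    rwa [e] at h1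

theorem isLeftMul_lmulHom (c : Alg K S) {x y z t : V} (p : Path x y) (q : Path z t) (i j : ℤ)
    (h : c * cls K S p ∈ pathIdeal K S q) (hc : c ∈ algDeg K S (j - i)) :
    IsLeftMul c (lin (lmulHom c p q i j h hc)) := fun _ => rfl

theorem exact_lmul {a b c x y : V} {p : Path a b} {q : Path b c} (h : IsPerfectPair K S p q)
    {q' : Path x y} (hq : tot q = tot q')
    {f : pathIdeal K S q' →ₗ[(Alg K S)ᵐᵒᵖ] pathIdeal K S (Path.nil : Path b b)}
    {z t : V} {p' : Path z t}
    {g : pathIdeal K S (Path.nil : Path b b) →ₗ[(Alg K S)ᵐᵒᵖ] pathIdeal K S p'}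
    (hf : IsLeftMul 1 f) (hg : IsLeftMul (cls K S p) g) : Function.Exact f g := by
  cases hq
  intro m
  have hm : idem K S b * m = m.1 := by
    obtain ⟨y, hy⟩ := mem_pathIdeal_iff.1 m.2
    rw [hy, ← mul_assoc, idem_mul_cls]
  constructor
  · intro h0
    have h1 : cls K S p * m = 0 := (hg m).symm.trans (congrArg Subtype.val h0)
    obtain ⟨y, hy⟩ := h.exists_mul_right h1
    rw [hm] at hy
    exact ⟨⟨m, mem_pathIdeal_iff.2 ⟨y, hy⟩⟩, Subtype.ext ((hf _).trans (one_mul _))⟩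
  · rintro ⟨n, rfl⟩
    refine Subtype.ext ((hg _).trans ?_)
    obtain ⟨y, hy⟩ := mem_pathIdeal_iff.1 n.2
    rw [hf, one_mul, hy, ← mul_assoc, ← cls_comp, h.comp_eq_zero, zero_mul]
    rfl

/-- Supplies the shifts that make all the left multiplications in a complete resolution homogeneous
of degree zero. -/
theorem exists_sum_int (l : ℤ → ℤ) (c : ℤ) :
    ∃ t : ℤ → ℤ, t 0 = c ∧ ∀ i, t (i + 1) = t i + l i := by
  refine ⟨fun i => c + ∑ k ∈ Finset.Ico 0 i, l k - ∑ k ∈ Finset.Ico i 0, l k, by simp, fun i => ?_⟩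
  rcases le_or_gt 0 i with h | h
  · have h1 : Finset.Ico 0 (i + 1) = insert i (Finset.Ico 0 i) := by ext; simp; omega
    have h2 : Finset.Ico i 0 = ∅ := by ext; simp; omega
    have h3 : Finset.Ico (i + 1) 0 = ∅ := by ext; simp; omega
    simp only [h1, h2, h3]
    rw [Finset.sum_insert (by simp)]
    simp
    ring
  · have h1 : Finset.Ico i 0 = insert i (Finset.Ico (i + 1) 0) := by ext; simp; omega
    have h2 : Finset.Ico 0 i = ∅ := by ext; simp; omega
    have h3 : Finset.Ico 0 (i + 1) = ∅ := by ext; simp; omega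
    simp only [h1, h2, h3]
    rw [Finset.sum_insert (by simp)]
    simp
    ring

/-- The complete resolution consists of the modules e_{v i}Λ and left multiplication by the π i.
Right minimality of the pairs gives exactness, and left minimality gives exactness after applying
Hom(-, Λ). The composite of two differentials is multiplication by π (i + 1) π i, so the indices run
against the order of the path sequence. -/
theorem isGproj_of_perfect_sequence (v : ℤ → V) (π : ∀ i, Path (v (i + 1)) (v i))
    (hπ : ∀ i, PerfectSucc K S (tot (π (i + 1))) (tot (π i))) {a b : V} (x : Path a b)
    (hx : PerfectSucc K S (tot (π 0)) (tot x)) (c : ℤ) :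
    ((pathMod K S x).shift c).IsGproj := by
  have ha : a = v 0 := by
    obtain ⟨_, _, _, _, _, e, e', -⟩ := hx
    cases e'
    exact (congrArg (fun y : TPath V => y.2.1) e).symm
  subst ha
  rw [perfectSucc_tot] at hx
  obtain ⟨t, ht, ht'⟩ := exists_sum_int (fun i => (π i).length) c
  have hmem : ∀ i, cls K S (π i) * idem K S (v i) ∈
      pathIdeal K S (Path.nil : Path (v (i + 1)) (v (i + 1))) := fun i =>
    mem_pathIdeal_iff.2 ⟨cls K S (π i), by rw [cls_mul_idem, idem_mul_cls]⟩
  have hdeg : ∀ i, cls K S (π i) ∈ algDeg K S (t (i + 1) - t i) := fun i => by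
    rw [ht', add_sub_cancel_left]
    exact cls_mem_algDeg _
  have hsurj : ∀ i (m : pathIdeal K S (Path.nil : Path (v (i + 1)) (v (i + 1)))),
      m.1 ∈ pathIdeal K S (π i) →
      ∃ m', lin (lmulHom (cls K S (π i)) _ _ (t i) (t (i + 1)) (hmem i) (hdeg i)) m' = m := by
    intro i m hm
    obtain ⟨y, hy⟩ := mem_pathIdeal_iff.1 hm
    refine ⟨(⟨idem K S (v i) * y, mem_pathIdeal_iff.2 ⟨y, rfl⟩⟩ :
      pathIdeal K S (Path.nil : Path (v i) (v i))), Subtype.ext ?_⟩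
    show cls K S (π i) * (idem K S (v i) * y) = m.1
    rw [← mul_assoc, cls_mul_idem, hy]
  refine ⟨fun i => (pathMod K S (Path.nil : Path (v i) (v i))).shift (t i),
    fun i => lmulHom (cls K S (π i)) _ _ (t i) (t (i + 1)) (hmem i) (hdeg i),
    ⟨fun i => pathMod_nil_isProjective _ _, fun i => ?_, fun i f hf => ?_⟩,
    lmulHom 1 x _ c (t 0) ?_ ?_, ?_, ?_⟩
  · intro m
    constructor
    · intro h0
      refine hsurj i m ?_
      have h1 : cls K S (π (i + 1)) * m.1 = 0 := congrArg Subtype.val h0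
      obtain ⟨y, hy⟩ := (perfectSucc_tot.1 (hπ i)).exists_mul_right h1
      obtain ⟨y', hy'⟩ := mem_pathIdeal_iff.1 m.2
      rw [hy', ← mul_assoc, idem_mul_cls, ← hy'] at hy
      exact mem_pathIdeal_iff.2 ⟨y, hy⟩
    · rintro ⟨n, rfl⟩
      refine Subtype.ext ?_
      show cls K S (π (i + 1)) * (cls K S (π i) * n.1) = 0
      rw [← mul_assoc, ← cls_comp, (perfectSucc_tot.1 (hπ i)).comp_eq_zero, zero_mul]
  · let f' : pathIdeal K S (Path.nil : Path (v (i + 1)) (v (i + 1))) →ₗ[(Alg K S)ᵐᵒᵖ] Alg K S := f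
    let y := f' (gen K S _)
    have hf' : ∀ m, f' m = y * m.1 := by
      intro m
      obtain ⟨z, hz⟩ := exists_smul_gen m
      have h1 : y * idem K S (v (i + 1)) = y := by
        have := congrArg f' (smul_idem_gen (K := K) (S := S) (Path.nil : Path (v (i + 1)) _))
        rw [map_smul] at this
        exact this
      rw [hz, map_smul]
      show y * z = y * (idem K S (v (i + 1)) * z)
      rw [← mul_assoc, h1]
    have h0 : y * cls K S (π i) = 0 := by
      have h1 := LinearMap.congr_fun hf (gen K S (Path.nil : Path (v i) (v i)))
      have h2 := (hf' _).symm.trans h1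
      have h3 : y * (cls K S (π i) * idem K S (v i)) = 0 := h2
      rwa [cls_mul_idem] at h3
    -- A homomorphism from e_{v (i+1)}Λ is left multiplication by some y. It vanishes on the image
    -- of d i exactly when y π i = 0, and then y = y' π (i + 1) factors through the next
    -- differential.
    obtain ⟨y', hy'⟩ := (perfectSucc_tot.1 (hπ i)).exists_mul_left h0
    let g : pathIdeal K S (Path.nil : Path (v (i + 1 + 1)) (v (i + 1 + 1))) →ₗ[(Alg K S)ᵐᵒᵖ]
        Alg K S :=
      { toFun := fun m => y' * m.1
        map_add' := fun m m' => mul_add _ _ _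
        map_smul' := fun a m => (mul_assoc y' m.1 a.unop).symm }
    refine ⟨g, LinearMap.ext fun m => ?_⟩
    refine Eq.trans ?_ (hf' m).symm
    show y' * (cls K S (π (i + 1)) * m.1) = y * m.1
    obtain ⟨z, hz⟩ := mem_pathIdeal_iff.1 m.2
    rw [← mul_assoc, ← hy', mul_assoc, hz, ← mul_assoc (idem K S _), idem_mul_cls]
  · rw [one_mul]
    exact mem_pathIdeal_iff.2 ⟨cls K S x, (idem_mul_cls x).symm⟩
  · rw [ht, sub_self]
    exact one_mem_algDeg
  · intro m m' h
    have h1 : 1 * m.1 = 1 * m'.1 := congrArg Subtype.val h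
    rw [one_mul, one_mul] at h1
    exact Subtype.ext h1
  · exact exact_lmul hx rfl (fun _ => rfl) (fun _ => rfl)

theorem isGproj_of_isPerfect {a b : V} {x : Path a b} (hx : IsPerfect K S (tot x)) (c : ℤ) :
    ((pathMod K S x).shift c).IsGproj := by
  obtain ⟨r, hr, k, e⟩ := hx
  have h1 : ∀ i : ℤ, PerfectSucc K S (tot (r.path (k - 1 - (i + 1)))) (tot (r.path (k - 1 - i))) := by
    intro i
    have := perfectSucc_tot.2 (hr (k - 1 - (i + 1)))
    rwa [CyclicSeq.tot_path_congr (show k - 1 - (i + 1) + 1 = k - 1 - i by ring)] at this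
  have h2 : ∀ i : ℤ, r.vert (k - 1 - i) = r.vert (k - 1 - (i + 1) + 1) := fun i => by
    congr 1
    ring
  refine isGproj_of_perfect_sequence (fun i => r.vert (k - 1 - i + 1))
    (fun i => (r.path (k - 1 - i)).cast (h2 i) rfl) (fun i => ?_) x ?_ c
  · rw [tot_cast, tot_cast]
    exact h1 i
  · rw [tot_cast, e]
    have := perfectSucc_tot.2 (hr (k - 1 - 0))
    rwa [CyclicSeq.tot_path_congr (show k - 1 - 0 + 1 = k by ring)] at this

end

end GradedModuleLemmas


/-! ### Splitting Gorenstein-projective modules into modules generated by paths -/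

section Decomposition

open Quiver GrMod

variable {V : Type u} [Quiver.{v} V]

theorem LeftDivisor.eq_of_len {x y : TPath V} (h : LeftDivisor x y) (e : y.len = x.len) :
    y = x := by
  obtain ⟨a, b, c, p, q, rfl, rfl⟩ := h
  have h' : (p.comp q).length = p.length := e
  rw [Path.length_comp] at h'
  have h0 : q.length = 0 := by omega
  obtain rfl := Path.eq_of_length_zero q h0
  obtain rfl := Path.eq_nil_of_length_zero q h0
  rfl

theorem RightDivisor.eq_of_len {x y : TPath V} (h : RightDivisor x y) (e : y.len = x.len) :
    y = x := by
  obtain ⟨a, b, c, p, q, rfl, rfl⟩ := h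
  have h' : (p.comp q).length = q.length := e
  rw [Path.length_comp] at h'
  have h0 : p.length = 0 := by omega
  obtain rfl := Path.eq_of_length_zero p h0
  obtain rfl := Path.eq_nil_of_length_zero p h0
  rw [Path.nil_comp]

theorem RightDivisor.refl (x : TPath V) : RightDivisor x x :=
  ⟨x.1, x.1, x.2.1, Path.nil, x.2.2, rfl, by rw [Path.nil_comp]⟩

variable {K : Type w} [Field K] [Fintype V] {S : Set (TPath V)}

noncomputable section

theorem exists_rep_algProj_ne_zero {z : Alg K S} {y : TPath V} (h : rep K S z y ≠ 0) :
    rep K S (algProj K S y.len z) y ≠ 0 := by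
  obtain ⟨s, hs⟩ := algProj_sum K S z
  have h1 := hs s (Finset.Subset.refl s)
  rw [← h1, map_sum, Finsupp.finsetSum_apply] at h
  obtain ⟨i, -, hi⟩ := Finset.exists_ne_zero_of_sum_ne_zero h
  have h2 := mem_algDeg_iff.1 (algProj_mem K S i z) y hi
  rwa [h2]

theorem eq_zero_of_rep {z : Alg K S} (h : ∀ y, rep K S z y = 0) : z = 0 :=
  rep_injective (Finsupp.ext fun y => by rw [h, map_zero, Finsupp.zero_apply])

theorem exists_rep_ne_zero {z : Alg K S} (h : z ≠ 0) : ∃ y, rep K S z y ≠ 0 := by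
  by_contra! h'
  exact h (eq_zero_of_rep h')

theorem filt_eq_smul_cls {Q : TPath V → Prop} {a b : V} {p : Path a b} {z : Alg K S}
    (h : ∀ y, rep K S z y ≠ 0 → (Q y ↔ y = tot p)) :
    filt Q z = rep K S z (tot p) • cls K S p := by
  refine rep_injective (Finsupp.ext fun y => ?_)
  classical
  rw [rep_filt, map_smul, Finsupp.smul_apply, smul_eq_mul]
  by_cases h0 : rep K S z y = 0
  · rw [h0, ite_self]
    by_cases e : tot p = y
    · rw [e, h0, zero_mul]
    · by_cases hp : cls K S p = 0
      · rw [hp, map_zero, Finsupp.zero_apply, mul_zero]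
      · rw [rep_cls p hp, Finsupp.single_eq_of_ne (Ne.symm e), mul_zero]
  · by_cases e : y = tot p
    · subst e
      rw [if_pos ((h _ h0).2 rfl), rep_cls p (cls_ne_zero_of_rep h0), Finsupp.single_eq_same,
        mul_one]
    · rw [if_neg fun h' => e ((h _ h0).1 h')]
      by_cases hp : cls K S p = 0
      · rw [hp, map_zero, Finsupp.zero_apply, mul_zero]
      · rw [rep_cls p hp, Finsupp.single_eq_of_ne e, mul_zero]

theorem exists_eq_mul_cls {a b : V} {p : Path a b} {z : Alg K S}
    (h : ∀ y, rep K S z y ≠ 0 → RightDivisor (tot p) y) : ∃ y, z = y * cls K S p := by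
  have : z ∈ LinearMap.range (LinearMap.mulRight K (cls K S p)) := by
    refine mem_of_rep fun {s t} q hq => ?_
    obtain ⟨_, _, _, y, q', e, e'⟩ := h _ hq
    cases e
    cases e'
    exact ⟨cls K S y, (cls_comp _ _).symm⟩
  obtain ⟨y, hy⟩ := this
  exact ⟨y, hy.symm⟩

/-- Homomorphisms of free right modules are matrices acting by left multiplication. Prolonging a
long enough path on the left does not affect whether it ends in x, so the suffix filter commutes
with them. -/
theorem apply_filt_rightDivisor {n k : ℕ}
    (G : (Fin n → Alg K S) →ₗ[(Alg K S)ᵐᵒᵖ] (Fin k → Alg K S)) {x : TPath V}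
    {z : Fin n → Alg K S} (hz : ∀ j y, rep K S (z j) y ≠ 0 → x.len ≤ y.len) (i : Fin k) :
    G (fun j => filt (RightDivisor x) (z j)) i = filt (RightDivisor x) (G z i) := by
  have h : ∀ z : Fin n → Alg K S, G z i = ∑ j, G (Pi.single j 1) i * z j := by
    intro z
    have h1 := LinearMap.congr_fun (eq_freeLin G) z
    have h2 : freeLin (fun j => G (Pi.single j 1)) z =
      ∑ j, MulOpposite.op (z j) • G (Pi.single j 1) := rfl
    rw [h1, h2, Finset.sum_apply]
    rfl
  rw [h, h, map_sum]
  refine Finset.sum_congr rfl fun j _ => ?_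
  rw [filt_mul_of_forall']
  intro a b c p q hp
  exact rightDivisor_comp_iff (hz j _ hp)

/-- Given a homogeneous embedding `Θ` of `M` in a free module, the image of the idempotent `E` is
closed under taking the parts of elements that are supported on the paths with a given suffix. -/
def IsSuffixClosed {M : GrMod K S} {n : ℕ} (Θ : M.carrier →ₗ[(Alg K S)ᵐᵒᵖ] (Fin n → Alg K S))
    (E : M ⟶ M) : Prop :=
  ∀ (x : TPath V) (w : M.carrier), lin E w = w →
    (∀ j y, rep K S (Θ w j) y ≠ 0 → x.len ≤ y.len) →
    ∃ w', lin E w' = w' ∧ ∀ j, Θ w' j = filt (RightDivisor x) (Θ w j)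

/-- With P 0 and P 1 realised as summands of free modules, M becomes the solution set of the
equations Az = z and Bz = 0. Both are preserved by suffix filters. -/
theorem GrMod.IsGproj.exists_embedding {M : GrMod K S} (hM : M.IsGproj) :
    ∃ (n : ℕ) (t : Fin n → ℤ) (Θ : M.carrier →ₗ[(Alg K S)ᵐᵒᵖ] (Fin n → Alg K S)),
      Function.Injective Θ ∧ (∀ (i : ℤ) (w : M.carrier), w ∈ M.deg i →
        ∀ j, Θ w j ∈ algDeg K S (i + t j)) ∧ IsSuffixClosed Θ (𝟙 M) := by
  obtain ⟨P, d, hP, e, he, hed⟩ := hM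
  obtain ⟨n, t, p, ι, hpι⟩ := (hP.projective 0).exists_freeMod
  obtain ⟨k, t', p', ι', hpι'⟩ := (hP.projective (0 + 1)).exists_freeMod
  have hp : ∀ z, lin p (lin ι z) = z := lin_surjective_of_comp_eq_id hpι
  have hp' : ∀ z, lin p' (lin ι' z) = z := lin_surjective_of_comp_eq_id hpι'
  let Θ : M.carrier →ₗ[(Alg K S)ᵐᵒᵖ] (Fin n → Alg K S) := lin (e ≫ ι)
  let A : (Fin n → Alg K S) →ₗ[(Alg K S)ᵐᵒᵖ] (Fin n → Alg K S) := lin (p ≫ ι)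
  let B : (Fin n → Alg K S) →ₗ[(Alg K S)ᵐᵒᵖ] (Fin k → Alg K S) := lin (p ≫ d 0 ≫ ι')
  refine ⟨n, t, Θ, ?_, fun i w hw => mem_freeMod_deg.1 (lin_deg (e ≫ ι) hw), ?_⟩
  · intro x y h
    refine he ?_
    have h1 : lin ι (lin e x) = lin ι (lin e y) := h
    rw [← hp (lin e x), h1, hp]
  · intro x w _ hw
    have hA : A (Θ w) = Θ w := congrArg (lin ι) (hp _)
    have hB : B (Θ w) = 0 := by
      have h1 : lin (d 0) (lin p (lin ι (lin e w))) = 0 := by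
        rw [hp]
        exact hed.apply_apply_eq_zero w
      exact (congrArg (lin ι') h1).trans (map_zero (lin ι'))
    let z' : Fin n → Alg K S := fun j => filt (RightDivisor x) (Θ w j)
    have hA' : A z' = z' := funext fun j => by
      rw [apply_filt_rightDivisor A hw, hA]
    have hB' : B z' = 0 := funext fun j => by
      rw [apply_filt_rightDivisor B hw, hB]
      exact map_zero _
    have h1 : lin (d 0) (lin p z') = 0 := by
      have h2 : lin ι' (lin (d 0) (lin p z')) = 0 := hB'
      rw [← hp' (lin (d 0) (lin p z')), h2, map_zero]
    obtain ⟨w', hw'⟩ := (hed _).1 h1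
    refine ⟨w', rfl, fun j => ?_⟩
    have h3 : Θ w' = A z' := congrArg (lin ι) hw'
    rw [h3, hA']

section Splitting

variable {M : GrMod K S} {n : ℕ} {t : Fin n → ℤ}
  {Θ : M.carrier →ₗ[(Alg K S)ᵐᵒᵖ] (Fin n → Alg K S)}

theorem algProj_apply_eq
    (hdeg : ∀ (i : ℤ) (w : M.carrier), w ∈ M.deg i → ∀ j, Θ w j ∈ algDeg K S (i + t j))
    (i : ℤ) (w : M.carrier) (j : Fin n) :
    Θ (M.component i w) j = algProj K S (i + t j) (Θ w j) :=
  component_eq_of_graded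
    ((Pi.evalAddMonoidHom (fun _ : Fin n => Alg K S) j).comp Θ.toAddMonoidHom)
    (algProj K S (i + t j)) i (fun x hx => algProj_of_mem K S _ (hdeg i x hx j))
    (fun k hk x hx => algProj_of_mem_ne K S (by omega) (hdeg k x hx j)) w

theorem mem_deg_of_apply_mem (hΘ : Function.Injective Θ)
    (hdeg : ∀ (i : ℤ) (w : M.carrier), w ∈ M.deg i → ∀ j, Θ w j ∈ algDeg K S (i + t j))
    {i : ℤ} {w : M.carrier} (hw : ∀ j, Θ w j ∈ algDeg K S (i + t j)) : w ∈ M.deg i := by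
  have h : M.component i w = w := hΘ (funext fun j => by
    rw [algProj_apply_eq hdeg, algProj_of_mem K S _ (hw j)])
  rw [← h]
  exact M.component_mem i w

/-- Choose a shortest path x occurring in a coordinate of an element of the image of E. Keeping only
the terms ending in x gives a generator of a copy of xΛ; reading off, in the same coordinate, the
terms beginning with x gives the retraction. Minimality of the length of x makes both filters
compatible with the module structure. -/
theorem exists_splitting (hΘ : Function.Injective Θ)
    (hdeg : ∀ (i : ℤ) (w : M.carrier), w ∈ M.deg i → ∀ j, Θ w j ∈ algDeg K S (i + t j))
    {E : M ⟶ M} (hE : E ≫ E = E) (hcl : IsSuffixClosed Θ E) (h0 : E ≠ 0) :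
    ∃ (a b : V) (x : Path a b) (s : ℤ) (I : (pathMod K S x).shift s ⟶ M)
      (R : M ⟶ (pathMod K S x).shift s), cls K S x ≠ 0 ∧ I ≫ R = 𝟙 _ ∧ I ≫ E = I ∧ E ≫ R = R ∧
        IsSuffixClosed Θ (E - R ≫ I) := by
  classical
  have hE' : ∀ w, lin E (lin E w) = lin E w := LinearMap.congr_fun (congrArg lin hE)
  have hex : ∃ l, ∃ w j y, lin E w = w ∧ rep K S (Θ w j) y ≠ 0 ∧ y.len = l := by
    have h1 : ∃ w, lin E w ≠ 0 := by
      by_contra! h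
      exact h0 (lin_injective (LinearMap.ext h))
    obtain ⟨w, hw⟩ := h1
    have h2 : Θ (lin E w) ≠ 0 := fun h => hw (hΘ (h.trans (map_zero Θ).symm))
    obtain ⟨j, hj⟩ := Function.ne_iff.1 h2
    obtain ⟨y, hy⟩ := exists_rep_ne_zero hj
    exact ⟨_, lin E w, j, y, hE' w, hy, rfl⟩
  obtain ⟨w₀, j, ⟨a, b, x⟩, hw₀, hx₀, hl⟩ := Nat.find_spec hex
  have hmin : ∀ w, lin E w = w → ∀ k y, rep K S (Θ w k) y ≠ 0 → x.length ≤ y.len := by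
    intro w hw k y hy
    exact hl.trans_le (Nat.find_min' hex ⟨w, k, y, hw, hy, rfl⟩)
  have hx : cls K S x ≠ 0 := cls_ne_zero_of_rep hx₀
  obtain ⟨i, hi⟩ : ∃ i : ℤ, i + t j = x.length := ⟨x.length - t j, sub_add_cancel _ _⟩
  obtain ⟨w₁, hw₁, hd₁, hx₁⟩ : ∃ w₁, lin E w₁ = w₁ ∧ (∀ k, Θ w₁ k ∈ algDeg K S (i + t k)) ∧
      rep K S (Θ w₁ j) (tot x) ≠ 0 := by
    refine ⟨M.component i w₀, by rw [lin_component, hw₀],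
      hdeg i _ (M.component_mem i w₀), ?_⟩
    have h5 : rep K S (algProj K S x.length (Θ w₀ j)) (tot x) ≠ 0 :=
      exists_rep_algProj_ne_zero (y := tot x) hx₀
    rw [← hi, ← algProj_apply_eq hdeg] at h5
    exact h5
  have hsc : ∃ w', lin E w' = w' ∧ ∀ k, Θ w' k = filt (RightDivisor (tot x)) (Θ w₁ k) :=
    hcl (tot x) w₁ hw₁ (hmin w₁ hw₁)
  obtain ⟨w', hw', hΘ'⟩ := hsc
  have hd' : w' ∈ M.deg i := mem_deg_of_apply_mem hΘ hdeg fun k => by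
    rw [hΘ']
    exact filt_mem_algDeg _ (hd₁ k)
  let c := rep K S (Θ w₁ j) (tot x)
  -- By homogeneity every path in coordinate j has the length of x, and x is the only such path
  -- ending in x.
  have hΘj : Θ w' j = c • cls K S x := by
    rw [hΘ']
    refine filt_eq_smul_cls fun y hy => ⟨fun h => h.eq_of_len ?_, fun h => ?_⟩
    · have := mem_algDeg_iff.1 (hd₁ j) y hy
      rw [hi] at this
      exact_mod_cast this
    · rw [h]
      exact RightDivisor.refl _
  -- All coordinates of w' lie in Λx, so w' is killed by whatever kills x.
  obtain ⟨I, hI⟩ := exists_pathMod_hom (p := x) (t := t j) hd' hi (fun y hy => hΘ (by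
    rw [map_zero, map_smul]
    funext k
    show Θ w' k * y = 0
    obtain ⟨z, hz⟩ := exists_eq_mul_cls (p := x) (z := Θ w' k) (fun y' hy' => by
      rw [hΘ', rep_filt] at hy'
      by_contra hne
      exact hy' (if_neg hne))
    rw [hz, mul_assoc, hy, mul_zero]))
  let Q : M.carrier → Alg K S := fun m => c⁻¹ • filt (LeftDivisor (tot x)) (Θ (lin E m) j)
  have hQadd : ∀ m m', Q (m + m') = Q m + Q m' := fun m m' => by
    show c⁻¹ • filt _ (Θ (lin E (m + m')) j) = _
    rw [map_add, map_add, Pi.add_apply, map_add, smul_add]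
  have hQsmul : ∀ (a : (Alg K S)ᵐᵒᵖ) m, Q (a • m) = Q m * a.unop := fun a m => by
    show c⁻¹ • filt _ (Θ (lin E (a • m)) j) = _
    rw [map_smul, map_smul]
    show c⁻¹ • filt _ (Θ (lin E m) j * a.unop) = _
    rw [filt_mul_of_forall, smul_mul_assoc]
    intro a b c p q hp
    exact leftDivisor_comp_iff (hmin _ (hE' m) j _ hp)
  have hQmem : ∀ m, Q m ∈ pathIdeal K S x := fun m => mem_pathIdeal_iff_rep.2 fun y hy => by
    have hy' : c⁻¹ * rep K S (filt (LeftDivisor (tot x)) (Θ (lin E m) j)) y ≠ 0 := by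
      have : rep K S (c⁻¹ • filt (LeftDivisor (tot x)) (Θ (lin E m) j)) y ≠ 0 := hy
      rwa [map_smul] at this
    rw [rep_filt] at hy'
    by_contra hne
    exact hy' (by rw [if_neg hne, mul_zero])
  let Rl : M.carrier →ₗ[(Alg K S)ᵐᵒᵖ] pathIdeal K S x :=
    { toFun := fun m => ⟨Q m, hQmem m⟩
      map_add' := fun m m' => Subtype.ext (hQadd m m')
      map_smul' := fun a m => Subtype.ext (hQsmul a m) }
  let R : M ⟶ (pathMod K S x).shift (t j) := ofLin Rl fun k m hm =>
    Submodule.smul_mem _ _ (filt_mem_algDeg _ (hdeg k _ (lin_deg E hm) j))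
  have hIR : I ≫ R = 𝟙 _ := pathMod_hom_ext (Subtype.ext (by
    have h1 : lin (I ≫ R) (gen K S x) = lin R w' := congrArg (lin R) hI
    refine (congrArg Subtype.val h1).trans ?_
    show c⁻¹ • filt _ (Θ (lin E w') j) = cls K S x
    rw [hw', hΘj, map_smul, filt_cls_pos (LeftDivisor.refl _), smul_smul,
      inv_mul_cancel₀ hx₁, one_smul]))
  have hIE : I ≫ E = I := pathMod_hom_ext (by
    refine (congrArg (lin E) hI).trans ?_
    rw [hw', hI])
  have hER : E ≫ R = R := lin_injective (LinearMap.ext fun m => Subtype.ext (by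
    show c⁻¹ • filt _ (Θ (lin E (lin E m)) j) = c⁻¹ • filt _ (Θ (lin E m) j)
    rw [hE']))
  refine ⟨a, b, x, t j, I, R, hx, hIR, hIE, hER, ?_⟩
  intro x₂ w hw hlong
  have hw2 : lin E w - lin I (lin R w) = w := hw
  have hIE' : ∀ z, lin E (lin I z) = lin I z := LinearMap.congr_fun (congrArg lin hIE)
  have hEw : lin E w = w := by
    conv_lhs => rw [← hw2, map_sub, hE', hIE', hw2]
  have hRw : lin R w = 0 := by
    rw [hEw, sub_eq_self] at hw2
    have h1 : lin R (lin I (lin R w)) = lin R w :=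
      LinearMap.congr_fun (congrArg lin hIR) (lin R w)
    rw [← h1, hw2, map_zero]
  obtain ⟨w'', hw'', hΘ''⟩ := hcl x₂ w hEw hlong
  refine ⟨w'', ?_, hΘ''⟩
  have hRw'' : lin R w'' = 0 := Subtype.ext (by
    have h1 : c⁻¹ • filt (LeftDivisor (tot x)) (Θ (lin E w) j) = 0 := congrArg Subtype.val hRw
    show c⁻¹ • filt _ (Θ (lin E w'') j) = 0
    rw [hEw] at h1
    rw [hw'', hΘ'']
    have h2 : filt (LeftDivisor (tot x)) (Θ w j) = 0 := by
      rcases smul_eq_zero.1 h1 with h | h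
      · exact absurd h (inv_ne_zero hx₁)
      · exact h
    -- Prefix and suffix filters both select basis paths and hence commute; this keeps the
    -- complement suffix closed.
    have h3 : filt (LeftDivisor (tot x)) (filt (RightDivisor x₂) (Θ w j)) =
        filt (RightDivisor x₂) (filt (LeftDivisor (tot x)) (Θ w j)) :=
      rep_injective (Finsupp.ext fun y => by
        rw [rep_filt, rep_filt, rep_filt, rep_filt]
        split_ifs <;> rfl)
    rw [h3, h2, map_zero, smul_zero])
  show lin E w'' - lin I (lin R w'') = w''
  rw [hRw'', map_zero, sub_zero, hw'']

end Splitting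

/-- A property of endomorphisms of a Gorenstein-projective module that is closed under addition
holds for the identity if it holds for the idempotents splitting off modules generated by paths. -/
theorem GrMod.IsGproj.id_mem [∀ a b : V, Finite (a ⟶ b)] (hS : IsAdmissible K S) {M : GrMod K S}
    (hM : M.IsGproj) (H : AddSubgroup (M ⟶ M))
    (hH : ∀ {a b : V} (x : Path a b) (s : ℤ) (I : (pathMod K S x).shift s ⟶ M)
      (R : M ⟶ (pathMod K S x).shift s), cls K S x ≠ 0 → I ≫ R = 𝟙 _ → R ≫ I ∈ H) :
    𝟙 M ∈ H := by
  obtain ⟨n, t, Θ, hΘ, hdeg, hcl⟩ := hM.exists_embedding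
  have := isNoetherianRing_mulOpposite_alg hS
  -- Noetherian induction on the kernel: subtracting the idempotent of a summand xΛ from E strictly
  -- enlarges ker E, so the process ends at E = 0.
  have key : ∀ N : Submodule (Alg K S)ᵐᵒᵖ M.carrier, ∀ E : M ⟶ M, LinearMap.ker (lin E) = N →
      E ≫ E = E → IsSuffixClosed Θ E → E ∈ H := by
    intro N
    induction N using WellFoundedGT.induction with
    | ind N ih =>
    intro E hN hE hcl
    by_cases h0 : E = 0
    · rw [h0]
      exact H.zero_mem
    obtain ⟨a, b, x, s, I, R, hx, hIR, hIE, hER, hcl'⟩ := exists_splitting hΘ hdeg hE hcl h0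
    have hE' : (E - R ≫ I) ≫ (E - R ≫ I) = E - R ≫ I := by
      have h1 : E ≫ R ≫ I = R ≫ I := by rw [← Category.assoc, hER]
      have h2 : (R ≫ I) ≫ E = R ≫ I := by rw [Category.assoc, hIE]
      have h3 : (R ≫ I) ≫ R ≫ I = R ≫ I := by
        rw [Category.assoc, ← Category.assoc I, hIR, Category.id_comp]
      rw [Preadditive.sub_comp, Preadditive.comp_sub, Preadditive.comp_sub, hE, h1, h2, h3]
      abel
    have hlt : LinearMap.ker (lin E) < LinearMap.ker (lin (E - R ≫ I)) := by
      have hER' : ∀ m, lin R (lin E m) = lin R m := LinearMap.congr_fun (congrArg lin hER)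
      have hIR' : ∀ m, lin R (lin I m) = m := LinearMap.congr_fun (congrArg lin hIR)
      have hIE' : ∀ m, lin E (lin I m) = lin I m := LinearMap.congr_fun (congrArg lin hIE)
      refine lt_of_le_of_ne (fun m hm => ?_) fun h => hx ?_
      · have hm' : lin E m = 0 := hm
        show lin E m - lin I (lin R m) = 0
        rw [← hER', hm', map_zero, map_zero, sub_zero]
      · obtain ⟨g, hg⟩ : ∃ g : ((pathMod K S x).shift s).carrier, g = gen K S x := ⟨_, rfl⟩
        have h2 : lin I g ∈ LinearMap.ker (lin (E - R ≫ I)) := by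
          show lin E (lin I g) - lin I (lin R (lin I g)) = 0
          rw [hIE', hIR', sub_self]
        rw [← h] at h2
        have h3 : lin E (lin I g) = 0 := h2
        rw [hIE'] at h3
        have h4 : g = 0 := by rw [← hIR' g, h3, map_zero]
        exact congrArg Subtype.val (hg.symm.trans h4)
    have h1 := ih _ (hN ▸ hlt) (E - R ≫ I) rfl hE' hcl'
    rw [← sub_add_cancel E (R ≫ I)]
    exact H.add_mem h1 (hH x s I R hx hIR)
  exact key _ (𝟙 M) rfl (Category.id_comp _) hcl

end

end Decomposition


/-! ### Which paths generate summands of Gorenstein-projective modules -/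

section Annihilators

open Quiver GrMod

variable {K : Type w} [Field K] {V : Type u} [Quiver.{v} V] [Fintype V] {S : Set (TPath V)}

noncomputable section

theorem GrMod.exists_lift_of_injective {X Y M : GrMod K S} (f : X ⟶ Y) (e : M ⟶ Y)
    (he : Function.Injective (lin e)) (h : ∀ x, ∃ m, lin e m = lin f x) :
    ∃ g : X ⟶ M, ∀ x, lin e (lin g x) = lin f x := by
  choose g hg using h
  refine ⟨ofLin { toFun := g, map_add' := fun x y => he ?_, map_smul' := fun a x => he ?_ }
    fun i x hx => ?_, hg⟩
  · rw [map_add, hg, hg, hg, map_add]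
  · rw [RingHom.id_apply, map_smul, hg, hg, map_smul]
  · have h1 : M.component i (g x) = g x := he (by
      rw [lin_component, hg, component_of_mem (lin_deg f hx)])
    show g x ∈ M.deg i
    rw [← h1]
    exact M.component_mem i _

/-- Every homomorphism from `qΛ` to `Λ` is a left multiplication. -/
def HasLeftMulHoms (K : Type w) [Field K] (S : Set (TPath V)) {a b : V} (q : Path a b) : Prop :=
  ∀ f : pathIdeal K S q →ₗ[(Alg K S)ᵐᵒᵖ] Alg K S, ∃ y, ∀ z, f z = y * z

/-- `x'Λ` is, up to a shift, a direct summand of the image of `d k`. -/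
def RetractAt {P : ℤ → GrMod K S} (d : ∀ i : ℤ, P i ⟶ P (i + 1)) (k : ℤ) {a b : V}
    (x : Path a b) : Prop :=
  ∃ (t : ℤ) (I : (pathMod K S x).shift t ⟶ P (k + 1)) (R : P k ⟶ (pathMod K S x).shift t),
    (∀ w z, lin (d k) w = lin I z → lin R w = z) ∧ ∀ z, ∃ w, lin (d k) w = lin I z

/-- The projective cover of `xΛ`. -/
def pathCover (K : Type w) [Field K] (S : Set (TPath V)) {a b : V} (x : Path a b) (t : ℤ) :
    (pathMod K S (Path.nil : Path b b)).shift (t - x.length) ⟶ (pathMod K S x).shift t :=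
  lmulHom (cls K S x) Path.nil x _ t (mem_pathIdeal_iff.2 ⟨idem K S b, rfl⟩) (by
    rw [sub_sub_cancel]
    exact cls_mem_algDeg x)

theorem pathCover_gen {a b : V} (x : Path a b) (t : ℤ) :
    lin (pathCover K S x t) (gen K S (Path.nil : Path b b)) = gen K S x :=
  Subtype.ext (cls_mul_idem x)

theorem pathCover_surjective {a b : V} (x : Path a b) (t : ℤ) :
    Function.Surjective (lin (pathCover K S x t)) := by
  intro m
  obtain ⟨y, hy⟩ := exists_smul_gen (m : pathIdeal K S x)
  refine ⟨(MulOpposite.op y • gen K S (Path.nil : Path b b) : pathIdeal K S _), ?_⟩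
  refine (map_smul (lin (pathCover K S x t)) (MulOpposite.op y) _).trans ?_
  rw [pathCover_gen]
  exact hy.symm

theorem idem_mul_val {b : V} (z : pathIdeal K S (Path.nil : Path b b)) :
    idem K S b * z = z.1 := by
  obtain ⟨y, hy⟩ := mem_pathIdeal_iff.1 z.2
  rw [hy, ← mul_assoc, idem_mul_cls]

theorem smul_gen_nil {b : V} (z : pathIdeal K S (Path.nil : Path b b)) :
    MulOpposite.op z.1 • gen K S (Path.nil : Path b b) = z := Subtype.ext (idem_mul_val z)

/-- An endomorphism of a graded projective module `eΛ` compatible with the map to a non-zero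
module `xΛ` is the identity. -/
theorem end_eq_id_of_comp_pathCover {a b : V} {x : Path a b} (hx : cls K S x ≠ 0) {t : ℤ}
    {φ : (pathMod K S (Path.nil : Path b b)).shift (t - x.length) ⟶
      (pathMod K S (Path.nil : Path b b)).shift (t - x.length)}
    (h : φ ≫ pathCover K S x t = pathCover K S x t) : φ = 𝟙 _ := by
  refine pathMod_hom_ext ?_
  obtain ⟨u, hu⟩ : ∃ u : pathIdeal K S (Path.nil : Path b b), u = lin φ (gen K S _) := ⟨_, rfl⟩
  have hdeg : u.1 ∈ algDeg K S 0 := by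
    have h1 : u.1 ∈ algDeg K S (((Path.nil : Path b b).length : ℤ) - (t - x.length) +
      (t - x.length)) := by
      rw [hu]
      exact lin_deg φ (gen_mem_deg (Path.nil : Path b b) (t - x.length))
    rw [sub_add_cancel] at h1
    exact h1
  have hue : u.1 * idem K S b = u := by
    have h1 := (map_smul (lin φ) (MulOpposite.op (idem K S b)) (gen K S Path.nil)).symm.trans
      (congrArg (lin φ) (smul_idem_gen _))
    have h2 : MulOpposite.op (idem K S b) • u = u := by
      rw [hu]
      exact h1
    exact congrArg Subtype.val h2
  obtain ⟨c, hc⟩ := exists_algProj_zero_mul u.1 b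
  have h1 : u.1 = c • idem K S b := by
    rw [← hc, algProj_of_mem K S 0 hdeg, hue]
  have h2 : cls K S x * u = cls K S x := by
    have h3 := LinearMap.congr_fun (congrArg lin h) (gen K S (Path.nil : Path b b))
    have h4 : cls K S x * u = cls K S x * idem K S b := by
      rw [hu]
      exact congrArg Subtype.val h3
    rwa [cls_mul_idem] at h4
  rw [h1, mul_smul_comm, cls_mul_idem] at h2
  have hc1 : c = 1 := by
    by_contra hne
    have h3 : (c - 1) • cls K S x = 0 := by rw [sub_smul, h2, one_smul, sub_self]
    exact (smul_ne_zero (sub_ne_zero.2 hne) hx) h3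
  have h3 : u = gen K S (Path.nil : Path b b) := Subtype.ext (by
    rw [h1, hc1, one_smul]
    rfl)
  exact hu.symm.trans h3

/-- Let q be a shortest path in N. Selecting the terms that begin with q is a homomorphism from N to
Λ, hence a left multiplication; in degree zero that can only rescale every path from b by one common
scalar. The scalar is non-zero because q survives, so every path in N survives, that is, begins with
q. -/
theorem exists_annihilator_generator {b : V} (N : Submodule (Alg K S)ᵐᵒᵖ (Alg K S))
    (hN : ∀ z ∈ N, ∀ y, rep K S z y ≠ 0 → cls K S y.2.2 ∈ N)
    (hNb : ∀ z ∈ N, idem K S b * z = z)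
    (hom : ∀ f : N →ₗ[(Alg K S)ᵐᵒᵖ] Alg K S, ∃ y, ∀ z : N, f z = y * z)
    (h0 : ∃ z ∈ N, z ≠ 0) :
    ∃ (c : V) (q : Path b c), cls K S q ≠ 0 ∧ N = pathIdeal K S q := by
  classical
  have hex : ∃ l, ∃ (c : V) (q : Path b c), cls K S q ∈ N ∧ cls K S q ≠ 0 ∧ q.length = l := by
    obtain ⟨z, hz, hz0⟩ := h0
    obtain ⟨y, hy⟩ := exists_rep_ne_zero hz0
    have hy' := hy
    rw [← hNb z hz] at hy'
    obtain ⟨c, q, rfl⟩ := exists_of_rep_idem_mul hy'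
    exact ⟨_, c, q, hN z hz _ hy, cls_ne_zero_of_rep hy, rfl⟩
  obtain ⟨c, q, hqN, hq0, hl⟩ := Nat.find_spec hex
  have hpath : ∀ z ∈ N, ∀ y, rep K S z y ≠ 0 → ∃ (c : V) (p : Path b c), y = tot p ∧
      cls K S p ∈ N := by
    intro z hz y hy
    have hy' := hy
    rw [← hNb z hz] at hy'
    obtain ⟨c, p, rfl⟩ := exists_of_rep_idem_mul hy'
    exact ⟨c, p, rfl, hN z hz _ hy⟩
  have hmin : ∀ z ∈ N, ∀ y, rep K S z y ≠ 0 → q.length ≤ y.len := by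
    intro z hz y hy
    obtain ⟨c, p, rfl, hp⟩ := hpath z hz y hy
    exact hl.trans_le (Nat.find_min' hex ⟨c, p, hp, cls_ne_zero_of_rep hy, rfl⟩)
  obtain ⟨y, hy⟩ := hom
    { toFun := fun z => filt (LeftDivisor (tot q)) z.1
      map_add' := fun z z' => map_add _ _ _
      map_smul' := fun a z => by
        show filt _ (z.1 * a.unop) = filt _ z.1 * a.unop
        rw [filt_mul_of_forall]
        intro a b c p p' hp
        exact leftDivisor_comp_iff (hmin _ z.2 _ hp) }
  have hy' : ∀ z ∈ N, filt (LeftDivisor (tot q)) z = y * z := fun z hz => hy ⟨z, hz⟩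
  -- The filter preserves degrees, so only the degree-zero part of y counts.
  obtain ⟨e, he⟩ := exists_algProj_zero_mul y b
  have key : ∀ {c : V} (p : Path b c), cls K S p ∈ N →
      filt (LeftDivisor (tot q)) (cls K S p) = e • cls K S p := by
    intro c p hp
    have h1 := filt_mem_algDeg (LeftDivisor (tot q)) (cls_mem_algDeg (K := K) (S := S) p)
    rw [← algProj_of_mem K S _ h1, hy' _ hp, algProj_mul_cls, sub_self, he]
  have he1 : e ≠ 0 := by
    rintro rfl
    have := key q hqN
    rw [filt_cls_pos (LeftDivisor.refl _), zero_smul] at this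
    exact hq0 this
  refine ⟨c, q, hq0, le_antisymm (fun z hz => ?_) ?_⟩
  · refine mem_pathIdeal_iff_rep.2 fun p hp => ?_
    obtain ⟨c', p, rfl, hpN⟩ := hpath z hz p hp
    by_contra hne
    have := key p hpN
    rw [filt_cls_neg hne] at this
    exact smul_ne_zero he1 (cls_ne_zero_of_rep hp) this.symm
  · rw [pathIdeal, Submodule.span_le]
    rintro _ rfl
    exact hqN

/-- One step to the left in a totally acyclic complex. The syzygy N of xΛ, the annihilator of x in
e_bΛ, is a summand of the preceding image. Exactness of Hom(-, Λ) makes all homomorphisms from N to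
Λ left multiplications, so N is zero or generated by one path. -/
theorem RetractAt.step {P : ℤ → GrMod K S} {d : ∀ i : ℤ, P i ⟶ P (i + 1)}
    (hP : IsTotallyAcyclic P d) {k : ℤ} {a b : V} {x : Path a b} (hx : cls K S x ≠ 0)
    (h : RetractAt d (k + 1 + 1) x) :
    (∀ {c : V} (q : Path b c), cls K S q ≠ 0 → cls K S (x.comp q) ≠ 0) ∨
      ∃ (c : V) (q : Path b c), cls K S q ≠ 0 ∧ cls K S (x.comp q) = 0 ∧
        (∀ {c' : V} (q' : Path b c'), cls K S q' ≠ 0 → cls K S (x.comp q') = 0 →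
          ∃ y : Path c c', q' = q.comp y) ∧
        RetractAt d (k + 1) q ∧ HasLeftMulHoms K S q := by
  obtain ⟨t, I, R, hRI, hI⟩ := h
  let e₀ : pathIdeal K S (Path.nil : Path b b) := gen K S Path.nil
  have hRd : ∀ w, lin R (lin (d (k + 1)) w) = 0 := fun w => hRI _ _ (by
    rw [map_zero]
    exact (hP.exact (k + 1)).apply_apply_eq_zero w)
  obtain ⟨w₀, hw₀, hw₀'⟩ := exists_homogeneous_lift (d (k + 1 + 1))
    (lin_deg I (gen_mem_deg x t)) (hI _)
  have hw₁ := (P (k + 1 + 1)).smul_mem hw₀ (cls_mem_algDeg (Path.nil : Path b b))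
  obtain ⟨L, hL⟩ := exists_pathMod_hom (p := (Path.nil : Path b b)) (t := t - x.length) hw₁
    (by simp) (fun y hy => by rw [← mul_smul, ← MulOpposite.op_mul, hy, MulOpposite.op_zero,
      zero_smul])
  have hLd : L ≫ d (k + 1 + 1) = pathCover K S x t ≫ I := pathMod_hom_ext (by
    refine (congrArg (lin (d (k + 1 + 1))) hL).trans ((map_smul _ _ _).trans ?_)
    rw [hw₀']
    refine (map_smul (lin I) _ _).symm.trans (congrArg (lin I) ?_)
    exact (smul_idem_gen x).trans (pathCover_gen x t).symm)
  have hLd' : ∀ z, lin (d (k + 1 + 1)) (lin L z) = lin I (lin (pathCover K S x t) z) :=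
    LinearMap.congr_fun (congrArg lin hLd)
  -- L and R' lift I and R to the projective cover e_bΛ of xΛ. Their composite is compatible with
  -- the cover and therefore the identity, so e_bΛ splits off P (k + 2).
  obtain ⟨R', hR'⟩ := hP.projective (k + 1 + 1) (pathCover K S x t) (pathCover_surjective x t) R
  have hR'' : ∀ w, lin (pathCover K S x t) (lin R' w) = lin R w :=
    LinearMap.congr_fun (congrArg lin hR')
  have hLR : L ≫ R' = 𝟙 _ := end_eq_id_of_comp_pathCover hx (by
    rw [Category.assoc, hR']
    exact lin_injective (LinearMap.ext fun z => hRI _ _ (hLd' z)))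
  have hLR' : ∀ z, lin R' (lin L z) = z := LinearMap.congr_fun (congrArg lin hLR)
  let ρ : (P (k + 1)).carrier →ₗ[(Alg K S)ᵐᵒᵖ] pathIdeal K S (Path.nil : Path b b) :=
    lin (d (k + 1) ≫ R')
  have hρ : ∀ w, cls K S x * (ρ w).1 = 0 := fun w =>
    congrArg Subtype.val ((hR'' (lin (d (k + 1)) w)).trans (hRd w))
  let N : Submodule (Alg K S)ᵐᵒᵖ (Alg K S) :=
    { carrier := {z | idem K S b * z = z ∧ cls K S x * z = 0}
      add_mem' := fun {z z'} hz hz' => ⟨by rw [mul_add, hz.1, hz'.1], by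
        rw [mul_add, hz.2, hz'.2, add_zero]⟩
      zero_mem' := ⟨mul_zero _, mul_zero _⟩
      smul_mem' := fun c z hz => ⟨by
        show idem K S b * (z * c.unop) = z * c.unop
        rw [← mul_assoc, hz.1], by
        show cls K S x * (z * c.unop) = 0
        rw [← mul_assoc, hz.2, zero_mul]⟩ }
  have hNpath : ∀ z ∈ N, ∀ y, rep K S z y ≠ 0 → cls K S y.2.2 ∈ N := by
    intro z hz y hy
    have hy' := hy
    rw [← hz.1] at hy'
    obtain ⟨c, q, rfl⟩ := exists_of_rep_idem_mul hy'
    refine ⟨idem_mul_cls q, ?_⟩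
    rw [← cls_comp]
    by_contra h0
    have h1 := rep_cls_mul h0 z
    rw [hz.2, map_zero, Finsupp.zero_apply] at h1
    exact hy h1.symm
  let ρ' : (P (k + 1)).carrier →ₗ[(Alg K S)ᵐᵒᵖ] N :=
    { toFun := fun w => ⟨(ρ w).1, idem_mul_val _, hρ w⟩
      map_add' := fun w w' => Subtype.ext (by
        show (ρ (w + w')).1 = (ρ w).1 + (ρ w').1
        rw [map_add]
        rfl)
      map_smul' := fun c w => Subtype.ext (by
        show (ρ (c • w)).1 = c • (ρ w).1
        rw [map_smul]
        rfl) }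
  have hNL : ∀ z : pathIdeal K S (Path.nil : Path b b), z.1 ∈ N →
      ∃ w, lin (d (k + 1)) w = lin L z := by
    intro z hz
    refine (hP.exact (k + 1) _).1 ?_
    have h1 : lin (pathCover K S x t) z = 0 := Subtype.ext hz.2
    exact (hLd' z).trans ((congrArg (lin I) h1).trans (map_zero _))
  -- The composite of f with the projection ρ' vanishes on the image of d k, so it extends along d
  -- (k + 1) to some g on P (k + 2). The multiplier is then g(L(e_b)).
  have hom : ∀ f : N →ₗ[(Alg K S)ᵐᵒᵖ] Alg K S, ∃ y, ∀ z : N, f z = y * z := by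
    intro f
    obtain ⟨g, hg⟩ := hP.hom_exact k (f.comp ρ') (LinearMap.ext fun w => by
      have h1 : ρ' (lin (d k) w) = 0 := Subtype.ext (by
        have h2 : lin (d (k + 1)) (lin (d k) w) = 0 := (hP.exact k).apply_apply_eq_zero w
        have h3 : ρ (lin (d k) w) = 0 := (congrArg (lin R') h2).trans (map_zero (lin R'))
        have h4 : (ρ (lin (d k) w)).1 = 0 := congrArg Subtype.val h3
        exact h4)
      exact (congrArg f h1).trans (map_zero f))
    refine ⟨g (lin L e₀), fun z => ?_⟩
    have hz : z.1 ∈ pathIdeal K S (Path.nil : Path b b) :=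
      mem_pathIdeal_iff.2 ⟨z.1, z.2.1.symm⟩
    obtain ⟨w, hw⟩ := hNL ⟨z.1, hz⟩ z.2
    have h0 : ρ w = ⟨z.1, hz⟩ := (congrArg (lin R') hw).trans (hLR' _)
    have h0' : (ρ w).1 = z.1 := congrArg Subtype.val h0
    have h1 : ρ' w = z := Subtype.ext h0'
    have h2 : f z = g (lin L (⟨z.1, hz⟩ : pathIdeal K S (Path.nil : Path b b))) := by
      exact (congrArg f h1).symm.trans ((LinearMap.congr_fun hg w).symm.trans (congrArg g hw))
    rw [h2]
    have h3 : lin L (⟨z.1, hz⟩ : pathIdeal K S (Path.nil : Path b b)) =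
        MulOpposite.op z.1 • lin L e₀ :=
      (congrArg (lin L) (smul_gen_nil ⟨z.1, hz⟩).symm).trans (map_smul (lin L) _ _)
    exact (congrArg g h3).trans (map_smul g _ _)
  by_cases h0 : ∃ z ∈ N, z ≠ 0
  · right
    obtain ⟨c, q, hq, hNq⟩ :=
      exists_annihilator_generator N hNpath (fun z hz => hz.1) hom h0
    have hqN : cls K S q ∈ N := hNq ▸ (gen K S q).2
    refine ⟨c, q, hq, by rw [cls_comp, hqN.2], ?_, ?_, ?_⟩
    · intro c' q' hq' hxq'
      have h1 : cls K S q' ∈ N := ⟨idem_mul_cls q', by rw [← cls_comp, hxq']⟩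
      rw [hNq] at h1
      have h2 := mem_pathIdeal_iff_rep.1 h1 (tot q') (by
        rw [rep_cls q' hq', Finsupp.single_eq_same]
        exact one_ne_zero)
      obtain ⟨y, hy⟩ := h2.exists_comp
      exact ⟨y, tot_inj.1 hy⟩
    · let j : (pathMod K S q).shift (t - x.length) ⟶
          (pathMod K S (Path.nil : Path b b)).shift (t - x.length) :=
        lmulHom 1 q Path.nil _ _ (mem_pathIdeal_iff.2 ⟨cls K S q, by rw [one_mul, idem_mul_cls]⟩)
          (by rw [sub_self]; exact one_mem_algDeg)
      let j' : pathIdeal K S q →ₗ[(Alg K S)ᵐᵒᵖ] pathIdeal K S (Path.nil : Path b b) := lin j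
      have hj : ∀ z : pathIdeal K S q, (j' z).1 = z.1 := fun z => one_mul _
      have hjinj : Function.Injective (lin j) := fun z z' hz =>
        Subtype.ext ((hj z).symm.trans ((congrArg Subtype.val hz).trans (hj z')))
      obtain ⟨R₁, hR₁⟩ := exists_lift_of_injective (d (k + 1) ≫ R') j hjinj (fun w => by
        have h1 : (ρ w).1 ∈ pathIdeal K S q := hNq ▸ (ρ' w).2
        exact ⟨(⟨(ρ w).1, h1⟩ : pathIdeal K S q), Subtype.ext (hj _)⟩)
      refine ⟨t - x.length, j ≫ L, R₁, fun w z hw => hjinj ?_, fun z => ?_⟩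
      · rw [hR₁]
        exact (congrArg (lin R') hw).trans (hLR' _)
      · refine hNL (lin j z) ?_
        have h1 : ∀ z : pathIdeal K S q, (j' z).1 ∈ N := fun z => by
          rw [hj, hNq]
          exact z.2
        exact h1 z
    · intro f
      let incl : N →ₗ[(Alg K S)ᵐᵒᵖ] pathIdeal K S q :=
        { toFun := fun z => ⟨z.1, hNq ▸ z.2⟩
          map_add' := fun _ _ => rfl
          map_smul' := fun _ _ => rfl }
      obtain ⟨y, hy⟩ := hom (f.comp incl)
      exact ⟨y, fun z => hy ⟨z.1, hNq.symm ▸ z.2⟩⟩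
  · left
    intro c q hq hxq
    exact h0 ⟨cls K S q, ⟨idem_mul_cls q, by rw [← cls_comp, hxq]⟩, hq⟩

/-- Were qΛ isomorphic to e_cΛ, the map sending q to e_c would be a left multiplication. Then e_c =
yq, which is impossible for a path q of positive length. -/
theorem HasLeftMulHoms.exists_comp_eq_zero {b c : V} {q : Path b c} (h : HasLeftMulHoms K S q)
    (hq : cls K S q ≠ 0) (hpos : 0 < q.length) :
    ∃ (c' : V) (q' : Path c c'), cls K S q' ≠ 0 ∧ cls K S (q.comp q') = 0 := by
  by_contra! hne
  obtain ⟨f, hf⟩ := exists_pathIdeal_hom (p := q) (idem K S c) (fun y hy => by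
    show idem K S c * y = 0
    refine eq_zero_of_rep fun z => ?_
    by_contra hz
    obtain ⟨c', z, rfl⟩ := exists_of_rep_idem_mul hz
    have h1 := rep_cls_mul (hne c' z (cls_ne_zero_of_rep hz)) (idem K S c * y)
    rw [← mul_assoc, cls_mul_idem, hy, map_zero, Finsupp.zero_apply] at h1
    exact hz h1.symm)
  obtain ⟨y, hy⟩ := h f
  have h1 : idem K S c = y * cls K S q := hf.symm.trans (hy _)
  have h2 : rep K S (idem K S c) (tot (Path.nil : Path c c)) ≠ 0 := by
    have h0 : idem K S c ≠ 0 := fun h0 => hq (by rw [← cls_mul_idem, h0, mul_zero])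
    rw [rep_cls _ h0, Finsupp.single_eq_same]
    exact one_ne_zero
  rw [h1] at h2
  obtain ⟨c', z, hz⟩ := exists_of_rep_mul_cls h2
  have h3 := congrArg TPath.len hz
  have h4 : 0 = (z.comp q).length := h3
  rw [Path.length_comp] at h4
  omega

/-- Left minimality is extracted from homomorphisms: if pq' = 0, then q ↦ p is well defined on qΛ,
hence p = yq and q is a right divisor of p. -/
theorem HasLeftMulHoms.isPerfectPair {a b c : V} {q : Path a b} {q' : Path b c}
    (h : HasLeftMulHoms K S q) (hq : cls K S q ≠ 0) (hpos : 0 < q.length) (hq' : cls K S q' ≠ 0)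
    (h0 : cls K S (q.comp q') = 0)
    (hmin : ∀ {d : V} (q'' : Path b d), cls K S q'' ≠ 0 → cls K S (q.comp q'') = 0 →
      ∃ y : Path c d, q'' = q'.comp y) : IsPerfectPair K S q q' where
  nonzero_left := hq
  nonzero_right := hq'
  pos_left := hpos
  pos_right := by
    rcases Nat.eq_zero_or_pos q'.length with h1 | h1
    · obtain rfl := Path.eq_of_length_zero q' h1
      obtain rfl := Path.eq_nil_of_length_zero q' h1
      exact absurd h0 hq
    · exact h1
  comp_eq_zero := h0
  right_minimal := hmin
  left_minimal := by
    intro d p hp hpq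
    obtain ⟨f, hf⟩ := exists_pathIdeal_hom (p := q) (cls K S p) (fun y hy => by
      obtain ⟨z, hz⟩ := exists_mul_right_of_forall hmin hy
      show cls K S p * y = 0
      rw [← cls_mul_idem, mul_assoc, hz, ← mul_assoc, ← cls_comp, hpq, zero_mul])
    obtain ⟨y, hy⟩ := h f
    have h1 : cls K S p = y * cls K S q := hf.symm.trans (hy _)
    have h2 : rep K S (y * cls K S q) (tot p) ≠ 0 := by
      rw [← h1, rep_cls p hp, Finsupp.single_eq_same]
      exact one_ne_zero
    obtain ⟨d', z, hz⟩ := exists_of_rep_mul_cls h2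
    cases hz
    exact ⟨z, rfl⟩

theorem length_pos_of_comp_eq_zero {a b c : V} {x : Path a b} {q : Path b c}
    (hx : cls K S x ≠ 0) (h : cls K S (x.comp q) = 0) : 0 < q.length := by
  rcases Nat.eq_zero_or_pos q.length with h1 | h1
  · obtain rfl := Path.eq_of_length_zero q h1
    obtain rfl := Path.eq_nil_of_length_zero q h1
    exact absurd h hx
  · exact h1

/-- Repeated use of `RetractAt.step` produces an infinite chain of perfect pairs; the non-projective
alternative always occurs because a path with `HasLeftMulHoms` and positive length has a non-zero
annihilating path. -/
theorem RetractAt.isPerfect [∀ a b : V, Finite (a ⟶ b)] (hS : IsAdmissible K S)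
    {P : ℤ → GrMod K S} {d : ∀ i : ℤ, P i ⟶ P (i + 1)} (hP : IsTotallyAcyclic P d) {k : ℤ}
    {a b : V} {q : Path a b} (hq : cls K S q ≠ 0) (hpos : 0 < q.length) (h : RetractAt d k q)
    (h' : HasLeftMulHoms K S q) : IsPerfect K S (tot q) := by
  refine isPerfect_of_forall_exists hS (fun y => cls K S y.2.2 ≠ 0 ∧ 0 < y.2.2.length ∧
    (∃ k, RetractAt d k y.2.2) ∧ HasLeftMulHoms K S y.2.2) ?_ ⟨hq, hpos, ⟨k, h⟩, h'⟩
  rintro ⟨a, b, q⟩ ⟨hq, hpos, ⟨k, h⟩, h'⟩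
  obtain ⟨k, rfl⟩ : ∃ k', k = k' + 1 + 1 := ⟨k - 2, by ring⟩
  rcases h.step hP hq with h1 | ⟨c, q', hq', h0, hmin, hret, hlm⟩
  · obtain ⟨c, q', hq', h0⟩ := h'.exists_comp_eq_zero hq hpos
    exact absurd h0 (h1 q' hq')
  · exact ⟨tot q', ⟨hq', length_pos_of_comp_eq_zero hq h0, ⟨_, hret⟩, hlm⟩,
      perfectSucc_tot.2 (h'.isPerfectPair hq hpos hq' h0 hmin)⟩

theorem retractAt_of_exact {P : ℤ → GrMod K S} {d : ∀ i : ℤ, P i ⟶ P (i + 1)}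
    (hP : IsTotallyAcyclic P d) {M : GrMod K S} {k : ℤ} (e : M ⟶ P (k + 1))
    (he : Function.Injective (lin e)) (hed : Function.Exact (lin e) (lin (d (k + 1))))
    {a b : V} {x : Path a b} {t : ℤ} {I : (pathMod K S x).shift t ⟶ M}
    {R : M ⟶ (pathMod K S x).shift t} (hIR : I ≫ R = 𝟙 _) : RetractAt d k x := by
  obtain ⟨g, hg⟩ := exists_lift_of_injective (d k) e he
    (fun w => (hed _).1 ((hP.exact k).apply_apply_eq_zero w))
  have hIR' : ∀ z, lin R (lin I z) = z := LinearMap.congr_fun (congrArg lin hIR)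
  refine ⟨t, I ≫ e, g ≫ R, fun w z h => ?_, fun z => (hP.exact k _).1 (hed.apply_apply_eq_zero _)⟩
  have h1 : lin g w = lin I z := he ((hg w).trans h)
  exact (congrArg (lin R) h1).trans (hIR' z)

/-- The paths generating direct summands of graded Gorenstein-projective modules: either the module
is projective, or the path ends with a perfect path having the same annihilator. -/
theorem GrMod.IsGproj.exists_isPerfectPair [∀ a b : V, Finite (a ⟶ b)] (hS : IsAdmissible K S)
    {M : GrMod K S} (hM : M.IsGproj) {a b : V} {x : Path a b} (hx : cls K S x ≠ 0) {t : ℤ}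
    {I : (pathMod K S x).shift t ⟶ M} {R : M ⟶ (pathMod K S x).shift t} (hIR : I ≫ R = 𝟙 _) :
    (∀ {c : V} (q : Path b c), cls K S q ≠ 0 → cls K S (x.comp q) ≠ 0) ∨
      ∃ (a' c : V) (z : Path a a') (x' : Path a' b) (q : Path b c), x = z.comp x' ∧
        IsPerfectPair K S x' q ∧ IsPerfect K S (tot x') ∧
        ∀ {c' : V} (q' : Path b c'), cls K S q' ≠ 0 → cls K S (x.comp q') = 0 →
          ∃ y : Path c c', q' = q.comp y := by
  obtain ⟨P, d, hP, e, he, hed⟩ := hM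
  have h : RetractAt d (-2 + 1) x := retractAt_of_exact (k := -2 + 1) hP e he hed hIR
  -- M sits in P 0 as the image of d (-1); the index is rewritten into the shape required by
  -- `RetractAt.step`.
  obtain ⟨k, hk⟩ : ∃ k : ℤ, (-2 : ℤ) + 1 = k + 1 + 1 := ⟨-3, by norm_num⟩
  rw [hk] at h
  rcases h.step hP hx with h1 | ⟨c, q, hq, h0, hmin, hret, hlm⟩
  · exact Or.inl h1
  · have hpos := length_pos_of_comp_eq_zero hx h0
    have hqp := hret.isPerfect hS hP hq hpos hlm
    obtain ⟨a', x', hx', hxp⟩ := hqp.exists_pred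
    -- The annihilator of x is qΛ with q perfect, and xq = 0 makes the predecessor x' of q a right
    -- divisor of x.
    obtain ⟨z, rfl⟩ := hx'.left_minimal x hx h0
    exact Or.inr ⟨a', c, z, x', q, rfl, hx', hxp, hmin⟩

end

end Annihilators


/-! ### A criterion for indecomposability -/

section Indecomposability

variable {C : Type*} [Category C] [Preadditive C] [HasBinaryBiproducts C]

/-- For a decomposition into Y and Z, the idempotent projecting onto Y is zero or invertible; an
invertible idempotent is the identity, so Y or Z vanishes. -/
theorem indecomposable_of_forall_end {X : C} (h0 : 𝟙 X ≠ 0)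
    (h : ∀ f : X ⟶ X, f = 0 ∨ IsIso f) : Indecomposable X := by
  refine ⟨fun hX => h0 (hX.eq_of_src _ _), fun Y Z a => ?_⟩
  have hid : (a.hom ≫ biprod.fst ≫ biprod.inl ≫ a.inv) ≫
      (a.hom ≫ biprod.fst ≫ biprod.inl ≫ a.inv) = a.hom ≫ biprod.fst ≫ biprod.inl ≫ a.inv := by
    simp
  rcases h (a.hom ≫ biprod.fst ≫ biprod.inl ≫ a.inv) with h1 | h1
  · left
    rw [IsZero.iff_id_eq_zero]
    have h2 : 𝟙 Y = biprod.inl ≫ a.inv ≫ (a.hom ≫ biprod.fst ≫ biprod.inl ≫ a.inv) ≫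
        a.hom ≫ biprod.fst := by simp
    rw [h2, h1, zero_comp, comp_zero, comp_zero]
  · right
    rw [IsZero.iff_id_eq_zero]
    have h2 : a.hom ≫ biprod.fst ≫ biprod.inl ≫ a.inv = 𝟙 X := by
      rw [← cancel_epi (a.hom ≫ biprod.fst ≫ biprod.inl ≫ a.inv), hid, Category.comp_id]
    have h3 : 𝟙 Z = biprod.inr ≫ a.inv ≫ 𝟙 X ≫ a.hom ≫ biprod.snd := by simp
    rw [h3, ← h2]
    simp

end Indecomposability

/-! ### Morphisms in the stable category -/

section Stable

open Quiver GrMod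

variable {K : Type w} [Field K] {V : Type u} [Quiver.{v} V] [Fintype V] {S : Set (TPath V)}

noncomputable section

theorem stMap_eq_zero_iff {M N : GrMod K S} {hM : M.IsGproj} {hN : N.IsGproj} {f : M ⟶ N} :
    (stMap f : stObj M hM ⟶ stObj N hN) = 0 ↔
      ∃ (P : GrMod K S) (a : M ⟶ P) (b : P ⟶ N), P.IsProjective ∧ f = a ≫ b := by
  have h : (stMap f : stObj M hM ⟶ stObj N hN) = 0 ↔ stableRel K S f 0 :=
    Iff.trans ⟨fun h => congrArg (fun g => g.hom) h, fun h => ObjectProperty.hom_ext _ h⟩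
      (CategoryTheory.Quotient.functor_map_eq_iff (stableRel K S) f 0)
  rw [h]
  unfold stableRel
  rw [sub_zero]

theorem exists_stMap_eq {M N : GrMod K S} {hM : M.IsGproj} {hN : N.IsGproj}
    (α : stObj M hM ⟶ stObj N hN) : ∃ f : M ⟶ N, α = stMap f := by
  obtain ⟨f, hf⟩ := (CategoryTheory.Quotient.functor (stableRel K S)).map_surjective α.hom
  exact ⟨f, ObjectProperty.hom_ext _ hf.symm⟩

/-- A morphism that is zero in the stable category lifts along surjections. -/
theorem exists_lift_of_stMap_eq_zero {M N L : GrMod K S} {hM : M.IsGproj} {hN : N.IsGproj}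
    {f : M ⟶ N} (hf : (stMap f : stObj M hM ⟶ stObj N hN) = 0) (q : L ⟶ N)
    (hq : Function.Surjective (lin q)) : ∃ g : M ⟶ L, ∀ x, lin q (lin g x) = lin f x := by
  obtain ⟨P, a, b, hP, rfl⟩ := stMap_eq_zero_iff.1 hf
  obtain ⟨c, rfl⟩ := hP q hq b
  exact ⟨a ≫ c, fun x => rfl⟩

/-- A morphism of short exact sequences that is the identity on the left term exhibits B as the
pullback of C → T ← I. Hence f factors through B itself, before passing to the stable category, once
ξf lifts to I. -/
theorem exists_factorization {A B C I T : GrMod K S} {u : A ⟶ B} {v : B ⟶ C}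
    (huv : IsShortExact u v) {j : A ⟶ I} {q : I ⟶ T} (hjq : IsShortExact j q) {φ : B ⟶ I}
    {ξ : C ⟶ T} (h1 : ∀ x, lin φ (lin u x) = lin j x)
    (h2 : ∀ x, lin q (lin φ x) = lin ξ (lin v x)) {M : GrMod K S} {f : M ⟶ C} {h : M ⟶ I}
    (hf : ∀ x, lin q (lin h x) = lin ξ (lin f x)) : ∃ β : M ⟶ B, β ≫ v = f := by
  obtain ⟨β, hβ⟩ := exists_lift_of_injective (GrMod.lift h f) (GrMod.lift φ v)
    (fun x y hxy => by
      have hφ : lin φ x = lin φ y := congrArg Prod.fst hxy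
      have hv : lin v x = lin v y := congrArg Prod.snd hxy
      obtain ⟨a, ha⟩ := (huv.exact (x - y)).1 (by rw [map_sub, hv, sub_self])
      have h3 : lin j a = 0 := by rw [← h1, ha, map_sub, hφ, sub_self]
      have h4 : a = 0 := hjq.injective (h3.trans (map_zero _).symm)
      rw [h4, map_zero] at ha
      exact (sub_eq_zero.1 ha.symm))
    (fun x => by
      obtain ⟨b, hb⟩ := huv.surjective (lin f x)
      obtain ⟨a, ha⟩ := (hjq.exact (lin h x - lin φ b)).1 (by
        rw [map_sub, hf, h2, hb, sub_self])
      refine ⟨b + lin u a, Prod.ext ?_ ?_⟩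
      · show lin φ (b + lin u a) = lin h x
        rw [map_add, h1, ha, add_sub_cancel]
      · show lin v (b + lin u a) = lin f x
        rw [map_add, hb, huv.exact.apply_apply_eq_zero, add_zero])
  exact ⟨β, lin_injective (LinearMap.ext fun x => congrArg Prod.snd (hβ x))⟩

theorem isDistinguished_of_isStandard {T : StTriangle (K := K) (S := S)} (h : T.IsStandard) :
    T.IsDistinguished :=
  ⟨T, h, Iso.refl _, Iso.refl _, Iso.refl _, Iso.refl _, ⟨𝟙 _, 𝟙 _, 𝟙 _,
    (Category.id_comp _).trans (Category.comp_id _).symm,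
    (Category.id_comp _).trans (Category.comp_id _).symm, rfl, rfl⟩,
    (Category.comp_id _).trans (Category.id_comp _).symm,
    (Category.comp_id _).trans (Category.id_comp _).symm,
    (Category.comp_id _).trans (Category.id_comp _).symm⟩

theorem eq_smul_cls {a b : V} {p : Path a b} {z : Alg K S}
    (h : ∀ y, rep K S z y ≠ 0 → y = tot p) : z = rep K S z (tot p) • cls K S p := by
  classical
  have h1 : filt (fun _ => True) z = z := rep_injective (Finsupp.ext fun y => by
    rw [rep_filt, if_pos trivial])
  rw [← filt_eq_smul_cls (Q := fun _ => True) fun y hy => ⟨fun _ => h y hy, fun _ => trivial⟩, h1]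

theorem eq_smul_cls_of_mem {a b : V} {p : Path a b} {z : Alg K S} (hz : z ∈ pathIdeal K S p)
    (hd : z ∈ algDeg K S p.length) : z = rep K S z (tot p) • cls K S p :=
  eq_smul_cls fun y hy => (mem_pathIdeal_iff_rep.1 hz y hy).eq_of_len
    (by exact_mod_cast mem_algDeg_iff.1 hd y hy)

/-- The multiple of the generator of `pΛ` by a scalar. -/
def smulGen (S : Set (TPath V)) (c : K) {a b : V} (p : Path a b) : pathIdeal K S p :=
  MulOpposite.op (c • (1 : Alg K S)) • gen K S p

theorem smulGen_val (c : K) {a b : V} (p : Path a b) :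
    (smulGen S c p).1 = c • cls K S p := by
  show cls K S p * (c • (1 : Alg K S)) = _
  rw [mul_smul_comm, mul_one]

/-- The only path in pΛ of the length of p is p, so a degree-zero endomorphism is multiplication by
a scalar. -/
theorem end_pathMod_eq_zero_or_isIso {a b : V} (p : Path a b) (t : ℤ)
    (f : (pathMod K S p).shift t ⟶ (pathMod K S p).shift t) : f = 0 ∨ IsIso f := by
  obtain ⟨m, hm⟩ : ∃ m : pathIdeal K S p, m = lin f (gen K S p) := ⟨_, rfl⟩
  have hd : m.1 ∈ algDeg K S p.length := by
    have h1 : m.1 ∈ algDeg K S ((p.length : ℤ) - t + t) := by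
      rw [hm]
      exact lin_deg f (gen_mem_deg p t)
    rwa [sub_add_cancel] at h1
  obtain ⟨c, hc⟩ : ∃ c : K, m.1 = c • cls K S p := ⟨_, eq_smul_cls_of_mem m.2 hd⟩
  have hm' : lin f (gen K S p) = smulGen S c p :=
    hm.symm.trans (Subtype.ext (by rw [hc, smulGen_val]))
  by_cases h0 : c = 0
  · left
    refine pathMod_hom_ext (hm'.trans (Subtype.ext ?_))
    rw [smulGen_val, h0, zero_smul]
    rfl
  · right
    obtain ⟨g, hg⟩ := exists_pathMod_hom (p := p) (t := t) (k := p.length - t)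
      (N := (pathMod K S p).shift t) (n := smulGen S c⁻¹ p) (by
        show (smulGen S c⁻¹ p).1 ∈ algDeg K S (p.length - t + t)
        rw [smulGen_val, sub_add_cancel]
        exact Submodule.smul_mem _ _ (cls_mem_algDeg p)) (sub_add_cancel _ _)
      (fun y hy => Subtype.ext (by
        show (smulGen S c⁻¹ p).1 * y = 0
        rw [smulGen_val, smul_mul_assoc, hy, smul_zero]))
    refine ⟨g, pathMod_hom_ext ?_, pathMod_hom_ext ?_⟩
    · refine (congrArg (lin g) hm').trans ((map_smul (lin g) _ _).trans ?_)
      rw [hg]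
      refine Subtype.ext ?_
      show (smulGen S c⁻¹ p).1 * (c • (1 : Alg K S)) = cls K S p
      rw [smulGen_val, mul_smul_comm, mul_one, smul_smul, mul_inv_cancel₀ h0, one_smul]
    · refine (congrArg (lin f) hg).trans ((map_smul (lin f) _ _).trans ?_)
      rw [hm']
      refine Subtype.ext ?_
      show (smulGen S c p).1 * (c⁻¹ • (1 : Alg K S)) = cls K S p
      rw [smulGen_val, mul_smul_comm, mul_one, smul_smul, inv_mul_cancel₀ h0, one_smul]

/-- Endomorphisms are scalars, so only stable non-vanishing needs an argument. If the identity
lifted to the cover e_bΛ, p would go to a degree-zero element k with pk = p and kq = 0 for the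
successor q of p. But k acts on paths from b as a scalar; kq = 0 makes this scalar zero, and then p
= pk = 0. -/
theorem indecomposable_stObj {a b : V} {p : Path a b} (hp : IsPerfect K S (tot p)) {t : ℤ}
    (hG : ((pathMod K S p).shift t).IsGproj) :
    Indecomposable (stObj ((pathMod K S p).shift t) hG) := by
  refine indecomposable_of_forall_end (fun h => ?_) fun α => ?_
  · have h1 : (stMap (𝟙 ((pathMod K S p).shift t)) : stObj _ hG ⟶ stObj _ hG) = 0 := h
    obtain ⟨g, hg⟩ := exists_lift_of_stMap_eq_zero h1 _ (pathCover_surjective p t)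
    obtain ⟨c, q, hq, -⟩ := hp.exists_succ
    obtain ⟨k, hk⟩ : ∃ k : pathIdeal K S (Path.nil : Path b b), k = lin g (gen K S p) := ⟨_, rfl⟩
    have hpk : cls K S p * k.1 = cls K S p := by
      rw [hk]
      exact congrArg Subtype.val (hg (gen K S p))
    have hkq : k.1 * cls K S q = 0 := by
      have h2 : MulOpposite.op (cls K S q) • k = 0 := by
        rw [hk]
        refine (map_smul (lin g) (MulOpposite.op (cls K S q)) (gen K S p)).symm.trans ?_
        have h3 : MulOpposite.op (cls K S q) • gen K S p = 0 := Subtype.ext (by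
          show cls K S p * cls K S q = 0
          rw [← cls_comp, hq.comp_eq_zero])
        exact (congrArg (lin g) h3).trans (map_zero _)
      exact congrArg Subtype.val h2
    have hd : k.1 ∈ algDeg K S 0 := by
      have h1 : k.1 ∈ algDeg K S ((p.length : ℤ) - t + (t - p.length)) := by
        rw [hk]
        exact lin_deg g (gen_mem_deg p t)
      rwa [show (p.length : ℤ) - t + (t - p.length) = 0 by ring] at h1
    obtain ⟨e, he⟩ := exists_algProj_zero_mul k.1 b
    rw [algProj_of_mem K S 0 hd] at he
    have he0 : e = 0 := by
      have h2 := he q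
      rw [hkq] at h2
      exact (smul_eq_zero.1 h2.symm).resolve_right hq.nonzero_right
    refine hp.ne_zero ?_
    rw [← cls_mul_idem p, ← hpk, mul_assoc, he, he0, zero_smul, mul_zero]
  · obtain ⟨f, rfl⟩ := exists_stMap_eq α
    rcases end_pathMod_eq_zero_or_isIso p t f with rfl | hf
    · exact Or.inl stMap_zero
    · right
      refine ⟨stMap (inv f), ?_, ?_⟩
      · rw [← stMap_comp, IsIso.hom_inv_id]
        rfl
      · rw [← stMap_comp, IsIso.inv_hom_id]
        rfl

end

end Stable


/-! ### Lifting along ΣA, path by path -/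

section AuslanderReiten

open Quiver GrMod

variable {K : Type w} [Field K] {V : Type u} [Quiver.{v} V] [Fintype V] {S : Set (TPath V)}

noncomputable section

/-- The combinatorial data of an Auslander–Reiten triangle ending in `pΛ`, where `p = ρ w`: the
minimal perfect path `ρ` is followed by a perfect path beginning with `w g`, where `g` is a minimal
perfect path beginning the successor `g v` of `p`, and `u ρ` is the predecessor of `w g`. -/
structure ARConfig (K : Type w) [Field K] (S : Set (TPath V)) {s a b c d e f : V} (u : Path s a)
    (ρ : Path a b) (w : Path b c) (g : Path c d) (v : Path d e) (h : Path d f) : Prop where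
  minimal_left : IsMinPerfect K S ρ
  minimal_right : IsMinPerfect K S g
  perfect_mid : IsPerfect K S (tot (ρ.comp w))
  perfect_left : IsPerfect K S (tot (w.comp g))
  perfect_susp : IsPerfect K S (tot (u.comp ρ))
  perfect_or_trivial : IsPerfect K S (tot w) ∨ w.length = 0
  perfect_or_zero : IsPerfect K S (tot (ρ.comp (w.comp g))) ∨ cls K S (ρ.comp (w.comp g)) = 0
  pair_mid : IsPerfectPair K S (ρ.comp w) (g.comp v)
  pair_susp : IsPerfectPair K S (u.comp ρ) (w.comp g)
  pair_left : IsPerfectPair K S ρ ((w.comp g).comp h)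
  ne_zero : cls K S (w.comp (g.comp v)) ≠ 0

namespace ARConfig

variable {s a b c d e f : V} {u : Path s a} {ρ : Path a b} {w : Path b c} {g : Path c d}
  {v : Path d e} {h : Path d f}

theorem mul_eq_zero (H : ARConfig K S u ρ w g v h) (y : Alg K S) :
    cls K S u * (cls K S (ρ.comp (w.comp g)) * y) = 0 := by
  rw [← mul_assoc, ← cls_comp, ← Path.comp_assoc, H.pair_susp.comp_eq_zero, zero_mul]

/-- The path P = ρwy in pΛ is killed by q and so ends in x. It lifts if P = ρk with kq = 0, or if uP
= 0, as happens when y begins with g. The position of x relative to ρw decides which case holds; if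
they overlap, `IsMinPerfect.overlap_cases` leaves only P = p = x as an exception. -/
theorem exists_of_path [∀ a b : V, Finite (a ⟶ b)] (hS : IsAdmissible K S)
    (H : ARConfig K S u ρ w g v h) {a' b' c' : V} {x : Path a' b'} {q : Path b' c'}
    (hx : IsPerfect K S (tot x)) (hxq : IsPerfectPair K S x q) {y : Path c b'}
    (hne : cls K S ((ρ.comp w).comp y) ≠ 0) (h0 : cls K S (((ρ.comp w).comp y).comp q) = 0) :
    (∃ k, cls K S (u.comp ρ) * k = cls K S u * cls K S ((ρ.comp w).comp y) ∧ k * cls K S q = 0) ∨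
      (tot x = tot (ρ.comp w) ∧ tot ((ρ.comp w).comp y) = tot (ρ.comp w)) := by
  have key : ∀ {t : V} (z : Path b t) (x' : Path t b'), (ρ.comp w).comp y = ρ.comp (z.comp x') →
      cls K S (x'.comp q) = 0 →
      ∃ k, cls K S (u.comp ρ) * k = cls K S u * cls K S ((ρ.comp w).comp y) ∧
        k * cls K S q = 0 := by
    intro t z x' e e'
    refine ⟨cls K S (z.comp x'), ?_, ?_⟩
    · rw [e, cls_comp u, cls_comp ρ, mul_assoc]
    · rw [← cls_comp, Path.comp_assoc, cls_comp, e', mul_zero]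
  obtain ⟨z, hz⟩ := hxq.left_minimal _ hne h0
  rcases comp_eq_comp_cases hz with ⟨t, h1, h2⟩ | ⟨t, h1, h2⟩
  · subst h2
    refine Or.inl (key (w.comp t) x ?_ hxq.comp_eq_zero)
    simp only [Path.comp_assoc]
  · subst h2
    by_cases ht : t.length = 0
    · obtain rfl := Path.eq_of_length_zero t ht
      obtain rfl := Path.eq_nil_of_length_zero t ht
      simp only [Path.nil_comp] at hxq ⊢
      refine Or.inl (key w y ?_ hxq.comp_eq_zero)
      rw [Path.comp_assoc]
    -- A genuine overlap: t is a non-trivial common part of ρw and x = ty. The path yq is non-zero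
    -- since x is longer than y, so it begins with the successor gv of ρw.
    have hyq : cls K S (y.comp q) ≠ 0 := fun h1 => by
      obtain ⟨y', hy'⟩ := hxq.left_minimal y (cls_ne_zero_right hne) h1
      have h2 := congrArg Path.length hy'
      rw [Path.length_comp, Path.length_comp] at h2
      omega
    obtain ⟨t', ht'⟩ := H.pair_mid.right_minimal (y.comp q) hyq (by rwa [← Path.comp_assoc])
    rcases comp_eq_comp_cases ht' with ⟨c, hc, -⟩ | ⟨y', hy', -⟩
    swap
    · refine absurd ?_ hne
      rw [hy', ← Path.comp_assoc, cls_comp, H.pair_mid.comp_eq_zero, zero_mul]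
    rcases H.minimal_left.overlap_cases hS H.minimal_right H.perfect_mid h1 hx (by omega)
      (by rwa [← Path.comp_assoc, ← h1]) hc with ⟨z', rfl⟩ | ⟨y', rfl⟩ | ⟨hz0, hy0⟩
    · refine Or.inl (key z' (t.comp y) ?_ hxq.comp_eq_zero)
      rw [h1]
      simp only [Path.comp_assoc]
    · left
      refine ⟨0, ?_, zero_mul _⟩
      rw [mul_zero, ← cls_comp]
      have h2 := H.mul_eq_zero (cls K S y')
      rw [← cls_comp, ← cls_comp] at h2
      simp only [Path.comp_assoc] at h2 ⊢
      exact h2.symm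
    · right
      obtain rfl := Path.eq_of_length_zero z hz0
      obtain rfl := Path.eq_nil_of_length_zero z hz0
      obtain rfl := Path.eq_of_length_zero y hy0
      obtain rfl := Path.eq_nil_of_length_zero y hy0
      rw [h1]
      simp

/-- The liftable elements form a subspace, so it is enough to treat the paths occurring in n; the
hypothesis on coefficients removes the exceptional one. -/
theorem exists_of_mem [∀ a b : V, Finite (a ⟶ b)] (hS : IsAdmissible K S)
    (H : ARConfig K S u ρ w g v h) {a' b' c' : V} {x : Path a' b'} {q : Path b' c'}
    (hx : IsPerfect K S (tot x)) (hxq : IsPerfectPair K S x q) {n : Alg K S}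
    (hn : n ∈ pathIdeal K S (ρ.comp w)) (hnb : n * idem K S b' = n) (hnq : n * cls K S q = 0)
    (hne : ¬ (tot x = tot (ρ.comp w) ∧ rep K S n (tot (ρ.comp w)) ≠ 0)) :
    ∃ k, cls K S (u.comp ρ) * k = cls K S u * n ∧ k * cls K S q = 0 := by
  let N : Submodule K (Alg K S) :=
    { carrier := {n | ∃ k, cls K S (u.comp ρ) * k = cls K S u * n ∧ k * cls K S q = 0}
      add_mem' := by
        rintro n n' ⟨k, h1, h2⟩ ⟨k', h1', h2'⟩
        exact ⟨k + k', by rw [mul_add, mul_add, h1, h1'], by rw [add_mul, h2, h2', add_zero]⟩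
      zero_mem' := ⟨0, by rw [mul_zero, mul_zero], zero_mul _⟩
      smul_mem' := by
        rintro c n ⟨k, h1, h2⟩
        exact ⟨c • k, by rw [mul_smul_comm, mul_smul_comm, h1], by
          rw [smul_mul_assoc, h2, smul_zero]⟩ }
  refine show n ∈ N from mem_of_rep fun {s' t'} P hP => ?_
  obtain ⟨y, hy⟩ := (mem_pathIdeal_iff_rep.1 hn _ hP).exists_comp
  have hP' := hP
  rw [← hnb] at hP'
  obtain ⟨e', z, hz⟩ := exists_of_rep_mul_cls hP'
  cases hz
  cases hy
  rw [Path.comp_nil] at hP ⊢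
  have h0 : cls K S (((ρ.comp w).comp y).comp q) = 0 := by
    by_contra h0
    have h1 := rep_mul_cls h0 n
    rw [hnq, map_zero, Finsupp.zero_apply] at h1
    exact hP h1.symm
  rcases H.exists_of_path hS hx hxq (cls_ne_zero_of_rep hP) h0 with h1 | ⟨h1, h2⟩
  · exact h1
  · rw [h2] at hP
    exact absurd ⟨h1, hP⟩ hne

end ARConfig

end

end AuslanderReiten


/-! ### Lifting homomorphisms and non-vanishing of ξ -/

section Triangle

open Quiver GrMod

variable {K : Type w} [Field K] {V : Type u} [Quiver.{v} V] [Fintype V] {S : Set (TPath V)}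

noncomputable section

theorem surjective_of_isLeftMul {a b x y : V} {p : Path a b} {q : Path x y} {c : Alg K S}
    {f : pathIdeal K S p →ₗ[(Alg K S)ᵐᵒᵖ] pathIdeal K S q} (hf : IsLeftMul c f)
    (h : c * cls K S p = cls K S q) : Function.Surjective f := by
  intro m
  obtain ⟨z, hz⟩ := mem_pathIdeal_iff.1 m.2
  refine ⟨⟨cls K S p * z, mem_pathIdeal_iff.2 ⟨z, rfl⟩⟩, Subtype.ext ?_⟩
  rw [hf, hz, ← mul_assoc, h]

theorem injective_of_isLeftMul_one {a b x y : V} {p : Path a b} {q : Path x y}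
    {f : pathIdeal K S p →ₗ[(Alg K S)ᵐᵒᵖ] pathIdeal K S q} (hf : IsLeftMul 1 f) :
    Function.Injective f := fun m m' h => Subtype.ext (by
  have h1 := congrArg Subtype.val h
  rwa [hf, hf, one_mul, one_mul] at h1)

namespace ARConfig

variable {s a b c d e f : V} {u : Path s a} {ρ : Path a b} {w : Path b c} {g : Path c d}
  {v : Path d e} {h : Path d f}

/-- The almost split property tested on a single module xΛ. The lift exists for projective xΛ;
otherwise everything depends on whether x' = p and p occurs in the image n of the generator. -/
theorem exists_lift_or_section [∀ a b : V, Finite (a ⟶ b)] (hS : IsAdmissible K S)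
    (H : ARConfig K S u ρ w g v h) {x₁ x₂ : V} {x : Path x₁ x₂} {t : ℤ}
    (hx : (∀ {c : V} (q : Path x₂ c), cls K S q ≠ 0 → cls K S (x.comp q) ≠ 0) ∨
      ∃ (a' c : V) (z : Path x₁ a') (x' : Path a' x₂) (q : Path x₂ c), x = z.comp x' ∧
        IsPerfectPair K S x' q ∧ IsPerfect K S (tot x') ∧
        ∀ {c' : V} (q' : Path x₂ c'), cls K S q' ≠ 0 → cls K S (x.comp q') = 0 →
          ∃ y : Path c c', q' = q.comp y)
    (F : (pathMod K S x).shift t ⟶ pathMod K S (ρ.comp w))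
    {ξ : pathMod K S (ρ.comp w) ⟶ (pathMod K S (u.comp ρ)).shift u.length}
    (hξ : IsLeftMul (cls K S u) (lin ξ))
    {π : (pathMod K S (Path.nil : Path b b)).shift (-(ρ.length : ℤ)) ⟶
      (pathMod K S (u.comp ρ)).shift u.length}
    (hπ : IsLeftMul (cls K S (u.comp ρ)) (lin π)) :
    (∃ k : (pathMod K S x).shift t ⟶
      (pathMod K S (Path.nil : Path b b)).shift (-(ρ.length : ℤ)),
      ∀ z, lin π (lin k z) = lin ξ (lin F z)) ∨
    ∃ σ : pathMod K S (ρ.comp w) ⟶ (pathMod K S x).shift t, σ ≫ F = 𝟙 _ := by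
  have hπs : Function.Surjective (lin π) := surjective_of_isLeftMul hπ (cls_mul_idem _)
  rcases hx with hx | ⟨a', c', z, x', q, rfl, hxq, hx', hmin⟩
  · left
    have hP : ((pathMod K S x).shift t).IsProjective := pathMod_isProjective_of_forall (by
      intro y hy
      refine eq_zero_of_rep fun P => ?_
      by_contra hP
      obtain ⟨c', P, rfl⟩ := exists_of_rep_idem_mul hP
      have h1 := rep_cls_mul (hx P (cls_ne_zero_of_rep hP)) (idem K S x₂ * y)
      rw [← mul_assoc, cls_mul_idem, hy, map_zero, Finsupp.zero_apply] at h1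
      exact hP h1.symm) t
    obtain ⟨k, hk⟩ := hP π hπs (F ≫ ξ)
    exact ⟨k, LinearMap.congr_fun (congrArg lin hk)⟩
  · obtain ⟨n, hn⟩ : ∃ n : pathIdeal K S (ρ.comp w), n = lin F (gen K S (z.comp x')) := ⟨_, rfl⟩
    have hF : ∀ y, cls K S (z.comp x') * y = 0 → n.1 * y = 0 := by
      intro y hy
      have h1 : MulOpposite.op y • gen K S (z.comp x') = 0 := Subtype.ext hy
      have h2 : MulOpposite.op y • n = 0 := by
        rw [hn]
        exact (map_smul (lin F) _ _).symm.trans ((congrArg (lin F) h1).trans (map_zero _))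
      exact congrArg Subtype.val h2
    have hnb : n.1 * idem K S x₂ = n.1 := by
      have h2 : MulOpposite.op (idem K S x₂) • n = n := by
        rw [hn]
        exact (map_smul (lin F) _ _).symm.trans (congrArg (lin F) (smul_idem_gen _))
      exact congrArg Subtype.val h2
    have hnq : n.1 * cls K S q = 0 := hF _ (by
      rw [cls_comp, mul_assoc, ← cls_comp x', hxq.comp_eq_zero, mul_zero])
    have hnd : n.1 ∈ algDeg K S ((z.comp x').length - t) := by
      rw [hn]
      exact lin_deg F (gen_mem_deg (z.comp x') t)
    by_cases hne : tot x' = tot (ρ.comp w) ∧ rep K S n.1 (tot (ρ.comp w)) ≠ 0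
    · right
      obtain ⟨e1, hr⟩ := hne
      -- Since n is homogeneous, an occurrence of p fixes its degree and n = r p. As x' = p, sending
      -- p to r⁻¹ z p is well defined and gives the section.
      have hd := mem_algDeg_iff.1 hnd _ hr
      have hd' : ((ρ.comp w).length : ℤ) = (z.comp x').length - t := hd
      rw [← hd'] at hnd
      obtain ⟨r, hr', hnr⟩ : ∃ r : K, r ≠ 0 ∧ n.1 = r • cls K S (ρ.comp w) :=
        ⟨_, hr, eq_smul_cls_of_mem n.2 hnd⟩
      obtain ⟨σ, hσ⟩ := exists_pathMod_hom (p := ρ.comp w) (t := 0) (k := (ρ.comp w).length)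
        (N := (pathMod K S (z.comp x')).shift t) (n := smulGen S r⁻¹ (z.comp x')) (by
          show (smulGen S r⁻¹ (z.comp x')).1 ∈ algDeg K S ((ρ.comp w).length + t)
          rw [smulGen_val, hd', sub_add_cancel]
          exact Submodule.smul_mem _ _ (cls_mem_algDeg _)) (add_zero _) (fun y hy => Subtype.ext (by
          show (smulGen S r⁻¹ (z.comp x')).1 * y = 0
          cases e1
          rw [smulGen_val, smul_mul_assoc, cls_comp z, mul_assoc, hy, mul_zero, smul_zero]))
      refine ⟨toShiftZero _ ≫ σ, lin_injective (pathIdeal_hom_ext ?_)⟩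
      refine (congrArg (lin F) hσ).trans ((map_smul (lin F) _ _).trans ?_)
      rw [← hn]
      refine Subtype.ext ?_
      show n.1 * (r⁻¹ • (1 : Alg K S)) = cls K S (ρ.comp w)
      rw [hnr, mul_smul_comm, mul_one, smul_smul, inv_mul_cancel₀ hr', one_smul]
    · left
      obtain ⟨k, hk, hkq⟩ := H.exists_of_mem hS hx' hxq n.2 hnb hnq hne
      -- The element k need be neither homogeneous nor in e_bΛ. Its component in the degree
      -- prescribed by n, cut down by e_b, still satisfies both equations.
      let D : ℤ := (z.comp x').length - t
      let k' := idem K S b * algProj K S (D - ρ.length) k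
      have hk' : cls K S (u.comp ρ) * k' = cls K S u * n.1 := by
        show cls K S (u.comp ρ) * (idem K S b * algProj K S (D - ρ.length) k) = _
        have h1 : D + u.length - (u.comp ρ).length = D - ρ.length := by
          rw [Path.length_comp]
          push_cast
          ring
        rw [← mul_assoc, cls_mul_idem, ← h1, ← algProj_cls_mul, hk, algProj_cls_mul,
          add_sub_cancel_right, algProj_of_mem K S D hnd]
      have hkq' : k' * cls K S q = 0 := by
        show idem K S b * algProj K S (D - ρ.length) k * cls K S q = 0
        have h1 : D - ρ.length = D - ρ.length + q.length - q.length := by ring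
        rw [mul_assoc, h1, ← algProj_mul_cls, hkq, map_zero, mul_zero]
      have hkd : k' ∈ algDeg K S (D - ρ.length) := by
        have h1 := algDeg_mul K S (cls_mem_algDeg (K := K) (S := S) (Path.nil : Path b b))
          (algProj_mem K S (D - ρ.length) k)
        rw [Path.length_nil, Nat.cast_zero, zero_add] at h1
        exact h1
      obtain ⟨φ, hφ⟩ := exists_pathMod_hom (p := z.comp x') (t := t) (k := D)
        (N := (pathMod K S (Path.nil : Path b b)).shift (-(ρ.length : ℤ)))
        (n := (⟨k' * idem K S x₂, mem_pathIdeal_iff.2 ⟨_, mul_assoc _ _ _⟩⟩ :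
          pathIdeal K S (Path.nil : Path b b))) (by
          have h1 := algDeg_mul K S hkd (cls_mem_algDeg (K := K) (S := S) (Path.nil : Path x₂ x₂))
          rw [Path.length_nil, Nat.cast_zero, add_zero] at h1
          exact h1) (sub_add_cancel _ _) (fun y hy => Subtype.ext (by
          obtain ⟨y', hy'⟩ := exists_mul_right_of_forall hmin hy
          show k' * idem K S x₂ * y = 0
          rw [mul_assoc, hy', ← mul_assoc, hkq', zero_mul]))
      refine ⟨φ, LinearMap.congr_fun (f := lin (φ ≫ π)) (g := lin (F ≫ ξ)) ?_⟩
      refine pathIdeal_hom_ext ?_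
      refine (congrArg (lin π) hφ).trans (Subtype.ext ?_)
      refine (hπ _).trans (Eq.trans ?_ (hξ _).symm)
      have h1 : (lin F (gen K S (z.comp x')) : pathIdeal K S (ρ.comp w)).1 = n.1 := by rw [hn]
      refine Eq.trans ?_ (congrArg (cls K S u * ·) h1.symm)
      show cls K S (u.comp ρ) * (k' * idem K S x₂) = cls K S u * n.1
      rw [← mul_assoc, hk', mul_assoc, hnb]

/-- If ξ were stably zero it would lift to eΛ, sending p to some k with uρk = uρw. The difference k
- w lies in wgΛ, whose paths are longer than w, so k = w by degree. But pgv = 0 forces kgv = 0,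
against wgv ≠ 0. -/
theorem stMap_ne_zero (H : ARConfig K S u ρ w g v h)
    {ξ : pathMod K S (ρ.comp w) ⟶ (pathMod K S (u.comp ρ)).shift u.length}
    (hξ : IsLeftMul (cls K S u) (lin ξ))
    {π : (pathMod K S (Path.nil : Path b b)).shift (-(ρ.length : ℤ)) ⟶
      (pathMod K S (u.comp ρ)).shift u.length}
    (hπ : IsLeftMul (cls K S (u.comp ρ)) (lin π)) (hC : (pathMod K S (ρ.comp w)).IsGproj)
    (hT : ((pathMod K S (u.comp ρ)).shift u.length).IsGproj) :
    (stMap ξ : stObj _ hC ⟶ stObj _ hT) ≠ 0 := by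
  intro h0
  obtain ⟨ζ, hζ⟩ := exists_lift_of_stMap_eq_zero h0 π (surjective_of_isLeftMul hπ (cls_mul_idem _))
  obtain ⟨k, hk⟩ : ∃ k : pathIdeal K S (Path.nil : Path b b), k = lin ζ (gen K S (ρ.comp w)) :=
    ⟨_, rfl⟩
  have h1 : cls K S (u.comp ρ) * k.1 = cls K S u * cls K S (ρ.comp w) := by
    rw [hk]
    exact (hπ _).symm.trans ((congrArg Subtype.val (hζ (gen K S (ρ.comp w)))).trans (hξ _))
  have h2 : k.1 * cls K S (g.comp v) = 0 := by
    have h3 : MulOpposite.op (cls K S (g.comp v)) • gen K S (ρ.comp w) = 0 := Subtype.ext (by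
      show cls K S (ρ.comp w) * cls K S (g.comp v) = 0
      rw [← cls_comp, H.pair_mid.comp_eq_zero])
    have h4 : MulOpposite.op (cls K S (g.comp v)) • k = 0 := by
      rw [hk]
      exact (map_smul (lin ζ) _ _).symm.trans ((congrArg (lin ζ) h3).trans (map_zero _))
    exact congrArg Subtype.val h4
  have hkd : k.1 ∈ algDeg K S w.length := by
    have h3 : (gen K S (ρ.comp w) : (pathMod K S (ρ.comp w)).carrier) ∈
        (pathMod K S (ρ.comp w)).deg (ρ.comp w).length := cls_mem_algDeg (ρ.comp w)
    have h4 : k.1 ∈ algDeg K S ((ρ.comp w).length + -(ρ.length : ℤ)) := by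
      rw [hk]
      exact lin_deg ζ h3
    rw [Path.length_comp] at h4
    rwa [show ((ρ.length + w.length : ℕ) : ℤ) + -(ρ.length : ℤ) = w.length by push_cast; ring] at h4
  obtain ⟨y, hy⟩ := H.pair_susp.exists_mul_right (x := k.1 - cls K S w) (by
    rw [mul_sub, h1, cls_comp u, cls_comp ρ, mul_assoc, sub_self])
  rw [mul_sub, idem_mul_val, idem_mul_cls] at hy
  have hd : k.1 - cls K S w ∈ algDeg K S w.length := Submodule.sub_mem _ hkd (cls_mem_algDeg w)
  have hz : k.1 - cls K S w = 0 := by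
    rw [← algProj_of_mem K S _ hd, hy]
    refine eq_zero_of_rep fun P => ?_
    by_contra hP
    have h5 := mem_algDeg_iff.1 (algProj_mem K S _ _) P hP
    rw [algProj_cls_mul] at hP
    obtain ⟨_, P, rfl⟩ := exists_of_rep_cls_mul hP
    have h6 : (((w.comp g).comp P).length : ℤ) = w.length := h5
    rw [Path.length_comp, Path.length_comp] at h6
    have := H.minimal_right.1.length_pos
    omega
  rw [sub_eq_zero.1 hz, ← cls_comp] at h2
  exact H.ne_zero h2

end ARConfig

end

end Triangle


/-! ### Assembling the Auslander–Reiten triangle -/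

section Main

open Quiver GrMod

variable {V : Type u} [Quiver.{v} V]

namespace CyclicSeq

variable {r : CyclicSeq V}

theorem exists_seg_of_source {x : V} {j : ℤ} (hx : r.vert j = x) (k : ℕ) :
    ∃ (y : V) (p : Path x y), tot p = tot (r.seg j k) := by
  subst hx
  exact ⟨_, _, rfl⟩

theorem exists_seg_of_target {y : V} {j : ℤ} {k : ℕ} (hy : r.vert (j + k) = y) :
    ∃ (x : V) (p : Path x y), tot p = tot (r.seg j k) := by
  subst hy
  exact ⟨_, _, rfl⟩

theorem target_eq {x y : V} {p : Path x y} {j : ℤ} {k : ℕ} (h : tot p = tot (r.seg j k)) :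
    r.vert (j + k) = y := (congrArg (fun z : TPath V => z.2.1) h).symm

end CyclicSeq

variable {K : Type w} [Field K] [Fintype V] {S : Set (TPath V)}

theorem IsMinPerfect.congr {a b a' b' : V} {p : Path a b} {p' : Path a' b'}
    (h : IsMinPerfect K S p) (e : tot p' = tot p) : IsMinPerfect K S p' := by
  cases e
  exact h

noncomputable section

/-- There is an Auslander–Reiten triangle `A → B₁ ⊕ B₂ → C → ΣA` of modules generated by the given
paths, whose morphisms are inclusions and left multiplications by `ρ` and `u`. -/
def HasTriangle (K : Type w) [Field K] (S : Set (TPath V)) {a b a₁ b₁ a₂ b₂ a₃ b₃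
    a₄ b₄ a₅ b₅ a₆ b₆ : V} (ρ : Path a b) (u : Path a₁ b₁) (pA : Path a₂ b₂) (pB₁ : Path a₃ b₃) (pB₂ : Path a₄ b₄)
    (pC : Path a₅ b₅) (pT : Path a₆ b₆) : Prop :=
  let l : ℤ := ρ.length
  let s : ℤ := u.length
  let A : GrMod K S := (pathMod K S pA).shift (-l)
  let B₁ : GrMod K S := (pathMod K S pB₁).shift (-l)
  let B₂ : GrMod K S := pathMod K S pB₂
  let C : GrMod K S := pathMod K S pC
  let I : GrMod K S := (pathMod K S (Path.nil : Path b b)).shift (-l)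
  let SA : GrMod K S := (pathMod K S pT).shift s
  ∃ (ι' : A ⟶ B₁) (π' : A ⟶ B₂) (π : B₁ ⟶ C) (ι : B₂ ⟶ C) (ξ : C ⟶ SA)
    (j : A ⟶ I) (q : I ⟶ SA)
    (hA : A.IsGproj) (hB : (B₁.prod B₂).IsGproj) (hC : C.IsGproj)
    (hI : I.IsProjective) (hSA : SA.IsGproj) (hjq : GrMod.IsShortExact j q),
    IsLeftMul 1 (GrMod.lin ι') ∧
    IsLeftMul (cls K S ρ) (GrMod.lin π') ∧
    IsLeftMul (cls K S ρ) (GrMod.lin π) ∧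
    IsLeftMul 1 (GrMod.lin ι) ∧
    IsLeftMul (cls K S u) (GrMod.lin ξ) ∧
    IsLeftMul 1 (GrMod.lin j) ∧
    IsLeftMul (cls K S pT) (GrMod.lin q) ∧
    GrMod.IsShortExact (GrMod.lift ι' (-π')) (GrMod.desc π ι) ∧
    StTriangle.IsAuslanderReiten
      { A := A, B := B₁.prod B₂, C := C, hA := hA, hB := hB, hC := hC
        σ := { I := I, susp := SA, incl := j, proj := q, isProjective := hI, isGproj := hSA,
               isShortExact := hjq }
        f := stMap (GrMod.lift ι' (-π'))
        g := stMap (GrMod.desc π ι)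
        h := stMap ξ }

namespace ARConfig

variable {s a b c d e f : V} {u : Path s a} {ρ : Path a b} {w : Path b c} {g : Path c d}
  {v : Path d e} {h : Path d f}

theorem isShortExact (H : ARConfig K S u ρ w g v h)
    {ι' : (pathMod K S (w.comp g)).shift (-(ρ.length : ℤ)) ⟶ (pathMod K S w).shift (-(ρ.length : ℤ))}
    {π' : (pathMod K S (w.comp g)).shift (-(ρ.length : ℤ)) ⟶ pathMod K S (ρ.comp (w.comp g))}
    {π : (pathMod K S w).shift (-(ρ.length : ℤ)) ⟶ pathMod K S (ρ.comp w)}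
    {ι : pathMod K S (ρ.comp (w.comp g)) ⟶ pathMod K S (ρ.comp w)}
    (h1 : IsLeftMul 1 (lin ι')) (h2 : IsLeftMul (cls K S ρ) (lin π'))
    (h3 : IsLeftMul (cls K S ρ) (lin π)) (h4 : IsLeftMul 1 (lin ι)) :
    IsShortExact (GrMod.lift ι' (-π')) (GrMod.desc π ι) where
  injective x y hxy := injective_of_isLeftMul_one h1 (congrArg Prod.fst hxy)
  surjective x := by
    obtain ⟨y, hy⟩ := surjective_of_isLeftMul h3 (cls_comp ρ w).symm x
    refine ⟨(y, 0), ?_⟩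
    show lin π y + lin ι 0 = x
    rw [map_zero, add_zero]
    exact hy
  exact := by
    -- Writing x = wx' and y = ρwgy', the element wx' + wgy' is killed by ρ, hence lies in wghΛ;
    -- therefore x itself lies in wgΛ.
    have key : ∀ (x : pathIdeal K S w) (y : pathIdeal K S (ρ.comp (w.comp g))),
        cls K S ρ * x.1 + y.1 = 0 → x.1 ∈ pathIdeal K S (w.comp g) := by
      intro x y hxy
      obtain ⟨x', hx'⟩ := mem_pathIdeal_iff.1 x.2
      obtain ⟨y', hy'⟩ := mem_pathIdeal_iff.1 y.2
      obtain ⟨z, hz⟩ := H.pair_left.exists_mul_right (x := cls K S w * x' + cls K S (w.comp g) * y')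
        (by rw [mul_add, ← mul_assoc _ _ y', ← cls_comp, ← hy', ← hx', hxy])
      rw [mul_add, ← mul_assoc, ← mul_assoc, idem_mul_cls, idem_mul_cls, cls_comp (w.comp g),
        mul_assoc _ _ z] at hz
      refine mem_pathIdeal_iff.2 ⟨cls K S h * z - y', ?_⟩
      rw [hx', mul_sub, ← hz, add_sub_cancel_right]
    rintro ⟨x, y⟩
    constructor
    · intro h0
      have h5 : cls K S ρ * (x : pathIdeal K S w).1 +
          (y : pathIdeal K S (ρ.comp (w.comp g))).1 = 0 := by
        have h6 : lin π x + lin ι y = 0 := h0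
        have h7 : (lin π x : pathIdeal K S (ρ.comp w)).1 + (lin ι y : pathIdeal K S (ρ.comp w)).1 = 0 :=
          congrArg Subtype.val h6
        have h8 : (lin π x : pathIdeal K S (ρ.comp w)).1 = _ := h3 x
        have h9 : (lin ι y : pathIdeal K S (ρ.comp w)).1 = _ := h4 y
        rwa [h8, h9, one_mul] at h7
      refine ⟨(⟨(x : pathIdeal K S w).1, key x y h5⟩ : pathIdeal K S (w.comp g)), Prod.ext ?_ ?_⟩
      · exact Subtype.ext ((h1 _).trans (one_mul _))
      · refine Subtype.ext ?_
        have h6 := h2 (⟨(x : pathIdeal K S w).1, key x y h5⟩ : pathIdeal K S (w.comp g))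
        refine (congrArg Neg.neg h6).trans ?_
        rw [add_eq_zero_iff_eq_neg] at h5
        exact neg_eq_iff_eq_neg.2 h5
    · rintro ⟨z, hz⟩
      have hx : lin ι' z = x := congrArg Prod.fst hz
      have hy : -lin π' z = y := congrArg Prod.snd hz
      show lin π x + lin ι y = 0
      rw [← hx, ← hy, map_neg, ← sub_eq_add_neg, sub_eq_zero]
      refine Subtype.ext ((h3 _).trans (Eq.trans ?_ (h4 _).symm))
      refine (congrArg (cls K S ρ * ·) (h1 z)).trans (Eq.trans ?_ (congrArg (1 * ·) (h2 z)).symm)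
      show cls K S ρ * (1 * _) = 1 * (cls K S ρ * _)
      rw [one_mul, one_mul]

/-- The comparison map B → eΛ is the inclusion of wΛ and zero on ρwgΛ. The square with ξ commutes
because uρwg = 0. -/
theorem isStandard (H : ARConfig K S u ρ w g v h)
    {ι' : (pathMod K S (w.comp g)).shift (-(ρ.length : ℤ)) ⟶ (pathMod K S w).shift (-(ρ.length : ℤ))}
    {π' : (pathMod K S (w.comp g)).shift (-(ρ.length : ℤ)) ⟶ pathMod K S (ρ.comp (w.comp g))}
    {π : (pathMod K S w).shift (-(ρ.length : ℤ)) ⟶ pathMod K S (ρ.comp w)}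
    {ι : pathMod K S (ρ.comp (w.comp g)) ⟶ pathMod K S (ρ.comp w)}
    {ξ : pathMod K S (ρ.comp w) ⟶ (pathMod K S (u.comp ρ)).shift u.length}
    {j : (pathMod K S (w.comp g)).shift (-(ρ.length : ℤ)) ⟶
      (pathMod K S (Path.nil : Path b b)).shift (-(ρ.length : ℤ))}
    {q : (pathMod K S (Path.nil : Path b b)).shift (-(ρ.length : ℤ)) ⟶
      (pathMod K S (u.comp ρ)).shift u.length}
    (h1 : IsLeftMul 1 (lin ι')) (h3 : IsLeftMul (cls K S ρ) (lin π)) (h4 : IsLeftMul 1 (lin ι))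
    (h5 : IsLeftMul (cls K S u) (lin ξ)) (h6 : IsLeftMul 1 (lin j))
    (h7 : IsLeftMul (cls K S (u.comp ρ)) (lin q)) :
    ∃ φ : ((pathMod K S w).shift (-(ρ.length : ℤ))).prod (pathMod K S (ρ.comp (w.comp g))) ⟶
        (pathMod K S (Path.nil : Path b b)).shift (-(ρ.length : ℤ)),
      (∀ x, lin φ (lin (GrMod.lift ι' (-π')) x) = lin j x) ∧
        ∀ x, lin q (lin φ x) = lin ξ (lin (GrMod.desc π ι) x) := by
  let κ : (pathMod K S w).shift (-(ρ.length : ℤ)) ⟶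
      (pathMod K S (Path.nil : Path b b)).shift (-(ρ.length : ℤ)) :=
    lmulHom 1 w Path.nil _ _ (mem_pathIdeal_iff.2 ⟨cls K S w, by rw [one_mul, idem_mul_cls]⟩)
      (by rw [sub_self]; exact one_mem_algDeg)
  have hκ : IsLeftMul 1 (lin κ) := isLeftMul_lmulHom _ _ _ _ _ _ _
  have hx : ∀ (x : pathIdeal K S w) (y : pathIdeal K S (ρ.comp (w.comp g))),
      lin q (lin κ x) = lin ξ (lin π x + lin ι y) := by
    intro x y
    have hy : cls K S u * y.1 = 0 := by
      obtain ⟨y', hy'⟩ := mem_pathIdeal_iff.1 y.2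
      rw [hy', H.mul_eq_zero]
    refine Subtype.ext ((h7 _).trans (Eq.trans ?_ (h5 _).symm))
    refine (congrArg (cls K S (u.comp ρ) * ·) (hκ x)).trans ?_
    refine Eq.trans ?_ (congrArg (cls K S u * ·) (congrArg₂ (· + ·) (h3 x) (h4 y))).symm
    show cls K S (u.comp ρ) * (1 * x.1) = cls K S u * (cls K S ρ * x.1 + 1 * y.1)
    rw [one_mul, one_mul, mul_add, hy, add_zero, ← mul_assoc, cls_comp]
  refine ⟨GrMod.desc κ 0, fun x => ?_, fun x => ?_⟩
  · show lin κ (lin ι' x) + 0 = lin j x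
    rw [add_zero]
    refine Subtype.ext ((hκ _).trans (Eq.trans ?_ (h6 x).symm))
    rw [one_mul]
    exact h1 x
  · show lin q (lin κ x.1 + 0) = lin ξ (lin π x.1 + lin ι x.2)
    rw [add_zero]
    exact hx x.1 x.2

theorem hasTriangle [∀ a b : V, Finite (a ⟶ b)] (hS : IsAdmissible K S)
    (H : ARConfig K S u ρ w g v h) :
    HasTriangle K S ρ u (w.comp g) w (ρ.comp (w.comp g)) (ρ.comp w) (u.comp ρ) := by
  have hdeg0 : ∀ t : ℤ, (1 : Alg K S) ∈ algDeg K S (t - t) := fun t => by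
    rw [sub_self]
    exact one_mem_algDeg
  have hdegρ : cls K S ρ ∈ algDeg K S (0 - -(ρ.length : ℤ)) := by
    rw [sub_neg_eq_add, zero_add]
    exact cls_mem_algDeg ρ
  let ι' : (pathMod K S (w.comp g)).shift (-(ρ.length : ℤ)) ⟶
      (pathMod K S w).shift (-(ρ.length : ℤ)) :=
    lmulHom 1 _ _ _ _ (mem_pathIdeal_iff.2 ⟨cls K S g, by rw [one_mul, cls_comp]⟩) (hdeg0 _)
  let π' : (pathMod K S (w.comp g)).shift (-(ρ.length : ℤ)) ⟶ pathMod K S (ρ.comp (w.comp g)) :=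
    lmulHom (cls K S ρ) _ _ _ 0 (mem_pathIdeal_iff.2 ⟨1, by rw [mul_one, ← cls_comp]⟩) hdegρ ≫
      ofShiftZero _
  let π : (pathMod K S w).shift (-(ρ.length : ℤ)) ⟶ pathMod K S (ρ.comp w) :=
    lmulHom (cls K S ρ) _ _ _ 0 (mem_pathIdeal_iff.2 ⟨1, by rw [mul_one, ← cls_comp]⟩) hdegρ ≫
      ofShiftZero _
  let ι : pathMod K S (ρ.comp (w.comp g)) ⟶ pathMod K S (ρ.comp w) :=
    toShiftZero _ ≫ lmulHom 1 _ _ 0 0 (mem_pathIdeal_iff.2 ⟨cls K S g, by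
      rw [one_mul, ← cls_comp, Path.comp_assoc]⟩) (hdeg0 _) ≫ ofShiftZero _
  let ξ : pathMod K S (ρ.comp w) ⟶ (pathMod K S (u.comp ρ)).shift u.length :=
    toShiftZero _ ≫ lmulHom (cls K S u) _ _ 0 _ (mem_pathIdeal_iff.2 ⟨cls K S w, by
      rw [← cls_comp, ← cls_comp, Path.comp_assoc]⟩) (by rw [sub_zero]; exact cls_mem_algDeg u)
  let j : (pathMod K S (w.comp g)).shift (-(ρ.length : ℤ)) ⟶
      (pathMod K S (Path.nil : Path b b)).shift (-(ρ.length : ℤ)) :=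
    lmulHom 1 _ _ _ _ (mem_pathIdeal_iff.2 ⟨cls K S (w.comp g), by rw [one_mul, idem_mul_cls]⟩)
      (hdeg0 _)
  let q : (pathMod K S (Path.nil : Path b b)).shift (-(ρ.length : ℤ)) ⟶
      (pathMod K S (u.comp ρ)).shift u.length :=
    lmulHom (cls K S (u.comp ρ)) _ _ _ _ (mem_pathIdeal_iff.2 ⟨idem K S b, rfl⟩) (by
      have h1 := cls_mem_algDeg (K := K) (S := S) (u.comp ρ)
      rw [Path.length_comp] at h1
      rwa [sub_neg_eq_add, ← Nat.cast_add])
  have h1 : IsLeftMul 1 (lin ι') := fun _ => rfl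
  have h2 : IsLeftMul (cls K S ρ) (lin π') := fun _ => rfl
  have h3 : IsLeftMul (cls K S ρ) (lin π) := fun _ => rfl
  have h4 : IsLeftMul 1 (lin ι) := fun _ => rfl
  have h5 : IsLeftMul (cls K S u) (lin ξ) := fun _ => rfl
  have h6 : IsLeftMul 1 (lin j) := fun _ => rfl
  have h7 : IsLeftMul (cls K S (u.comp ρ)) (lin q) := fun _ => rfl
  have hA := isGproj_of_isPerfect H.perfect_left (-(ρ.length : ℤ))
  have hB₁ : ((pathMod K S w).shift (-(ρ.length : ℤ))).IsGproj := by
    rcases H.perfect_or_trivial with hw | hw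
    · exact isGproj_of_isPerfect hw _
    · obtain rfl := Path.eq_of_length_zero w hw
      obtain rfl := Path.eq_nil_of_length_zero w hw
      exact (pathMod_nil_isProjective _ _).isGproj
  have hB₂ : (pathMod K S (ρ.comp (w.comp g))).IsGproj := by
    rw [← shift_zero (pathMod K S (ρ.comp (w.comp g)))]
    rcases H.perfect_or_zero with h0 | h0
    · exact isGproj_of_isPerfect h0 0
    · exact (pathMod_isProjective_of_eq_zero h0 0).isGproj
  have hC : (pathMod K S (ρ.comp w)).IsGproj := by
    rw [← shift_zero (pathMod K S (ρ.comp w))]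
    exact isGproj_of_isPerfect H.perfect_mid 0
  have hT := isGproj_of_isPerfect H.perfect_susp (u.length : ℤ)
  have hjq : IsShortExact j q :=
    { injective := injective_of_isLeftMul_one h6
      exact := exact_lmul H.pair_susp rfl h6 h7
      surjective := surjective_of_isLeftMul h7 (cls_mul_idem _) }
  have hex := H.isShortExact h1 h2 h3 h4
  obtain ⟨φ, hφ, hφ'⟩ := H.isStandard (π' := π') h1 h3 h4 h5 h6 h7
  refine ⟨ι', π', π, ι, ξ, j, q, hA, hB₁.prod hB₂, hC, pathMod_nil_isProjective _ _, hT, hjq,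
    h1, h2, h3, h4, h5, h6, h7, hex, ?_, indecomposable_stObj H.perfect_left hA, ?_,
    H.stMap_ne_zero h5 h7 hC hT, ?_⟩
  · exact isDistinguished_of_isStandard ⟨GrMod.lift ι' (-π'), GrMod.desc π ι, φ, ξ, hex,
      lin_injective (LinearMap.ext hφ), lin_injective (LinearMap.ext hφ'), rfl, rfl, rfl⟩
  · have hC' := isGproj_of_isPerfect H.perfect_mid 0
    have key : ∀ (M : GrMod K S) (hM : M.IsGproj), M = (pathMod K S (ρ.comp w)).shift 0 →
        Indecomposable (stObj M hM) := by
      rintro M hM rfl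
      exact indecomposable_stObj H.perfect_mid hM
    exact key _ hC (shift_zero _).symm
  · rintro ⟨⟨M⟩, hM⟩ α hα
    have hM' : M.IsGproj := hM
    obtain ⟨F, rfl⟩ : ∃ F : M ⟶ pathMod K S (ρ.comp w),
        α = (stMap F : stObj M hM' ⟶ stObj _ hC) := exists_stMap_eq _
    -- The endomorphisms E for which the composite of E, F and ξ lifts to eΛ. Membership of the
    -- identity is what `exists_factorization` requires.
    let X : AddSubgroup (M ⟶ M) :=
      { carrier := {E | ∃ k : M ⟶ (pathMod K S (Path.nil : Path b b)).shift (-(ρ.length : ℤ)),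
          k ≫ q = E ≫ F ≫ ξ}
        add_mem' := by
          rintro E E' ⟨k, hk⟩ ⟨k', hk'⟩
          exact ⟨k + k', by rw [Preadditive.add_comp, Preadditive.add_comp, hk, hk']⟩
        zero_mem' := ⟨0, by rw [zero_comp, zero_comp]⟩
        neg_mem' := by
          rintro E ⟨k, hk⟩
          exact ⟨-k, by rw [Preadditive.neg_comp, Preadditive.neg_comp, hk]⟩ }
    have hX : 𝟙 M ∈ X := hM'.id_mem hS X fun {x₁ x₂} x t I R hx hIR => by
      rcases H.exists_lift_or_section hS (hM'.exists_isPerfectPair hS hx hIR) (I ≫ F) h5 h7 with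
        ⟨k, hk⟩ | ⟨σ, hσ⟩
      · have hk' : k ≫ q = (I ≫ F) ≫ ξ := lin_injective (LinearMap.ext hk)
        exact ⟨R ≫ k, by rw [Category.assoc, hk']; simp only [Category.assoc]⟩
      -- A section of F on one summand would make α a split epimorphism, so only the lifting
      -- alternative survives.
      · refine absurd ?_ hα
        refine ⟨⟨⟨(stMap (σ ≫ I) : stObj _ hC ⟶ stObj M hM'), ?_⟩⟩⟩
        have h8 : (σ ≫ I) ≫ F = 𝟙 _ := by rw [Category.assoc, hσ]
        exact (stMap_comp (hN := hM') (σ ≫ I) F).symm.trans (congrArg stMap h8)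
    obtain ⟨k, hk⟩ := hX
    rw [Category.id_comp] at hk
    obtain ⟨β, hβ⟩ := exists_factorization hex hjq hφ hφ' (f := F) (h := k)
      (LinearMap.congr_fun (congrArg lin hk))
    exact ⟨stMap β, (stMap_comp (hN := hB₁.prod hB₂) β _).symm.trans (congrArg stMap hβ)⟩

end ARConfig

/-- Replaces the composites of `ARConfig` by the brackets of the final statement, which have the
same underlying paths but syntactically different endpoints. -/
theorem HasTriangle.congr {a b a₁ b₁ a₂ b₂ a₃ b₃ a₄ b₄ a₅ b₅ a₆ b₆ : V}
    {ρ : Path a b} {u : Path a₁ b₁} {pA : Path a₂ b₂} {pB₁ : Path a₃ b₃} {pB₂ : Path a₄ b₄}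
    {pC : Path a₅ b₅} {pT : Path a₆ b₆} {a₁' b₁' a₂' b₂' a₃' b₃' a₄' b₄' a₅' b₅' a₆' b₆' : V}
    {u' : Path a₁' b₁'} {pA' : Path a₂' b₂'} {pB₁' : Path a₃' b₃'} {pB₂' : Path a₄' b₄'}
    {pC' : Path a₅' b₅'} {pT' : Path a₆' b₆'} (h : HasTriangle K S ρ u pA pB₁ pB₂ pC pT)
    (h1 : tot u = tot u') (h2 : tot pA = tot pA') (h3 : tot pB₁ = tot pB₁')
    (h4 : tot pB₂ = tot pB₂') (h5 : tot pC = tot pC') (h6 : tot pT = tot pT') :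
    HasTriangle K S ρ u' pA' pB₁' pB₂' pC' pT' := by
  cases h1
  cases h2
  cases h3
  cases h4
  cases h5
  cases h6
  exact h

namespace CyclicSeq

variable {r : CyclicSeq V}

/-- Here p has m + 1 factors, so w has m and k = m_c - (m + 1) counts the factors of both u and v.
All fields are instances of `perfect_segments`; the path h may be taken to be v, since the successor
of r_i has m_c = m + 1 + k factors. -/
theorem exists_arConfig [∀ a b : V, Finite (a ⟶ b)] (hS : IsAdmissible K S)
    (hc : IsUnderlyingCycle K S r.total) (hr : ∀ k : ℤ, IsMinPerfect K S (r.path k)) (i : ℤ)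
    (m k : ℕ) (hm : m + k + 1 = numPerfect K S r) :
    ∃ (s c d e f : V) (u : Path s (r.vert i)) (w : Path (r.vert (i + 1)) c) (g : Path c d)
      (v : Path d e) (h : Path d f), ARConfig K S u (r.path i) w g v h ∧
      tot u = tot (r.seg (i - k) k) ∧ tot w = tot (r.seg (i + 1) m) ∧
      tot g = tot (r.seg (i + 1 + m) 1) := by
  obtain ⟨hp, hs⟩ := perfect_segments hS hc hr
  rw [← hm] at hp hs
  obtain ⟨s, u, hu⟩ := exists_seg_of_target (r := r) (j := i - k) (k := k)
    (congrArg r.vert (sub_add_cancel i (k : ℤ)))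
  obtain ⟨c, w, hw⟩ := exists_seg_of_source (r := r) (j := i + 1) rfl m
  obtain ⟨d, g, hg⟩ := exists_seg_of_source (target_eq hw) 1
  obtain ⟨e, v, hv⟩ := exists_seg_of_source (target_eq hg) k
  have hρ : tot (r.path i) = tot (r.seg i 1) := (r.tot_seg_one i).symm
  have hρw : tot ((r.path i).comp w) = tot (r.seg i (1 + m)) := r.tot_comp_seg hρ hw
  have hwg : tot (w.comp g) = tot (r.seg (i + 1) (m + 1)) := r.tot_comp_seg hw hg
  have hρwg : tot ((r.path i).comp (w.comp g)) = tot (r.seg i (1 + (m + 1))) :=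
    r.tot_comp_seg hρ hwg
  have huρ : tot (u.comp (r.path i)) = tot (r.seg (i - k) (k + 1)) :=
    r.tot_comp_seg hu (hρ.trans (tot_seg_congr (by ring) 1))
  have hgv : tot (g.comp v) = tot (r.seg (i + 1 + m) (1 + k)) := r.tot_comp_seg hg hv
  have hwgv : tot (w.comp (g.comp v)) = tot (r.seg (i + 1) (m + (1 + k))) := r.tot_comp_seg hw hgv
  have hwgv' : tot ((w.comp g).comp v) = tot (r.seg (i + 1) (m + (1 + k))) := by
    rw [Path.comp_assoc, hwgv]
  refine ⟨s, c, d, e, e, u, w, g, v, v,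
    { minimal_left := hr i
      minimal_right := ?_
      perfect_mid := ?_
      perfect_left := ?_
      perfect_susp := ?_
      perfect_or_trivial := ?_
      perfect_or_zero := ?_
      pair_mid := ?_
      pair_susp := ?_
      pair_left := ?_
      ne_zero := ?_ }, hu, hw, hg⟩
  · exact (hr _).congr (hg.trans (r.tot_seg_one _))
  · rw [hρw]
    exact (hp _ _ (by omega)).2 (by omega)
  · rw [hwg]
    exact (hp _ _ (by omega)).2 (by omega)
  · rw [huρ]
    exact (hp _ _ (by omega)).2 (by omega)
  · rcases Nat.eq_zero_or_pos m with h0 | h0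
    · right
      subst h0
      have h1 : w.length = (r.seg (i + 1) 0).length := congrArg TPath.len hw
      rw [h1]
      exact congrArg TPath.len (tot_cast rfl _ (Path.nil : Path (r.vert (i + 1)) _))
    · left
      rw [hw]
      exact (hp _ _ h0).2 (by omega)
  · rcases Nat.eq_zero_or_pos k with h0 | h0
    · right
      -- For k = 0 the path p has the maximal number of factors, so its successor is the single
      -- letter g and ρwg = 0.
      have h1 := hs i (1 + m) (by omega) (by omega)
      rw [← hρw, show m + k + 1 + 1 - (1 + m) = 1 by omega,
        tot_seg_congr (show i + ((1 + m : ℕ) : ℤ) = i + 1 + m by push_cast; ring), ← hg,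
        perfectSucc_tot] at h1
      rw [← Path.comp_assoc]
      exact h1.comp_eq_zero
    · left
      rw [hρwg]
      exact (hp _ _ (by omega)).2 (by omega)
  · have h1 := hs i (1 + m) (by omega) (by omega)
    rwa [← hρw, show m + k + 1 + 1 - (1 + m) = 1 + k by omega,
      tot_seg_congr (show i + ((1 + m : ℕ) : ℤ) = i + 1 + m by push_cast; ring), ← hgv,
      perfectSucc_tot] at h1
  · have h1 := hs (i - k) (k + 1) (by omega) (by omega)
    rwa [← huρ, show m + k + 1 + 1 - (k + 1) = m + 1 by omega,
      tot_seg_congr (show i - k + ((k + 1 : ℕ) : ℤ) = i + 1 by push_cast; ring), ← hwg,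
      perfectSucc_tot] at h1
  · have h1 := hs i 1 (by omega) (by omega)
    rwa [← hρ, show m + k + 1 + 1 - 1 = m + (1 + k) by omega, Nat.cast_one, ← hwgv',
      perfectSucc_tot] at h1
  · refine MonAlg.IsPerfect.ne_zero ?_
    rw [hwgv]
    exact (hp _ _ (by omega)).2 (by omega)

end CyclicSeq

end

end Main

end MonAlg


theorem mainTheorem4 {K : Type w} [Field K] {V : Type u} [Quiver.{v} V] [Fintype V]
    [∀ a b : V, Finite (a ⟶ b)] (S : Set (TPath V)) (hS : IsAdmissible K S)
    (r : CyclicSeq V) (hc : IsUnderlyingCycle K S r.total)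
    (hr : ∀ k : ℤ, IsCoelementary K S (tot (r.path k)))
    (i : ℤ) (m : ℕ) (hm : 0 < m) (hp : IsPerfect K S (tot (r.bracket i (i + m - 1)))) :
    let mc : ℤ := numPerfect K S r
    let l : ℤ := (r.path i).length
    let s : ℤ := (r.bracket (i + m - mc) (i - 1)).length
    let A : GrMod K S := (pathMod K S (r.bracket (i + 1) (i + m))).shift (-l)
    let B₁ : GrMod K S := (pathMod K S (r.bracket (i + 1) (i + m - 1))).shift (-l)
    let B₂ : GrMod K S := pathMod K S (r.bracket i (i + m))
    let C : GrMod K S := pathMod K S (r.bracket i (i + m - 1))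
    let I : GrMod K S :=
      (pathMod K S (Quiver.Path.nil : Quiver.Path (r.vert (i + 1)) (r.vert (i + 1)))).shift (-l)
    let SA : GrMod K S := (pathMod K S (r.bracket (i + m - mc) i)).shift s
    ∃ (ι' : A ⟶ B₁) (π' : A ⟶ B₂) (π : B₁ ⟶ C) (ι : B₂ ⟶ C) (ξ : C ⟶ SA)
      (j : A ⟶ I) (q : I ⟶ SA)
      (hA : A.IsGproj) (hB : (B₁.prod B₂).IsGproj) (hC : C.IsGproj)
      (hI : I.IsProjective) (hSA : SA.IsGproj) (hjq : GrMod.IsShortExact j q),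
      IsLeftMul 1 (GrMod.lin ι') ∧
      IsLeftMul (cls K S (r.path i)) (GrMod.lin π') ∧
      IsLeftMul (cls K S (r.path i)) (GrMod.lin π) ∧
      IsLeftMul 1 (GrMod.lin ι) ∧
      IsLeftMul (cls K S (r.bracket (i + m - mc) (i - 1))) (GrMod.lin ξ) ∧
      IsLeftMul 1 (GrMod.lin j) ∧
      IsLeftMul (cls K S (r.bracket (i + m - mc) i)) (GrMod.lin q) ∧
      GrMod.IsShortExact (GrMod.lift ι' (-π')) (GrMod.desc π ι) ∧
      StTriangle.IsAuslanderReiten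
        { A := A, B := B₁.prod B₂, C := C, hA := hA, hB := hB, hC := hC
          σ := { I := I, susp := SA, incl := j, proj := q, isProjective := hI, isGproj := hSA,
                 isShortExact := hjq }
          f := stMap (GrMod.lift ι' (-π'))
          g := stMap (GrMod.desc π ι)
          h := stMap ξ } := by
  have hr' : ∀ k : ℤ, IsMinPerfect K S (r.path k) := fun k => (hr k).isMinPerfect
  have hm' : m ≤ numPerfect K S r := by
    rw [CyclicSeq.tot_bracket (k := m) (by ring)] at hp
    exact ((CyclicSeq.perfect_segments hS hc hr').1 i m hm).1 hp
  -- From here on m is one less than in the statement: it counts the factors of w rather than those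
  -- of p.
  obtain ⟨m, rfl⟩ := Nat.exists_eq_succ_of_ne_zero hm.ne'
  obtain ⟨k, hk⟩ := Nat.exists_eq_add_of_le hm'
  have hk' : (numPerfect K S r : ℤ) = m + 1 + k := by rw [hk]; push_cast; ring
  obtain ⟨s, c, d, e, f, u, w, g, v, h, H, hu, hw, hg⟩ :=
    CyclicSeq.exists_arConfig hS hc hr' i m k (by omega)
  have hρ : tot (r.path i) = tot (r.seg i 1) := (r.tot_seg_one i).symm
  have hwg : tot (w.comp g) = tot (r.seg (i + 1) (m + 1)) := r.tot_comp_seg hw hg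
  have e1 : i + ((m + 1 : ℕ) : ℤ) - (numPerfect K S r : ℤ) = i - k := by
    rw [hk']
    push_cast
    ring
  refine (H.hasTriangle hS).congr ?_ ?_ ?_ ?_ ?_ ?_
  · rw [hu, CyclicSeq.tot_bracket (k := k) (by push_cast; omega)]
    exact CyclicSeq.tot_seg_congr e1.symm k
  · rw [hwg, CyclicSeq.tot_bracket (k := m + 1) (by push_cast; ring)]
  · rw [hw, CyclicSeq.tot_bracket (k := m) (by push_cast; ring)]
  · rw [r.tot_comp_seg hρ hwg, CyclicSeq.tot_bracket (k := 1 + (m + 1)) (by push_cast; ring)]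
  · rw [r.tot_comp_seg hρ hw, CyclicSeq.tot_bracket (k := 1 + m) (by push_cast; ring)]
  · rw [r.tot_comp_seg hu (hρ.trans (CyclicSeq.tot_seg_congr (by ring) 1)),
      CyclicSeq.tot_bracket (k := k + 1) (by push_cast; omega)]
    exact CyclicSeq.tot_seg_congr e1.symm (k + 1)
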